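/- For a continuous function $h:\mathbb R\to[0,\infty)$ let $\Omega_h=\{(x,y)\in\mathbb R^2: 0<y<h(x)\}$. For $V>0$ let $\mathcal A_V$ be the set of pairs $(u,h)$ such that $h\in H^1(\mathbb R)$ (identified with its continuous representative), $h\ge 0$, $\int_{\mathbb R}h\,dx=V$, $u\in H^1(\Omega_h)$, and $u(x,0)=x$ for a.e. $x$ with $h(x)>0$ in the sense of traces. Put $$F_s(V)=\inf\Big\{\int_{\Omega_h}|\nabla u|^2\,dx\,dy+\int_{\mathbb R}(h')^2\,dx\ :\ (u,h)\in\mathcal A_V\Big\}.$$ Then there is a largest number $\overline V>0$ such that $F_s(V)=V$ for all $0<V\le\overline V$; for every $V>0$ one has $V>\overline V$ if and only if $F_s(V)<V$; and for every $V>\overline V$ the infimum $F_s(V)$ is attained, i.e. there is a pair $(u,h)\in\mathcal A_V$ with $\int_{\Omega_h}|\nabla u|^2\,dx\,dy+\int_{\mathbb R}(h')^2\,dx=F_s(V)$. -/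

import Mathlib

open MeasureTheory Set
open scoped ContDiff

noncomputable section

namespace EpitaxialFilm

/-- `φ` is a smooth function with compact support contained in `Ω`. -/
def IsTestFunction {E : Type*} [NormedAddCommGroup E] [NormedSpace ℝ E]
    (Ω : Set E) (φ : E → ℝ) : Prop :=
  ContDiff ℝ ∞ φ ∧ HasCompactSupport φ ∧ tsupport φ ⊆ Ω

/-- The locally integrable function `w` is the weak derivative of the locally integrable
function `u` in the direction `v` on the open set `Ω`. -/
def HasWeakDerivOn {E : Type*} [NormedAddCommGroup E] [NormedSpace ℝ E] [MeasureSpace E]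
    (Ω : Set E) (u : E → ℝ) (v : E) (w : E → ℝ) : Prop :=
  LocallyIntegrableOn u Ω volume ∧ LocallyIntegrableOn w Ω volume ∧
    ∀ φ : E → ℝ, IsTestFunction Ω φ →
      ∫ x in Ω, u x * fderiv ℝ φ x v = -∫ x in Ω, w x * φ x

/-- Weak derivatives on open sets are unique up to null sets. -/
theorem HasWeakDerivOn.ae_eq {E : Type*} [NormedAddCommGroup E] [NormedSpace ℝ E]
    [FiniteDimensional ℝ E] [MeasureSpace E] [BorelSpace E]
    {Ω : Set E} (hΩ : IsOpen Ω) {u : E → ℝ} {v : E} {w₁ w₂ : E → ℝ}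
    (h₁ : HasWeakDerivOn Ω u v w₁) (h₂ : HasWeakDerivOn Ω u v w₂) :
    ∀ᵐ x ∂(volume : Measure E), x ∈ Ω → w₁ x = w₂ x := by
  have hint : ∀ (w φ : E → ℝ), LocallyIntegrableOn w Ω volume → IsTestFunction Ω φ →
      Integrable (fun x => w x * φ x) (volume.restrict Ω) := by
    intro w φ hw hφ
    have hK : IntegrableOn w (tsupport φ) volume :=
      hw.integrableOn_compact_subset hφ.2.2 hφ.2.1
    have h1 : IntegrableOn (fun x => w x * φ x) (tsupport φ) volume :=
      hK.mul_continuousOn hφ.1.continuous.continuousOn hφ.2.1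
    have h2 : Integrable (fun x => w x * φ x) volume :=
      (integrableOn_iff_integrable_of_support_subset (by
        intro x hx
        apply subset_tsupport
        intro h0
        exact hx (by simp [h0]))).1 h1
    exact h2.integrableOn
  have key := hΩ.ae_eq_zero_of_integral_contDiff_smul_eq_zero (μ := (volume : Measure E))
    (f := fun x => w₁ x - w₂ x) (h₁.2.1.sub h₂.2.1) (by
      intro g hg hgc hgs
      have ht : IsTestFunction Ω g := ⟨hg, hgc, hgs⟩
      have e1 := h₁.2.2 g ht
      have e2 := h₂.2.2 g ht
      have e3 : ∫ x, g x • (w₁ x - w₂ x) = ∫ x in Ω, g x • (w₁ x - w₂ x) := by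
        symm
        apply setIntegral_eq_integral_of_forall_compl_eq_zero
        intro x hx
        have : g x = 0 := image_eq_zero_of_notMem_tsupport (fun h => hx (hgs h))
        simp [this]
      rw [e3]
      have e4 : ∫ x in Ω, g x • (w₁ x - w₂ x)
          = (∫ x in Ω, w₁ x * g x) - ∫ x in Ω, w₂ x * g x := by
        rw [← integral_sub (hint w₁ g h₁.2.1 ht) (hint w₂ g h₂.2.1 ht)]
        congr 1
        funext x
        simp only [smul_eq_mul]
        ring
      rw [e4]
      linarith)
  filter_upwards [key] with x hx hxΩ
  have := hx hxΩ
  linarith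

open Classical in
/-- The weak derivative of `u` in the direction `v` on the open set `Ω` (zero if there is none);
it is determined up to null sets. -/
def weakDeriv {E : Type*} [NormedAddCommGroup E] [NormedSpace ℝ E] [MeasureSpace E]
    (Ω : Set E) (u : E → ℝ) (v : E) : E → ℝ :=
  if hw : ∃ w, HasWeakDerivOn Ω u v w then hw.choose else 0

/-- The Sobolev space `H¹(Ω)`: `u` and all its weak first derivatives exist in `L²(Ω)`. -/
def MemH1 {E : Type*} [NormedAddCommGroup E] [NormedSpace ℝ E] [MeasureSpace E]
    (Ω : Set E) (u : E → ℝ) : Prop :=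
  MemLp u 2 (volume.restrict Ω) ∧
    ∀ v : E, ∃ w : E → ℝ, HasWeakDerivOn Ω u v w ∧ MemLp w 2 (volume.restrict Ω)

/-- The region `Ω_h = {(x, y) : 0 < y < h x}` occupied by the film. -/
def film (h : ℝ → ℝ) : Set (ℝ × ℝ) :=
  {p | 0 < p.2 ∧ p.2 < h p.1}

/-- The weak partial derivative `∂ₓu` in the film. -/
def dx (h : ℝ → ℝ) (u : ℝ × ℝ → ℝ) : ℝ × ℝ → ℝ := weakDeriv (film h) u (1, 0)

/-- The weak partial derivative `∂_y u` in the film. -/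
def dy (h : ℝ → ℝ) (u : ℝ × ℝ → ℝ) : ℝ × ℝ → ℝ := weakDeriv (film h) u (0, 1)

/-- The trace of `u ∈ H¹(Ω_h)` on the flat part `{h > 0} × {0}` of the boundary is `f`,
expressed by Green's formula. The test functions are those with compact support in the open set
`{(x, y) : h x > 0, y < h x}`: they need not vanish on `{h > 0} × {0}`, but they vanish near the
rest of the boundary of `Ω_h`. -/
def HasBaseTrace (h : ℝ → ℝ) (u : ℝ × ℝ → ℝ) (f : ℝ → ℝ) : Prop :=
  ∀ φ : ℝ × ℝ → ℝ, IsTestFunction {p : ℝ × ℝ | 0 < h p.1 ∧ p.2 < h p.1} φ →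
    ∫ p in film h, (u p * fderiv ℝ φ p (0, 1) + dy h u p * φ p) = -∫ x, f x * φ (x, 0)

/-- The admissible pairs `(u, h)` of volume `V`. The profile `h ∈ H¹(ℝ)` is given by its continuous
representative; only the values of `u` in `Ω_h` matter. -/
def admissible (V : ℝ) : Set ((ℝ × ℝ → ℝ) × (ℝ → ℝ)) :=
  {q | Continuous q.2 ∧ MemH1 univ q.2 ∧ (∀ x, 0 ≤ q.2 x) ∧
    Integrable q.2 ∧ ∫ x, q.2 x = V ∧
    MemH1 (film q.2) q.1 ∧ HasBaseTrace q.2 q.1 (fun x => x)}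

/-- The total energy `∫_{Ω_h} |∇u|² + ∫_ℝ (h')²` of the pair `(u, h)`. -/
def energy (q : (ℝ × ℝ → ℝ) × (ℝ → ℝ)) : ℝ :=
  (∫ p in film q.2, ((dx q.2 q.1 p) ^ 2 + (dy q.2 q.1 p) ^ 2)) +
    ∫ x, (weakDeriv univ q.2 1 x) ^ 2

/-- The minimal energy `F_s(V)`. -/
def Fs (V : ℝ) : ℝ := sInf (energy '' admissible V)

/-- The pair `q = (u, h)` is a minimizer of the small slope problem with volume `V`. -/
def IsMinimizer (V : ℝ) (q : (ℝ × ℝ → ℝ) × (ℝ → ℝ)) : Prop :=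
  q ∈ admissible V ∧ IsMinOn energy (admissible V) q

/-- `Vbar` is the critical volume: the largest positive number such that `F_s(V) = V` for all
`0 < V ≤ Vbar`. -/
def IsCriticalVolume (Vbar : ℝ) : Prop :=
  IsGreatest {W : ℝ | 0 < W ∧ ∀ V : ℝ, 0 < V → V ≤ W → Fs V = V} Vbar

end EpitaxialFilm

end

noncomputable section

namespace EpitaxialFilm

open Filter Topology

/-! Write (P, Q) for the gradient of u and g for h'. The field (1, g) is tangential to the free
surface and u = x on the substrate, so the divergence theorem gives the flux identity ∫_film (P +
gQ) = V (`integral_flux`). Since 2(P + gQ) ≤ P² + Q² + g² + 1, integration yields V ≤ ∫_film (P² +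
Q²) + ∫ h g², hence energy ≥ V whenever h ≤ 1 (`volume_le_energy`). A profile with surface energy at
most T satisfies h³ ≤ 8TV, so for small V either the surface energy alone is at least V or h ≤ 1;
thus `Fs V` ≥ V for small V. Low and wide films with u = x give `Fs V` ≤ V for every V > 0.

Under a homothety of ratio l, volume and elastic energy scale like l² and surface energy like l.
Hence `Fs V` / V does not increase with V (`mul_Fs_le`), a strict inequality `Fs V` < V survives a
slight shrinking (`exists_lt_Fs_lt_self`), and a sheared film that lowers the elastic energy wins
over its surface energy once it is large (`exists_Fs_lt_self`). So {V > 0 : `Fs V` < V} is an open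
half line with a positive endpoint, the critical volume.

For existence when `Fs V` < V, the danger is that minimizing films spread out or split. A near
minimizer is cut at a small height δ. The flux inequality, applied in the removed bottom layer,
shows that the removed volume is paid for by the removed energy up to an error of order δ
(`exists_excursion_decomposition`). With the monotone ratio this bounds the removed volume by a
constant times δ. Some excursion must have a good ratio of energy to volume, and its base has
bounded length, because the slab of height δ below it was removed. Its volume is bounded below,
since low films gain nothing, so it can be enlarged to volume V with controlled energy and base
(`exists_near_minimizer_bounded_base`).

On a fixed bounded base the slopes and the gradients, extended by zero, have weak L² limits. The
limit displacement is rebuilt as x plus the vertical primitive of the limit of Q. That its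
horizontal derivative is the limit of P is checked with test functions satisfying ∂_yΦ = ∂_xφ, so no
convergence of u is needed (`exists_limit_film`). -/

/-! ### Weak derivatives of continuous functions on the line -/

/-- A continuous primitive can be integrated by parts against a test function. -/
theorem integral_mul_deriv_of_primitive {h g φ : ℝ → ℝ} (hg : LocallyIntegrable g)
    (hftc : ∀ a b, h b - h a = ∫ x in a..b, g x) (hφ : ContDiff ℝ 1 φ)
    (hφc : HasCompactSupport φ) :
    ∫ x, h x * deriv φ x = -∫ x, g x * φ x := by
  obtain ⟨R, hR⟩ := hφc.isCompact.isBounded.subset_closedBall (0 : ℝ)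
  set r := max R 0 + 1 with hr
  have hr0 : 0 < r := by positivity
  have hzero : ∀ x, x ∉ Ioo (-r) r → φ x = 0 := by
    intro x hx
    apply image_eq_zero_of_notMem_tsupport
    intro hx'
    have := hR hx'
    rw [Metric.mem_closedBall, Real.dist_eq, sub_zero, abs_le] at this
    exact hx ⟨by have := le_max_left R 0; linarith, by have := le_max_left R 0; linarith⟩
  have hzero' : ∀ x, x ∉ Ioo (-r) r → deriv φ x = 0 := by
    intro x hx
    apply image_eq_zero_of_notMem_tsupport
    intro hx'
    have := hR (tsupport_deriv_subset hx')
    rw [Metric.mem_closedBall, Real.dist_eq, sub_zero, abs_le] at this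
    exact hx ⟨by have := le_max_left R 0; linarith, by have := le_max_left R 0; linarith⟩
  have hloc : ∀ a b, IntervalIntegrable g volume a b := fun a b =>
    (hg.integrableOn_isCompact isCompact_uIcc).intervalIntegrable
  have hh : h = fun x => h 0 + ∫ t in (0:ℝ)..x, g t := by
    funext x; rw [← hftc]; ring
  have hac : AbsolutelyContinuousOnInterval h (-r) r := by
    have h1 := (hloc (-r) r).absolutelyContinuousOnInterval_intervalIntegral (c := 0)
      (by rw [uIcc_of_le (by linarith)]; exact ⟨by linarith, by linarith⟩)
    have h2 : AbsolutelyContinuousOnInterval (fun _ : ℝ => h 0) (-r) r :=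
      (contDiff_const (n := 1)).contDiffOn.absolutelyContinuousOnInterval
    rw [hh]
    exact h2.add h1
  have hφac : AbsolutelyContinuousOnInterval φ (-r) r :=
    hφ.contDiffOn.absolutelyContinuousOnInterval
  have key := hac.integral_mul_deriv_eq_deriv_mul hφac
  have hd : ∀ᵐ x, deriv h x = g x := by
    filter_upwards [LocallyIntegrable.ae_hasDerivAt_integral hg] with x hx
    rw [hh]
    exact ((hx 0).const_add (h 0)).deriv
  have e1 : ∫ x, h x * deriv φ x = ∫ x in (-r)..r, h x * deriv φ x := by
    rw [intervalIntegral.integral_of_le (by linarith)]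
    refine (setIntegral_eq_integral_of_forall_compl_eq_zero fun x hx => ?_).symm
    rw [hzero' x (fun h' => hx ⟨h'.1, h'.2.le⟩), mul_zero]
  have e2 : ∫ x, g x * φ x = ∫ x in (-r)..r, deriv h x * φ x := by
    rw [intervalIntegral.integral_of_le (by linarith)]
    rw [setIntegral_eq_integral_of_forall_compl_eq_zero (fun x hx => by
      rw [hzero x (fun h' => hx ⟨h'.1, h'.2.le⟩), mul_zero])]
    refine integral_congr_ae ?_
    filter_upwards [hd] with x hx
    rw [hx]
  rw [e1, e2, key, hzero r (by simp), hzero (-r) (by simp)]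
  ring

/-- A continuous function with vanishing weak derivative is constant. -/
theorem const_of_integral_mul_deriv_eq_zero {d : ℝ → ℝ} (hd : Continuous d)
    (h0 : ∀ φ : ℝ → ℝ, ContDiff ℝ ∞ φ → HasCompactSupport φ → ∫ x, d x * deriv φ x = 0) :
    ∃ c, ∀ x, d x = c := by
  let f : ContDiffBump (0 : ℝ) := ⟨1, 2, one_pos, one_lt_two⟩
  set ψ₀ := f.normed volume with hψ₀
  have hψs : ContDiff ℝ ∞ ψ₀ := f.contDiff_normed
  have hψc : HasCompactSupport ψ₀ := f.hasCompactSupport_normed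
  have hψ1 : ∫ x, ψ₀ x = 1 := f.integral_normed
  refine ⟨∫ x, d x * ψ₀ x, ?_⟩
  set c := ∫ x, d x * ψ₀ x with hc
  have hii : ∀ ψ : ℝ → ℝ, Continuous ψ → HasCompactSupport ψ →
      Integrable fun x => d x * ψ x := fun ψ h1 h2 =>
    (hd.mul h1).integrable_of_hasCompactSupport h2.mul_left
  have key : ∀ᵐ x : ℝ, d x - c = 0 := by
    refine ae_eq_zero_of_integral_contDiff_smul_eq_zero (μ := volume)
      (hd.sub continuous_const).locallyIntegrable ?_
    intro ψ hs hcs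
    set m := ∫ x, ψ x with hm
    -- Removing the mean makes θ the derivative of a test function. The hypothesis applied to its
    -- primitive says that `d` and the constant `c` have the same integral against `ψ`.
    set θ : ℝ → ℝ := fun x => ψ x - m * ψ₀ x with hθ
    have hθs : ContDiff ℝ ∞ θ := hs.sub (contDiff_const.mul hψs)
    have hθc : HasCompactSupport θ := hcs.sub hψc.mul_left
    have hψi : Integrable ψ := hs.continuous.integrable_of_hasCompactSupport hcs
    have hψ₀i : Integrable ψ₀ := hψs.continuous.integrable_of_hasCompactSupport hψc
    have hθi : Integrable θ := hψi.sub (hψ₀i.const_mul m)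
    have hθ0 : ∫ x, θ x = 0 := by
      rw [hθ, integral_sub hψi (hψ₀i.const_mul m), integral_const_mul, hψ1]; ring
    obtain ⟨R, hR⟩ := hθc.isCompact.isBounded.subset_closedBall (0 : ℝ)
    have hzero : ∀ x, x ∉ Icc (-R) R → θ x = 0 := by
      intro x hx
      apply image_eq_zero_of_notMem_tsupport
      intro hx'
      have := hR hx'
      rw [Metric.mem_closedBall, Real.dist_eq, sub_zero, abs_le] at this
      exact hx this
    set φ : ℝ → ℝ := fun x => ∫ t in (-R - 1)..x, θ t with hφ
    have hder : ∀ x, HasDerivAt φ (θ x) x := fun x =>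
      intervalIntegral.integral_hasDerivAt_right (hθs.continuous.intervalIntegrable _ _)
        (hθs.continuous.stronglyMeasurableAtFilter _ _) hθs.continuous.continuousAt
    have hdφ : deriv φ = θ := funext fun x => (hder x).deriv
    have hφs : ContDiff ℝ ∞ φ := by
      rw [contDiff_infty_iff_deriv, hdφ]
      exact ⟨fun x => (hder x).differentiableAt, hθs⟩
    have hφc : HasCompactSupport φ := by
      refine HasCompactSupport.of_support_subset_isCompact (isCompact_Icc (a := -R - 1) (b := R)) ?_
      intro x hx
      by_contra hx'
      apply hx
      rw [mem_Icc, not_and_or, not_le, not_le] at hx'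
      simp only [hφ]
      rcases hx' with hx' | hx'
      · rw [intervalIntegral.integral_of_ge hx'.le]
        rw [setIntegral_eq_zero_of_forall_eq_zero, neg_zero]
        intro t ht
        exact hzero t (fun h => by have := h.1; have := ht.2; linarith)
      -- The radius `R` may be negative; then θ vanishes and the base point -R - 1 can lie to the
      -- right of `x`.
      · by_cases hRx : -R - 1 ≤ x
        · rw [intervalIntegral.integral_of_le hRx, ← hθ0]
          refine setIntegral_eq_integral_of_forall_compl_eq_zero fun t ht => hzero t fun h => ?_
          exact ht ⟨by have := h.1; linarith, by have := h.2; linarith⟩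
        · rw [intervalIntegral.integral_of_ge (by linarith)]
          rw [setIntegral_eq_zero_of_forall_eq_zero, neg_zero]
          intro t ht
          exact hzero t (fun h => by have := h.1; have := ht.2; linarith)
    have h1 := h0 φ hφs hφc
    rw [hdφ] at h1
    have h2 : ∫ x, d x * θ x = (∫ x, d x * ψ x) - m * c := by
      rw [hc, ← integral_const_mul, ← integral_sub (hii ψ hs.continuous hcs)
        ((hii ψ₀ hψs.continuous hψc).const_mul m)]
      congr 1; funext x; simp only [hθ]; ring
    have h3 : ∫ x, ψ x • (d x - c) = (∫ x, d x * ψ x) - m * c := by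
      rw [hm, ← integral_mul_const, ← integral_sub (hii ψ hs.continuous hcs) (hψi.mul_const c)]
      congr 1; funext x; simp only [smul_eq_mul]; ring
    rw [h3, ← h2, h1]
  have := (hd.sub continuous_const).ae_eq_iff_eq volume (continuous_const (y := (0:ℝ))) |>.1 key
  intro x
  have h := congrFun this x
  simp at h
  linarith

/-- A continuous function with locally integrable weak derivative is a primitive of it. -/
theorem primitive_of_hasWeakDerivOn {h g : ℝ → ℝ} (hh : Continuous h)
    (hw : HasWeakDerivOn univ h 1 g) (a b : ℝ) : h b - h a = ∫ x in a..b, g x := by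
  have hg : LocallyIntegrable g := locallyIntegrableOn_univ.1 hw.2.1
  have hloc : ∀ a b, IntervalIntegrable g volume a b := fun a b =>
    (hg.integrableOn_isCompact isCompact_uIcc).intervalIntegrable
  set H : ℝ → ℝ := fun x => ∫ t in (0:ℝ)..x, g t with hH
  have hHc : Continuous H := intervalIntegral.continuous_primitive hloc 0
  have hHf : ∀ a b, H b - H a = ∫ x in a..b, g x := fun a b =>
    intervalIntegral.integral_interval_sub_left (hloc _ _) (hloc _ _)
  obtain ⟨c, hc⟩ := const_of_integral_mul_deriv_eq_zero (hh.sub hHc) (by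
    intro φ hφ hφc
    have h1 := integral_mul_deriv_of_primitive hg hHf (hφ.of_le (by exact_mod_cast le_top)) hφc
    have h2 := hw.2.2 φ ⟨hφ, hφc, subset_univ _⟩
    simp only [Measure.restrict_univ, fderiv_apply_one_eq_deriv] at h2
    have hdc : Continuous (deriv φ) := hφ.continuous_deriv (by simp)
    have e : ∫ x, (h - H) x * deriv φ x
        = (∫ x, h x * deriv φ x) - ∫ x, H x * deriv φ x := by
      have i1 : Integrable fun x => h x * deriv φ x :=
        (hh.mul hdc).integrable_of_hasCompactSupport hφc.deriv.mul_left
      have i2 : Integrable fun x => H x * deriv φ x :=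
        (hHc.mul hdc).integrable_of_hasCompactSupport hφc.deriv.mul_left
      rw [← integral_sub i1 i2]
      congr 1; funext x; simp only [Pi.sub_apply]; ring
    rw [e, h1, h2]; ring)
  rw [← hHf]
  have h1 := hc a
  have h2 := hc b
  simp only [Pi.sub_apply] at h1 h2
  linarith

/-- A primitive of a locally integrable function has it as weak derivative. -/
theorem hasWeakDerivOn_of_primitive {h g : ℝ → ℝ} (hh : Continuous h) (hg : LocallyIntegrable g)
    (hftc : ∀ a b, h b - h a = ∫ x in a..b, g x) (v : ℝ) :
    HasWeakDerivOn univ h v (fun x => v * g x) := by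
  refine ⟨locallyIntegrableOn_univ.2 hh.locallyIntegrable,
    locallyIntegrableOn_univ.2 (hg.smul v), ?_⟩
  intro φ hφ
  have h1 := integral_mul_deriv_of_primitive hg hftc
    (hφ.1.of_le (by exact_mod_cast le_top)) hφ.2.1
  simp only [Measure.restrict_univ]
  have e : ∀ x, fderiv ℝ φ x v = v * deriv φ x := fun x => by
    rw [← fderiv_apply_one_eq_deriv, ← smul_eq_mul, ← map_smul, smul_eq_mul, mul_one]
  simp only [e]
  have e1 : ∀ x, h x * (v * deriv φ x) = v * (h x * deriv φ x) := fun x => by ring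
  have e2 : ∀ x, v * g x * φ x = v * (g x * φ x) := fun x => by ring
  simp only [e1, e2, integral_const_mul, h1]
  ring

/-! ### Profiles -/

/-- The Cauchy–Schwarz inequality for integrals. -/
theorem sq_integral_mul_le {α : Type*} [MeasurableSpace α] {μ : Measure α} {f g : α → ℝ}
    (hf : MemLp f 2 μ) (hg : MemLp g 2 μ) :
    (∫ x, f x * g x ∂μ) ^ 2 ≤ (∫ x, f x ^ 2 ∂μ) * ∫ x, g x ^ 2 ∂μ := by
  have i1 := hf.integrable_sq
  have i2 := hg.integrable_sq
  have i3 : Integrable (fun x => f x * g x) μ := hf.integrable_mul hg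
  have key : ∀ t : ℝ, 0 ≤ (∫ x, g x ^ 2 ∂μ) * (t * t) + (2 * ∫ x, f x * g x ∂μ) * t
      + ∫ x, f x ^ 2 ∂μ := by
    intro t
    have h0 : 0 ≤ ∫ x, (g x * t + f x) ^ 2 ∂μ := integral_nonneg fun x => sq_nonneg _
    have e : ∀ x, (g x * t + f x) ^ 2 = g x ^ 2 * (t * t) + (f x * g x) * (2 * t) + f x ^ 2 :=
      fun x => by ring
    simp only [e] at h0
    have i4 : Integrable (fun x => g x ^ 2 * (t * t) + (f x * g x) * (2 * t)) μ :=
      (i2.mul_const _).add (i3.mul_const _)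
    rw [integral_add i4 i1, integral_add (i2.mul_const _) (i3.mul_const _), integral_mul_const,
      integral_mul_const] at h0
    linarith
  have := discrim_le_zero key
  rw [discrim] at this
  linarith

/-- `h` is a nonnegative continuous profile of volume `V` with square integrable slope `g`. -/
structure IsProfile (V : ℝ) (h g : ℝ → ℝ) : Prop where
  cont : Continuous h
  nonneg : ∀ x, 0 ≤ h x
  integrable : Integrable h
  volume_eq : ∫ x, h x = V
  memLp : MemLp g 2 volume
  ftc : ∀ a b, h b - h a = ∫ x in a..b, g x

/-- The open region below the graph of `h` over `{h > 0}`. -/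
def subgraph (h : ℝ → ℝ) : Set (ℝ × ℝ) :=
  {p | 0 < h p.1 ∧ p.2 < h p.1}

theorem isOpen_film {h : ℝ → ℝ} (hc : Continuous h) : IsOpen (film h) :=
  (isOpen_lt continuous_const continuous_snd).inter
    (isOpen_lt continuous_snd (hc.comp continuous_fst))

theorem film_subset_subgraph (h : ℝ → ℝ) : film h ⊆ subgraph h :=
  fun _ hp => ⟨hp.1.trans hp.2, hp.2⟩

theorem film_mono {h h' : ℝ → ℝ} (hle : ∀ x, h x ≤ h' x) : film h ⊆ film h' :=
  fun p hp => ⟨hp.1, hp.2.trans_le (hle p.1)⟩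

theorem subgraph_mono {h h' : ℝ → ℝ} (hle : ∀ x, h x ≤ h' x) : subgraph h ⊆ subgraph h' :=
  fun p hp => ⟨hp.1.trans_le (hle p.1), hp.2.trans_le (hle p.1)⟩

theorem map_fst_film {h : ℝ → ℝ} (hc : Continuous h) :
    ((volume : Measure (ℝ × ℝ)).restrict (film h)).map Prod.fst
      = volume.withDensity (fun x => ((h x).toNNReal : ENNReal)) := by
  ext s hs
  rw [Measure.map_apply measurable_fst hs, withDensity_apply _ hs,
    Measure.restrict_apply (measurable_fst hs)]
  have : Prod.fst ⁻¹' s ∩ film h = regionBetween (fun _ => 0) h s := by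
    ext p; simp [film, regionBetween]
  rw [this, Measure.volume_eq_prod,
    volume_regionBetween_eq_lintegral aemeasurable_const hc.aemeasurable hs]
  simp [ENNReal.ofReal]

/-- The vertical slice of the film over x has length h(x). With k = g² this produces the weighted
surface term ∫ h g², and the weight is what makes height one the threshold for an energy gain. -/
theorem integral_film_fst {h : ℝ → ℝ} (hc : Continuous h) (h0 : ∀ x, 0 ≤ h x) {k : ℝ → ℝ}
    (hk : AEStronglyMeasurable k volume) :
    ∫ p in film h, k p.1 = ∫ x, h x * k x := by
  have hm : Measurable fun x => (h x).toNNReal := hc.measurable.real_toNNReal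
  have h1 : ∫ p in film h, k p.1
      = ∫ x, k x ∂((volume : Measure (ℝ × ℝ)).restrict (film h)).map Prod.fst := by
    rw [integral_map measurable_fst.aemeasurable]
    rw [map_fst_film hc]
    exact hk.mono_ac (withDensity_absolutelyContinuous _ _)
  rw [h1, map_fst_film hc, integral_withDensity_eq_integral_smul hm]
  congr 1; funext x
  rw [NNReal.smul_def, Real.coe_toNNReal _ (h0 x), smul_eq_mul]

theorem volume_film_ne_top {h : ℝ → ℝ} (hc : Continuous h) (hi : Integrable h) :
    volume (film h) ≠ ⊤ := by
  have : film h = regionBetween (fun _ => 0) h univ := by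
    ext p; simp [film, regionBetween]
  rw [this, Measure.volume_eq_prod,
    volume_regionBetween_eq_lintegral aemeasurable_const hc.aemeasurable MeasurableSet.univ]
  have := hi.lintegral_lt_top
  simpa using this.ne

theorem memLp_film_fst {h k : ℝ → ℝ} (hc : Continuous h) {M : ℝ} {r : ENNReal} (hM : ∀ x, h x ≤ M)
    (hk : MemLp k r volume) :
    MemLp (fun p : ℝ × ℝ => k p.1) r (volume.restrict (film h)) := by
  have h1 : MemLp k r (((volume : Measure (ℝ × ℝ)).restrict (film h)).map Prod.fst) := by
    refine MemLp.of_measure_le_smul (c := ENNReal.ofReal M) ENNReal.ofReal_ne_top ?_ hk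
    rw [map_fst_film hc, ← withDensity_const]
    exact withDensity_mono (ae_of_all _ fun x => ENNReal.ofReal_le_ofReal (hM x))
  exact h1.comp_of_map measurable_fst.aemeasurable

namespace IsProfile

variable {V : ℝ} {h g : ℝ → ℝ}

theorem locallyIntegrable (H : IsProfile V h g) : LocallyIntegrable g :=
  H.memLp.locallyIntegrable (by norm_num)

theorem intervalIntegrable (H : IsProfile V h g) (a b : ℝ) : IntervalIntegrable g volume a b :=
  (H.locallyIntegrable.integrableOn_isCompact isCompact_uIcc).intervalIntegrable

theorem volume_nonneg (H : IsProfile V h g) : 0 ≤ V :=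
  H.volume_eq ▸ integral_nonneg H.nonneg

theorem integrable_sq (H : IsProfile V h g) : Integrable fun x => g x ^ 2 :=
  H.memLp.integrable_sq

theorem isFiniteMeasure_film (H : IsProfile V h g) :
    IsFiniteMeasure ((volume : Measure (ℝ × ℝ)).restrict (film h)) :=
  ⟨by rw [Measure.restrict_apply_univ]
      exact lt_top_iff_ne_top.2 (volume_film_ne_top H.cont H.integrable)⟩

theorem measurableSet_film (H : IsProfile V h g) : MeasurableSet (film h) :=
  (isOpen_film H.cont).measurableSet

theorem integral_film_one (H : IsProfile V h g) : ∫ _ in film h, (1 : ℝ) = V := by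
  have := integral_film_fst H.cont H.nonneg (k := fun _ => 1) aestronglyMeasurable_const
  simp only [mul_one] at this
  rw [this, H.volume_eq]

/-- A profile is Hölder continuous with exponent `1/2`. -/
theorem sq_sub_le (H : IsProfile V h g) (a b : ℝ) :
    (h b - h a) ^ 2 ≤ (∫ x, g x ^ 2) * |b - a| := by
  wlog hab : a ≤ b generalizing a b
  · have := this b a (le_of_not_ge hab)
    rw [abs_sub_comm, ← neg_sub (h b), neg_sq] at this
    exact this
  have h1 := sq_integral_mul_le (μ := volume.restrict (Ioc a b)) (f := g) (g := fun _ => 1)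
    (H.memLp.restrict _) (memLp_const 1)
  rw [H.ftc a b, intervalIntegral.integral_of_le hab]
  simp only [mul_one, one_pow] at h1
  refine h1.trans ?_
  have h2 : ∫ _ in Ioc a b, (1:ℝ) = |b - a| := by
    simp [abs_of_nonneg (sub_nonneg.2 hab), hab]
  rw [h2]
  exact mul_le_mul_of_nonneg_right
    (setIntegral_le_integral H.integrable_sq (ae_of_all _ fun x => sq_nonneg _)) (abs_nonneg _)

/-- On an interval of length `h x ^ 2 / (4 T)` containing `x` the profile is at least `h x / 2`. -/
theorem cube_le_interval (H : IsProfile V h g) {T : ℝ} (hT : 0 < T) (hS : ∫ x, g x ^ 2 ≤ T)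
    {x a b : ℝ} (hax : a ≤ x) (hxb : x ≤ b) (hab : b - a = h x ^ 2 / (4 * T)) :
    h x ^ 3 ≤ 8 * T * ∫ y in Icc a b, h y := by
  have hlow : ∀ y ∈ Icc a b, h x / 2 ≤ h y := by
    intro y hy
    have h1 := H.sq_sub_le y x
    have h2 : |x - y| ≤ b - a := by
      rw [abs_le]; constructor <;> linarith [hy.1, hy.2]
    have h3 : (h x - h y) ^ 2 ≤ (h x / 2) ^ 2 := by
      calc (h x - h y) ^ 2 ≤ T * (b - a) :=
            h1.trans (mul_le_mul hS h2 (abs_nonneg _) hT.le)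
        _ = (h x / 2) ^ 2 := by rw [hab]; field_simp; ring
    have := abs_le_of_sq_le_sq h3 (by have := H.nonneg x; linarith)
    linarith [(abs_le.1 this).2]
  have h4 : (h x / 2) * (b - a) ≤ ∫ y in Icc a b, h y := by
    have h5 : ∫ y in Icc a b, h x / 2 ≤ ∫ y in Icc a b, h y :=
      setIntegral_mono_on (by simp) H.integrable.integrableOn measurableSet_Icc hlow
    have h6 : ∫ y in Icc a b, h x / 2 = (h x / 2) * (b - a) := by
      simp [hax.trans hxb, mul_comm]
    rwa [h6] at h5
  calc h x ^ 3 = 8 * T * ((h x / 2) * (b - a)) := by rw [hab]; field_simp; ring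
    _ ≤ _ := by gcongr

theorem cube_le (H : IsProfile V h g) {T : ℝ} (hT : 0 < T) (hS : ∫ x, g x ^ 2 ≤ T) (x : ℝ) :
    h x ^ 3 ≤ 8 * T * V := by
  refine (H.cube_le_interval hT hS (x := x) (a := x) (b := x + h x ^ 2 / (4 * T)) le_rfl
    (by have : 0 ≤ h x ^ 2 / (4 * T) := by positivity
        linarith) (by ring)).trans ?_
  rw [← H.volume_eq]
  exact mul_le_mul_of_nonneg_left
    (setIntegral_le_integral H.integrable (ae_of_all _ H.nonneg)) (by positivity)

theorem exists_bound (H : IsProfile V h g) : ∃ M, 0 < M ∧ ∀ x, h x ≤ M := by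
  set T := (∫ x, g x ^ 2) + 1 with hTd
  have hT : 0 < T := by
    have : 0 ≤ ∫ x, g x ^ 2 := integral_nonneg fun x => sq_nonneg _
    linarith
  refine ⟨8 * T * V + 1, by have := H.volume_nonneg; positivity, fun x => ?_⟩
  have h1 := H.cube_le hT (by rw [hTd]; linarith) x
  by_contra hlt
  push Not at hlt
  have h2 : 0 ≤ 8 * T * V := by have := H.volume_nonneg; positivity
  nlinarith [sq_nonneg (h x), mul_pos (show 0 < h x by linarith) (show 0 < h x by linarith)]

theorem memLp_self (H : IsProfile V h g) : MemLp h 2 volume := by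
  obtain ⟨M, hM, hb⟩ := H.exists_bound
  rw [memLp_two_iff_integrable_sq H.cont.aestronglyMeasurable]
  refine (H.integrable.const_mul M).mono' (H.cont.pow 2).aestronglyMeasurable
    (ae_of_all _ fun x => ?_)
  rw [Real.norm_of_nonneg (sq_nonneg _), sq]
  exact mul_le_mul_of_nonneg_right (hb x) (H.nonneg x)

theorem memLp_film (H : IsProfile V h g) {k : ℝ → ℝ} (hk : MemLp k 2 volume) :
    MemLp (fun p : ℝ × ℝ => k p.1) 2 (volume.restrict (film h)) := by
  obtain ⟨M, -, hM⟩ := H.exists_bound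
  exact memLp_film_fst H.cont hM hk

/-- A profile tends to zero at infinity. -/
theorem exists_radius (H : IsProfile V h g) {κ : ℝ} (hκ : 0 < κ) (R₀ : ℝ) :
    ∃ R, R₀ ≤ R ∧ 0 < R ∧ ∀ x, R ≤ |x| → h x < κ := by
  set T := (∫ x, g x ^ 2) + 1 with hTd
  have hT : 0 < T := by
    have : 0 ≤ ∫ x, g x ^ 2 := integral_nonneg fun x => sq_nonneg _
    linarith
  have hS : ∫ x, g x ^ 2 ≤ T := by rw [hTd]; linarith
  have hlim := tendsto_setIntegral_of_antitone (μ := volume) (f := h)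
    (s := fun n : ℕ => {x : ℝ | (n : ℝ) ≤ |x|})
    (fun n => measurableSet_le measurable_const measurable_norm)
    (fun m n hmn x (hx : (n:ℝ) ≤ |x|) => (Nat.cast_le.2 hmn).trans hx)
    ⟨0, H.integrable.integrableOn⟩
  have hempty : ⋂ n : ℕ, {x : ℝ | (n : ℝ) ≤ |x|} = ∅ := by
    ext x
    simp only [mem_iInter, mem_ofPred_eq, mem_empty_iff_false, iff_false, not_forall, not_le]
    exact exists_nat_gt |x|
  rw [hempty, setIntegral_empty] at hlim
  have hpos : 0 < κ ^ 3 / (8 * T) := by positivity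
  obtain ⟨n, hn⟩ := (hlim.eventually (gt_mem_nhds hpos)).exists
  refine ⟨max R₀ (n + 1), le_max_left _ _, lt_of_lt_of_le (by positivity) (le_max_right _ _),
    fun x hx => ?_⟩
  have hnx : (n : ℝ) ≤ |x| := by have := (le_max_right R₀ (n + 1 : ℝ)).trans hx; linarith
  have key : h x ^ 3 ≤ 8 * T * ∫ y in {x : ℝ | (n : ℝ) ≤ |x|}, h y := by
    have hr : 0 ≤ h x ^ 2 / (4 * T) := by positivity
    have hsub : ∀ a b, Icc a b ⊆ {x : ℝ | (n : ℝ) ≤ |x|} →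
        8 * T * ∫ y in Icc a b, h y ≤ 8 * T * ∫ y in {x : ℝ | (n : ℝ) ≤ |x|}, h y := by
      intro a b hs
      exact mul_le_mul_of_nonneg_left (setIntegral_mono_set H.integrable.integrableOn
        (ae_of_all _ H.nonneg) hs.eventuallyLE) (by positivity)
    -- The interval for the cube estimate is taken on the side of `x` away from the origin, so it
    -- stays in the tail, where the volume is small.
    rcases le_total 0 x with h0 | h0
    · rw [abs_of_nonneg h0] at hnx
      refine (H.cube_le_interval hT hS (x := x) (a := x) (b := x + h x ^ 2 / (4 * T)) le_rfl
        (by linarith) (by ring)).trans (hsub _ _ fun y hy => ?_)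
      exact (hnx.trans hy.1).trans (le_abs_self y)
    · rw [abs_of_nonpos h0] at hnx
      refine (H.cube_le_interval hT hS (x := x) (a := x - h x ^ 2 / (4 * T)) (b := x)
        (by linarith) le_rfl (by ring)).trans (hsub _ _ fun y hy => ?_)
      have := hy.2
      exact (show (n:ℝ) ≤ -y by linarith).trans (neg_le_abs y)
  have h2 : h x ^ 3 < κ ^ 3 := by
    calc h x ^ 3 ≤ _ := key
      _ < 8 * T * (κ ^ 3 / (8 * T)) := by gcongr
      _ = κ ^ 3 := by field_simp
  exact lt_of_pow_lt_pow_left₀ 3 hκ.le h2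

end IsProfile

/-! ### Displacements -/

/-- `u` is a displacement of the film with `u(x, 0) = x` and gradient `(P, Q)`. Both derivatives
and the boundary condition are tested with functions that need not vanish on the substrate. -/
structure IsDisplacement (h : ℝ → ℝ) (u P Q : ℝ × ℝ → ℝ) : Prop where
  memLp : MemLp u 2 (volume.restrict (film h))
  memLp_dx : MemLp P 2 (volume.restrict (film h))
  memLp_dy : MemLp Q 2 (volume.restrict (film h))
  integral_dx : ∀ φ : ℝ × ℝ → ℝ, IsTestFunction (subgraph h) φ →
    ∫ p in film h, ((u p - p.1) * fderiv ℝ φ p (1, 0) + (P p - 1) * φ p) = 0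
  integral_dy : ∀ φ : ℝ × ℝ → ℝ, IsTestFunction (subgraph h) φ →
    ∫ p in film h, ((u p - p.1) * fderiv ℝ φ p (0, 1) + Q p * φ p) = 0

theorem IsTestFunction.mono {E : Type*} [NormedAddCommGroup E] [NormedSpace ℝ E]
    {Ω Ω' : Set E} {φ : E → ℝ} (hφ : IsTestFunction Ω φ) (hΩ : Ω ⊆ Ω') : IsTestFunction Ω' φ :=
  ⟨hφ.1, hφ.2.1, hφ.2.2.trans hΩ⟩

theorem continuous_fderiv_apply {E : Type*} [NormedAddCommGroup E] [NormedSpace ℝ E]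
    {φ : E → ℝ} (hφ : ContDiff ℝ 1 φ) (v : E) : Continuous fun p => fderiv ℝ φ p v :=
  (hφ.continuous_fderiv (by simp)).clm_apply continuous_const

theorem hasCompactSupport_fderiv_apply' {E : Type*} [NormedAddCommGroup E] [NormedSpace ℝ E]
    {φ : E → ℝ} (hc : HasCompactSupport φ) (v : E) :
    HasCompactSupport fun p => fderiv ℝ φ p v :=
  hc.fderiv_apply (𝕜 := ℝ) v

theorem eq_zero_of_notMem {E : Type*} [NormedAddCommGroup E] [NormedSpace ℝ E]
    {φ : E → ℝ} {Ω : Set E} (hs : tsupport φ ⊆ Ω) {p : E} (hp : p ∉ Ω) : φ p = 0 :=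
  image_eq_zero_of_notMem_tsupport fun h => hp (hs h)

theorem fderiv_eq_zero_of_notMem {E : Type*} [NormedAddCommGroup E] [NormedSpace ℝ E]
    {φ : E → ℝ} {Ω : Set E} (hs : tsupport φ ⊆ Ω) {p : E} (hp : p ∉ Ω) : fderiv ℝ φ p = 0 :=
  image_eq_zero_of_notMem_tsupport fun h => hp (hs (tsupport_fderiv_subset ℝ h))

theorem upper_inter_notMem_film {h : ℝ → ℝ} {p : ℝ × ℝ} (hp : 0 < p.2) (hf : p ∉ film h) :
    p ∉ subgraph h := fun hs => hf ⟨hp, hs.2⟩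

/-- An integral over the film of a function supported in the subgraph is an integral over the upper
half plane. -/
theorem integral_film_eq_upper {h : ℝ → ℝ} {f : ℝ × ℝ → ℝ}
    (hf : ∀ p, p ∉ subgraph h → f p = 0) :
    ∫ p in film h, f p = ∫ p in univ ×ˢ Ioi (0 : ℝ), f p := by
  have hsub : film h ⊆ univ ×ˢ Ioi (0 : ℝ) := fun p hp => ⟨mem_univ _, hp.1⟩
  refine (setIntegral_eq_of_subset_of_forall_sdiff_eq_zero
    (MeasurableSet.univ.prod measurableSet_Ioi) hsub ?_).symm
  intro p hp
  exact hf p (upper_inter_notMem_film hp.1.2 hp.2)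

theorem hasDerivAt_fst_slice {ψ : ℝ × ℝ → ℝ} (hψ : ContDiff ℝ 1 ψ) (x y : ℝ) :
    HasDerivAt (fun s => ψ (s, y)) (fderiv ℝ ψ (x, y) (1, 0)) x := by
  have h1 : HasDerivAt (fun s : ℝ => (s, y)) ((1 : ℝ), (0 : ℝ)) x :=
    (hasDerivAt_id x).prodMk (hasDerivAt_const x y)
  exact ((hψ.differentiable (by simp)) (x, y)).hasFDerivAt.comp_hasDerivAt x h1

theorem hasDerivAt_snd_slice {ψ : ℝ × ℝ → ℝ} (hψ : ContDiff ℝ 1 ψ) (x y : ℝ) :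
    HasDerivAt (fun s => ψ (x, s)) (fderiv ℝ ψ (x, y) (0, 1)) y := by
  have h1 : HasDerivAt (fun s : ℝ => (x, s)) ((0 : ℝ), (1 : ℝ)) y :=
    (hasDerivAt_const y x).prodMk (hasDerivAt_id y)
  exact ((hψ.differentiable (by simp)) (x, y)).hasFDerivAt.comp_hasDerivAt y h1

theorem hasCompactSupport_snd_slice {ψ : ℝ × ℝ → ℝ} (hc : HasCompactSupport ψ) (x : ℝ) :
    HasCompactSupport fun s => ψ (x, s) := by
  refine HasCompactSupport.of_support_subset_isCompact (hc.isCompact.image continuous_snd) ?_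
  intro s hs
  exact ⟨(x, s), subset_tsupport _ hs, rfl⟩

theorem hasCompactSupport_fst_slice {ψ : ℝ × ℝ → ℝ} (hc : HasCompactSupport ψ) (y : ℝ) :
    HasCompactSupport fun s => ψ (s, y) := by
  refine HasCompactSupport.of_support_subset_isCompact (hc.isCompact.image continuous_fst) ?_
  intro s hs
  exact ⟨(s, y), subset_tsupport _ hs, rfl⟩

/-- The divergence theorem in the film for horizontal fields. -/
theorem integral_film_fderiv_fst {h : ℝ → ℝ} {ψ : ℝ × ℝ → ℝ}
    (hψ : ContDiff ℝ 1 ψ) (hψc : HasCompactSupport ψ) (hs : tsupport ψ ⊆ subgraph h) :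
    ∫ p in film h, fderiv ℝ ψ p (1, 0) = 0 := by
  rw [integral_film_eq_upper (fun p hp => by rw [fderiv_eq_zero_of_notMem hs hp]; rfl)]
  have hi : Integrable fun p : ℝ × ℝ => fderiv ℝ ψ p (1, 0) :=
    (continuous_fderiv_apply hψ _).integrable_of_hasCompactSupport
      (hasCompactSupport_fderiv_apply' hψc _)
  rw [Measure.volume_eq_prod] at hi ⊢
  rw [← Measure.prod_restrict, integral_prod_symm]
  · rw [integral_eq_zero_of_ae]
    filter_upwards with y
    simp only [Measure.restrict_univ, Pi.zero_apply]
    have hd : ∀ x, HasDerivAt (fun s => ψ (s, y)) (fderiv ℝ ψ (x, y) (1, 0)) x :=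
      fun x => hasDerivAt_fst_slice hψ x y
    have hcx : Continuous fun x => fderiv ℝ ψ (x, y) (1, 0) :=
      (continuous_fderiv_apply hψ (1, 0)).comp (by fun_prop)
    exact integral_eq_zero_of_hasDerivAt_of_integrable hd
      (hcx.integrable_of_hasCompactSupport
        (hasCompactSupport_fst_slice (hasCompactSupport_fderiv_apply' hψc _) y))
      ((hψ.continuous.comp (by fun_prop)).integrable_of_hasCompactSupport
        (hasCompactSupport_fst_slice hψc y))
  · rw [Measure.prod_restrict]; exact hi.integrableOn

/-- The divergence theorem in the film for vertical fields. -/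
theorem integral_film_fderiv_snd {h : ℝ → ℝ} {ψ : ℝ × ℝ → ℝ}
    (hψ : ContDiff ℝ 1 ψ) (hψc : HasCompactSupport ψ) (hs : tsupport ψ ⊆ subgraph h) :
    ∫ p in film h, fderiv ℝ ψ p (0, 1) = -∫ x, ψ (x, 0) := by
  rw [integral_film_eq_upper (fun p hp => by rw [fderiv_eq_zero_of_notMem hs hp]; rfl)]
  have hi : Integrable fun p : ℝ × ℝ => fderiv ℝ ψ p (0, 1) :=
    (continuous_fderiv_apply hψ _).integrable_of_hasCompactSupport
      (hasCompactSupport_fderiv_apply' hψc _)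
  rw [Measure.volume_eq_prod] at hi ⊢
  rw [← Measure.prod_restrict, integral_prod]
  · rw [← integral_neg, Measure.restrict_univ]
    congr 1; funext x
    have hd : deriv (fun s => ψ (x, s)) = fun y => fderiv ℝ ψ (x, y) (0, 1) :=
      funext fun y => (hasDerivAt_snd_slice hψ x y).deriv
    have h1 : ContDiff ℝ 1 fun s => ψ (x, s) := hψ.comp (by fun_prop)
    have := HasCompactSupport.integral_Ioi_deriv_eq h1 (hasCompactSupport_snd_slice hψc x) 0
    rw [hd] at this
    exact this
  · rw [Measure.prod_restrict]; exact hi.integrableOn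

theorem memLp_test {E : Type*} [NormedAddCommGroup E] [NormedSpace ℝ E] [MeasureSpace E]
    [BorelSpace E] [SecondCountableTopology E]
    [IsFiniteMeasureOnCompacts (volume : Measure E)] {f : E → ℝ} (hf : Continuous f)
    (hc : HasCompactSupport f) (s : Set E) : MemLp f 2 (volume.restrict s) :=
  (hf.memLp_of_hasCompactSupport hc).restrict s

section products

variable {h : ℝ → ℝ} {φ k : ℝ × ℝ → ℝ}

theorem integrable_mul_test {s : Set (ℝ × ℝ)} {f ψ : ℝ × ℝ → ℝ}
    (hf : MemLp f 2 (volume.restrict s))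
    (hψ : Continuous ψ) (hc : HasCompactSupport ψ) : IntegrableOn (fun p => f p * ψ p) s :=
  hf.integrable_mul (memLp_test hψ hc s)

theorem integrable_continuous_mul_test {s : Set (ℝ × ℝ)} {f ψ : ℝ × ℝ → ℝ}
    (hf : Continuous f)
    (hψ : Continuous ψ) (hc : HasCompactSupport ψ) : IntegrableOn (fun p => f p * ψ p) s :=
  ((hf.mul hψ).integrable_of_hasCompactSupport hc.mul_left).integrableOn

/-- Integration by parts in the film for a smooth factor, horizontal direction. -/
theorem integral_film_mul_fderiv_fst (hk : ContDiff ℝ 1 k)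
    (hφ : IsTestFunction (subgraph h) φ) :
    ∫ p in film h, (k p * fderiv ℝ φ p (1, 0) + fderiv ℝ k p (1, 0) * φ p) = 0 := by
  have h1 : ContDiff ℝ 1 φ := hφ.1.of_le (by exact_mod_cast le_top)
  refine Eq.trans ?_ (integral_film_fderiv_fst (hk.mul h1) hφ.2.1.mul_left
    ((tsupport_mul_subset_right).trans hφ.2.2))
  congr 1; funext p
  rw [fderiv_fun_mul (hk.differentiable (by simp) p) (h1.differentiable (by simp) p)]
  simp [mul_comm]

/-- Integration by parts in the film for a smooth factor, vertical direction. -/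
theorem integral_film_mul_fderiv_snd (hk : ContDiff ℝ 1 k)
    (hφ : IsTestFunction (subgraph h) φ) :
    ∫ p in film h, (k p * fderiv ℝ φ p (0, 1) + fderiv ℝ k p (0, 1) * φ p)
      = -∫ x, k (x, 0) * φ (x, 0) := by
  have h1 : ContDiff ℝ 1 φ := hφ.1.of_le (by exact_mod_cast le_top)
  rw [← integral_film_fderiv_snd (hk.mul h1) hφ.2.1.mul_left
    ((tsupport_mul_subset_right).trans hφ.2.2)]
  congr 1; funext p
  rw [fderiv_fun_mul (hk.differentiable (by simp) p) (h1.differentiable (by simp) p)]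
  simp [mul_comm]

theorem integral_film_fst_mul_dx (hφ : IsTestFunction (subgraph h) φ) :
    ∫ p in film h, (p.1 * fderiv ℝ φ p (1, 0) + φ p) = 0 := by
  refine Eq.trans ?_ (integral_film_mul_fderiv_fst contDiff_fst hφ)
  simp [fderiv_fst]

theorem integral_film_fst_mul_dy (hφ : IsTestFunction (subgraph h) φ) :
    ∫ p in film h, p.1 * fderiv ℝ φ p (0, 1) = -∫ x, x * φ (x, 0) := by
  rw [← integral_film_mul_fderiv_snd contDiff_fst hφ]
  simp [fderiv_fst]

end products

theorem IsTestFunction.contDiff_one {Ω : Set (ℝ × ℝ)} {φ : ℝ × ℝ → ℝ}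
    (hφ : IsTestFunction Ω φ) : ContDiff ℝ 1 φ := hφ.1.of_le (by exact_mod_cast le_top)

/-! ### Admissible pairs as profiles with displacements. -/

section equivalence

variable {h : ℝ → ℝ} {u P Q φ : ℝ × ℝ → ℝ}

theorem integrableOn_mul_fderiv {Ω s : Set (ℝ × ℝ)} {f : ℝ × ℝ → ℝ}
    (hf : MemLp f 2 (volume.restrict s)) (hφ : IsTestFunction Ω φ) (v : ℝ × ℝ) :
    IntegrableOn (fun p => f p * fderiv ℝ φ p v) s :=
  integrable_mul_test hf (continuous_fderiv_apply hφ.contDiff_one v)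
    (hasCompactSupport_fderiv_apply' hφ.2.1 v)

theorem integrableOn_fst_mul_fderiv {Ω s : Set (ℝ × ℝ)} (hφ : IsTestFunction Ω φ) (v : ℝ × ℝ) :
    IntegrableOn (fun p : ℝ × ℝ => p.1 * fderiv ℝ φ p v) s :=
  integrable_continuous_mul_test continuous_fst (continuous_fderiv_apply hφ.contDiff_one v)
    (hasCompactSupport_fderiv_apply' hφ.2.1 v)

theorem integrableOn_test {Ω s : Set (ℝ × ℝ)} (hφ : IsTestFunction Ω φ) : IntegrableOn φ s :=
  (hφ.1.continuous.integrable_of_hasCompactSupport hφ.2.1).integrableOn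

/-- The horizontal test identity with and without subtraction of the boundary datum. -/
theorem integral_dx_iff (hu : MemLp u 2 (volume.restrict (film h)))
    (hP : MemLp P 2 (volume.restrict (film h))) (hφ : IsTestFunction (subgraph h) φ) :
    ∫ p in film h, ((u p - p.1) * fderiv ℝ φ p (1, 0) + (P p - 1) * φ p) = 0 ↔
      ∫ p in film h, u p * fderiv ℝ φ p (1, 0) = -∫ p in film h, P p * φ p := by
  have i1 := integrableOn_mul_fderiv hu hφ (1, 0)
  have i2 := integrable_mul_test hP hφ.1.continuous hφ.2.1
  have i3 : IntegrableOn (fun p : ℝ × ℝ => p.1 * fderiv ℝ φ p (1, 0) + φ p) (film h) :=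
    (integrableOn_fst_mul_fderiv hφ (1, 0)).add (integrableOn_test hφ)
  have i4 : IntegrableOn (fun p => u p * fderiv ℝ φ p (1, 0) + P p * φ p) (film h) := i1.add i2
  have e : ∫ p in film h, ((u p - p.1) * fderiv ℝ φ p (1, 0) + (P p - 1) * φ p)
      = (∫ p in film h, u p * fderiv ℝ φ p (1, 0)) + (∫ p in film h, P p * φ p)
        - ∫ p in film h, (p.1 * fderiv ℝ φ p (1, 0) + φ p) := by
    rw [← integral_add i1 i2, ← integral_sub i4 i3]
    congr 1; funext p; ring
  rw [e, integral_film_fst_mul_dx hφ, sub_zero, add_eq_zero_iff_eq_neg]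

/-- The vertical test identity with and without subtraction of the boundary datum. -/
theorem integral_dy_iff (hu : MemLp u 2 (volume.restrict (film h)))
    (hQ : MemLp Q 2 (volume.restrict (film h))) (hφ : IsTestFunction (subgraph h) φ) :
    ∫ p in film h, ((u p - p.1) * fderiv ℝ φ p (0, 1) + Q p * φ p) = 0 ↔
      ∫ p in film h, (u p * fderiv ℝ φ p (0, 1) + Q p * φ p) = -∫ x, x * φ (x, 0) := by
  have i1 := integrableOn_mul_fderiv hu hφ (0, 1)
  have i2 := integrable_mul_test hQ hφ.1.continuous hφ.2.1
  have i3 := integrableOn_fst_mul_fderiv (s := film h) hφ (0, 1)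
  have i4 : IntegrableOn (fun p => u p * fderiv ℝ φ p (0, 1) + Q p * φ p) (film h) := i1.add i2
  have e : ∫ p in film h, ((u p - p.1) * fderiv ℝ φ p (0, 1) + Q p * φ p)
      = (∫ p in film h, (u p * fderiv ℝ φ p (0, 1) + Q p * φ p))
        - ∫ p in film h, p.1 * fderiv ℝ φ p (0, 1) := by
    rw [← integral_sub i4 i3]
    congr 1; funext p; ring
  rw [e, integral_film_fst_mul_dy hφ, sub_eq_zero]

/-- A smooth cutoff in the vertical variable, vanishing for `y ≤ 1 / (k + 1)`. -/
def cutoff (k : ℕ) (p : ℝ × ℝ) : ℝ := Real.smoothTransition ((k + 1) * p.2 - 1)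

theorem contDiff_cutoff (k : ℕ) : ContDiff ℝ ∞ (cutoff k) :=
  Real.smoothTransition.contDiff.comp (by fun_prop)

theorem cutoff_tendsto {p : ℝ × ℝ} (hp : 0 < p.2) :
    Tendsto (fun k => cutoff k p) atTop (𝓝 1) := by
  obtain ⟨n, hn⟩ := exists_nat_gt (2 / p.2)
  refine tendsto_const_nhds.congr' ?_
  filter_upwards [eventually_ge_atTop n] with k hk
  refine (Real.smoothTransition.one_of_one_le ?_).symm
  have h1 : (n : ℝ) ≤ k := Nat.cast_le.2 hk
  rw [div_lt_iff₀ hp] at hn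
  nlinarith

/-- The cutoff depends on y alone, so the product rule leaves no term that blows up with `k`. This
is why the horizontal derivative extends to test functions touching the substrate without any trace
condition. -/
theorem fderiv_mul_cutoff_fst {φ : ℝ × ℝ → ℝ} (hφ : ContDiff ℝ 1 φ) (k : ℕ) (p : ℝ × ℝ) :
    fderiv ℝ (fun q => φ q * cutoff k q) p (1, 0) = fderiv ℝ φ p (1, 0) * cutoff k p := by
  obtain ⟨x, y⟩ := p
  have h1 : ContDiff ℝ 1 fun q => φ q * cutoff k q :=
    hφ.mul ((contDiff_cutoff k).of_le (by exact_mod_cast le_top))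
  have h2 := hasDerivAt_fst_slice h1 x y
  have h3 := (hasDerivAt_fst_slice hφ x y).mul_const (cutoff k (x, y))
  exact h2.unique h3

/-- The horizontal derivative may be tested with functions not vanishing on the substrate. -/
theorem integral_dx_extend (hc : Continuous h) (hu : MemLp u 2 (volume.restrict (film h)))
    (hP : MemLp P 2 (volume.restrict (film h)))
    (hw : ∀ φ : ℝ × ℝ → ℝ, IsTestFunction (film h) φ →
      ∫ p in film h, u p * fderiv ℝ φ p (1, 0) = -∫ p in film h, P p * φ p)
    (hφ : IsTestFunction (subgraph h) φ) :
    ∫ p in film h, u p * fderiv ℝ φ p (1, 0) = -∫ p in film h, P p * φ p := by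
  have i1 := integrableOn_mul_fderiv hu hφ (1, 0)
  have i2 := integrable_mul_test hP hφ.1.continuous hφ.2.1
  have i3 : IntegrableOn (fun p => u p * fderiv ℝ φ p (1, 0) + P p * φ p) (film h) := i1.add i2
  have h0 : ∀ k : ℕ, ∫ p in film h,
      (u p * fderiv ℝ φ p (1, 0) + P p * φ p) * cutoff k p = 0 := by
    intro k
    have ht : IsTestFunction (film h) fun q => φ q * cutoff k q := by
      refine ⟨hφ.1.mul (contDiff_cutoff k), hφ.2.1.mul_right, ?_⟩
      intro p hp
      have hp1 : p ∈ tsupport φ := tsupport_mul_subset_left hp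
      have hp2 : p ∈ tsupport (cutoff k) := tsupport_mul_subset_right hp
      have hp3 : 0 < p.2 := by
        have hcl : IsClosed {p : ℝ × ℝ | 1 ≤ (k + 1 : ℝ) * p.2} :=
          isClosed_le continuous_const (by fun_prop)
        have hsub : tsupport (cutoff k) ⊆ {p : ℝ × ℝ | 1 ≤ (k + 1 : ℝ) * p.2} := by
          refine closure_minimal (fun q hq => ?_) hcl
          by_contra hlt
          refine hq (Real.smoothTransition.zero_of_nonpos ?_)
          simp only [mem_ofPred_eq, not_le] at hlt
          linarith
        have h1 : 1 ≤ (k + 1 : ℝ) * p.2 := hsub hp2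
        by_contra hneg
        push Not at hneg
        nlinarith [(Nat.cast_nonneg k : (0:ℝ) ≤ k)]
      exact ⟨hp3, (hφ.2.2 hp1).2⟩
    have h1 := hw _ ht
    rw [← add_eq_zero_iff_eq_neg, ← integral_add (integrableOn_mul_fderiv hu ht (1, 0))
      (integrable_mul_test hP ht.1.continuous ht.2.1)] at h1
    refine Eq.trans ?_ h1
    congr 1; funext p
    rw [fderiv_mul_cutoff_fst hφ.contDiff_one]
    ring
  have hlim : Tendsto (fun k : ℕ => ∫ p in film h,
      (u p * fderiv ℝ φ p (1, 0) + P p * φ p) * cutoff k p) atTop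
      (𝓝 (∫ p in film h, (u p * fderiv ℝ φ p (1, 0) + P p * φ p))) := by
    refine tendsto_integral_of_dominated_convergence
      (fun p => ‖u p * fderiv ℝ φ p (1, 0) + P p * φ p‖) ?_ i3.norm ?_ ?_
    · intro k
      exact i3.aestronglyMeasurable.mul (contDiff_cutoff k).continuous.aestronglyMeasurable
    · intro k
      refine ae_of_all _ fun p => ?_
      rw [norm_mul]
      refine mul_le_of_le_one_right (norm_nonneg _) ?_
      rw [cutoff, Real.norm_of_nonneg (Real.smoothTransition.nonneg _)]
      exact Real.smoothTransition.le_one _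
    · filter_upwards [ae_restrict_mem (isOpen_film hc).measurableSet] with p hp
      have := (cutoff_tendsto hp.1).const_mul (u p * fderiv ℝ φ p (1, 0) + P p * φ p)
      rwa [mul_one] at this
  simp only [h0] at hlim
  rw [← add_eq_zero_iff_eq_neg, ← integral_add i1 i2]
  exact tendsto_nhds_unique hlim tendsto_const_nhds

theorem hasWeakDerivOn_weakDeriv {E : Type*} [NormedAddCommGroup E] [NormedSpace ℝ E]
    [MeasureSpace E] {Ω : Set E} {u : E → ℝ} {v : E} {w : E → ℝ} (hw : HasWeakDerivOn Ω u v w) :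
    HasWeakDerivOn Ω u v (weakDeriv Ω u v) := by
  have hex : ∃ w, HasWeakDerivOn Ω u v w := ⟨w, hw⟩
  rw [weakDeriv, dif_pos hex]
  exact hex.choose_spec

theorem weakDeriv_ae_eq {E : Type*} [NormedAddCommGroup E] [NormedSpace ℝ E]
    [FiniteDimensional ℝ E] [MeasureSpace E] [BorelSpace E] {Ω : Set E} (hΩ : IsOpen Ω)
    {u : E → ℝ} {v : E} {w : E → ℝ} (hw : HasWeakDerivOn Ω u v w) :
    weakDeriv Ω u v =ᵐ[volume.restrict Ω] w := by
  have h1 := (hasWeakDerivOn_weakDeriv hw).ae_eq hΩ hw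
  exact (ae_restrict_iff' hΩ.measurableSet).2 h1

theorem memLp_weakDeriv {E : Type*} [NormedAddCommGroup E] [NormedSpace ℝ E]
    [FiniteDimensional ℝ E] [MeasureSpace E] [BorelSpace E] {Ω : Set E} (hΩ : IsOpen Ω)
    {u : E → ℝ} (hu : MemH1 Ω u) (v : E) :
    HasWeakDerivOn Ω u v (weakDeriv Ω u v) ∧ MemLp (weakDeriv Ω u v) 2 (volume.restrict Ω) := by
  obtain ⟨w, hw, hw2⟩ := hu.2 v
  exact ⟨hasWeakDerivOn_weakDeriv hw, (memLp_congr_ae (weakDeriv_ae_eq hΩ hw)).2 hw2⟩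

theorem isProfile_of_admissible {V : ℝ} {q : (ℝ × ℝ → ℝ) × (ℝ → ℝ)} (hq : q ∈ admissible V) :
    IsProfile V q.2 (weakDeriv univ q.2 1) := by
  obtain ⟨hc, hH, h0, hi, hV, -, -⟩ := hq
  obtain ⟨h1, h2⟩ := memLp_weakDeriv isOpen_univ hH 1
  rw [Measure.restrict_univ] at h2
  exact ⟨hc, h0, hi, hV, h2, primitive_of_hasWeakDerivOn hc h1⟩

/-- The vertical identity is the trace condition and the horizontal one comes from the cutoff
argument. In both, the datum x is subtracted by integrating the smooth function x by parts. -/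
theorem isDisplacement_of_admissible {V : ℝ} {q : (ℝ × ℝ → ℝ) × (ℝ → ℝ)}
    (hq : q ∈ admissible V) :
    IsDisplacement q.2 q.1 (dx q.2 q.1) (dy q.2 q.1) := by
  obtain ⟨hc, -, -, -, -, hu, ht⟩ := hq
  obtain ⟨hx, hx2⟩ := memLp_weakDeriv (isOpen_film hc) hu (1, 0)
  obtain ⟨hy, hy2⟩ := memLp_weakDeriv (isOpen_film hc) hu (0, 1)
  refine ⟨hu.1, hx2, hy2, fun φ hφ => ?_, fun φ hφ => ?_⟩
  · exact (integral_dx_iff hu.1 hx2 hφ).2 (integral_dx_extend hc hu.1 hx2 hx.2.2 hφ)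
  · exact (integral_dy_iff hu.1 hy2 hφ).2 (ht φ hφ)

variable {V : ℝ} {g : ℝ → ℝ}

theorem IsDisplacement.hasWeakDerivOn (H : IsProfile V h g) (D : IsDisplacement h u P Q)
    (v : ℝ × ℝ) : HasWeakDerivOn (film h) u v (fun p => v.1 * P p + v.2 * Q p) := by
  have := H.isFiniteMeasure_film
  have hw : MemLp (fun p => v.1 * P p + v.2 * Q p) 2 (volume.restrict (film h)) :=
    (D.memLp_dx.const_mul v.1).add (D.memLp_dy.const_mul v.2)
  have iu : IntegrableOn u (film h) := D.memLp.integrable (by norm_num)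
  have iw : IntegrableOn (fun p => v.1 * P p + v.2 * Q p) (film h) := hw.integrable (by norm_num)
  refine ⟨iu.locallyIntegrableOn, iw.locallyIntegrableOn, fun φ hφ => ?_⟩
  have hφ' := hφ.mono (film_subset_subgraph h)
  have h1 := (integral_dx_iff D.memLp D.memLp_dx hφ').1 (D.integral_dx φ hφ')
  have h2 := (integral_dy_iff D.memLp D.memLp_dy hφ').1 (D.integral_dy φ hφ')
  have h3 : ∀ x : ℝ, φ (x, 0) = 0 := fun x =>
    eq_zero_of_notMem hφ.2.2 fun hx => lt_irrefl _ hx.1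
  have i1 := integrableOn_mul_fderiv D.memLp hφ (1, 0)
  have i2 := integrableOn_mul_fderiv D.memLp hφ (0, 1)
  have i3 := integrable_mul_test D.memLp_dx hφ.1.continuous hφ.2.1
  have i4 := integrable_mul_test D.memLp_dy hφ.1.continuous hφ.2.1
  simp only [h3, mul_zero, integral_zero, neg_zero] at h2
  rw [integral_add i2 i4, add_eq_zero_iff_eq_neg] at h2
  have e1 : ∀ p, u p * fderiv ℝ φ p v
      = v.1 * (u p * fderiv ℝ φ p (1, 0)) + v.2 * (u p * fderiv ℝ φ p (0, 1)) := by
    intro p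
    have : v = v.1 • ((1 : ℝ), (0 : ℝ)) + v.2 • ((0 : ℝ), (1 : ℝ)) := by simp
    conv_lhs => rw [this]
    rw [map_add, map_smul, map_smul]
    simp only [smul_eq_mul]; ring
  have e2 : ∀ p, (v.1 * P p + v.2 * Q p) * φ p = v.1 * (P p * φ p) + v.2 * (Q p * φ p) :=
    fun p => by ring
  simp only [e1, e2]
  rw [integral_add (i1.const_mul _) (i2.const_mul _), integral_add (i3.const_mul _)
    (i4.const_mul _)]
  simp only [integral_const_mul, h1, h2]
  ring

/-- The trace condition is stated with the chosen derivative `dy`, which agrees with Q almost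
everywhere in the film by uniqueness of weak derivatives. -/
theorem mem_admissible (H : IsProfile V h g) (D : IsDisplacement h u P Q) :
    (u, h) ∈ admissible V := by
  have hQ : dy h u =ᵐ[volume.restrict (film h)] Q := by
    refine (weakDeriv_ae_eq (isOpen_film H.cont) (D.hasWeakDerivOn H (0, 1))).trans
      (ae_of_all _ fun p => ?_)
    simp
  refine ⟨H.cont, ⟨by rw [Measure.restrict_univ]; exact H.memLp_self, fun v => ?_⟩, H.nonneg,
    H.integrable, H.volume_eq, ⟨D.memLp, fun v => ?_⟩, fun φ hφ => ?_⟩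
  · refine ⟨_, hasWeakDerivOn_of_primitive H.cont H.locallyIntegrable H.ftc v, ?_⟩
    rw [Measure.restrict_univ]
    exact H.memLp.const_mul v
  · exact ⟨_, D.hasWeakDerivOn H v, (D.memLp_dx.const_mul v.1).add (D.memLp_dy.const_mul v.2)⟩
  · rw [← (integral_dy_iff D.memLp D.memLp_dy hφ).1 (D.integral_dy φ hφ)]
    refine integral_congr_ae ?_
    filter_upwards [hQ] with p hp
    rw [hp]

theorem energy_eq (H : IsProfile V h g) (D : IsDisplacement h u P Q) :
    energy (u, h) = (∫ p in film h, (P p ^ 2 + Q p ^ 2)) + ∫ x, g x ^ 2 := by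
  have hP := weakDeriv_ae_eq (isOpen_film H.cont) (D.hasWeakDerivOn H (1, 0))
  have hQ := weakDeriv_ae_eq (isOpen_film H.cont) (D.hasWeakDerivOn H (0, 1))
  have hg := weakDeriv_ae_eq isOpen_univ
    (hasWeakDerivOn_of_primitive H.cont H.locallyIntegrable H.ftc 1)
  rw [Measure.restrict_univ] at hg
  rw [energy]
  congr 1
  · refine integral_congr_ae ?_
    filter_upwards [hP, hQ] with p h1 h2
    simp only [dx, dy, h1, h2]
    ring
  · refine integral_congr_ae ?_
    filter_upwards [hg] with x hx
    simp only [hx]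
    ring

end equivalence

/-! ### The flux identity -/

theorem integral_sq_le_of_eLpNorm_le {α : Type*} [MeasurableSpace α] {μ : Measure α} {f : α → ℝ}
    (hf : MemLp f 2 μ) {ε : ℝ} (hε : 0 ≤ ε) (hle : eLpNorm f 2 μ ≤ ENNReal.ofReal ε) :
    ∫ x, f x ^ 2 ∂μ ≤ ε ^ 2 := by
  rw [hf.eLpNorm_eq_integral_rpow_norm (by norm_num) (by norm_num),
    ENNReal.ofReal_le_ofReal_iff hε] at hle
  have h0 : 0 ≤ ∫ x, f x ^ 2 ∂μ := integral_nonneg fun x => sq_nonneg _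
  have e : ∫ a, ‖f a‖ ^ (ENNReal.toReal 2) ∂μ = ∫ x, f x ^ 2 ∂μ := by
    congr 1; funext x
    simp
  rw [e] at hle
  simp only [ENNReal.toReal_ofNat] at hle
  rw [show ((2 : ℝ)⁻¹) = 1 / 2 by norm_num, ← Real.sqrt_eq_rpow] at hle
  calc ∫ x, f x ^ 2 ∂μ = (√(∫ x, f x ^ 2 ∂μ)) ^ 2 := (Real.sq_sqrt h0).symm
    _ ≤ ε ^ 2 := by gcongr

theorem hasDerivAt_zero_of_eventually_const {f : ℝ → ℝ} {x c : ℝ} (h : ∀ᶠ y in 𝓝 x, f y = c) :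
    HasDerivAt f 0 x :=
  (hasDerivAt_const x c).congr_of_eventuallyEq h

section transport

variable {θ χ η k G : ℝ → ℝ}

/-- The transport field `(1, G)` annihilates functions of `k x - y` if `G = k'`. -/
theorem transport_derivative (hθ : ContDiff ℝ ∞ θ) (hχ : ContDiff ℝ ∞ χ) (hη : ContDiff ℝ ∞ η)
    (hk : ∀ x, HasDerivAt k (G x) x) (hks : ContDiff ℝ ∞ k) {x y : ℝ} (hχ0 : HasDerivAt χ 0 y)
    (hθ0 : deriv θ x * η (k x - y) = 0) :
    fderiv ℝ (fun p : ℝ × ℝ => θ p.1 * χ p.2 * η (k p.1 - p.2)) (x, y) (1, 0)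
      + G x * fderiv ℝ (fun p : ℝ × ℝ => θ p.1 * χ p.2 * η (k p.1 - p.2)) (x, y) (0, 1) = 0 := by
  set f : ℝ × ℝ → ℝ := fun p => θ p.1 * χ p.2 * η (k p.1 - p.2) with hf
  have hfs : ContDiff ℝ 1 f := by
    have : ContDiff ℝ ∞ f :=
      ((hθ.comp contDiff_fst).mul (hχ.comp contDiff_snd)).mul
        (hη.comp ((hks.comp contDiff_fst).sub contDiff_snd))
    exact this.of_le (by exact_mod_cast le_top)
  have dη : HasDerivAt η (deriv η (k x - y)) (k x - y) :=
    (hη.differentiable (by simp) _).hasDerivAt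
  have dθ : HasDerivAt θ (deriv θ x) x := (hθ.differentiable (by simp) _).hasDerivAt
  have e1 : fderiv ℝ f (x, y) (1, 0)
      = deriv θ x * χ y * η (k x - y) + θ x * χ y * (deriv η (k x - y) * G x) := by
    refine (hasDerivAt_fst_slice hfs x y).unique ?_
    exact (dθ.mul_const (χ y)).mul (dη.comp x ((hk x).sub_const y))
  have e2 : fderiv ℝ f (x, y) (0, 1)
      = θ x * 0 * η (k x - y) + θ x * χ y * (deriv η (k x - y) * (-1)) := by
    refine (hasDerivAt_snd_slice hfs x y).unique ?_
    exact (hχ0.const_mul (θ x)).mul (dη.comp y ((hasDerivAt_id y).const_sub (k x)))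
  rw [e1, e2]
  linear_combination χ y * hθ0

end transport

variable {V : ℝ} {h g : ℝ → ℝ} {u P Q : ℝ × ℝ → ℝ}

/-- Test functions adapted to an almost tangential field. -/
theorem IsProfile.exists_transport_test (H : IsProfile V h g) {κ : ℝ} (hκ : 0 < κ) (R₀ : ℝ) :
    ∃ (G : ℝ → ℝ) (f : ℝ × ℝ → ℝ), MemLp G 2 volume ∧ ∫ x, (G x - g x) ^ 2 ≤ κ ^ 2 ∧
      Continuous f ∧ (∀ p, 0 ≤ f p ∧ f p ≤ 1) ∧
      (∀ p ∈ film h, |p.1| ≤ R₀ → p.2 + 2 * κ ≤ h p.1 → f p = 1) ∧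
      ∀ u P Q, IsDisplacement h u P Q →
        ∫ p in film h, ((P p - 1) * f p + G p.1 * Q p * f p) = 0 := by
  obtain ⟨R, hR₀, hRpos, hR⟩ := H.exists_radius (κ := κ / 8) (by positivity) R₀
  obtain ⟨M, hM, hb⟩ := H.exists_bound
  -- With this bound on the L² distance of slopes, Cauchy–Schwarz on an interval of length |x| ≤ R +
  -- 1 ≤ (R + 2)² keeps the primitives within κ/8 of each other.
  set ε := min κ (κ / (8 * (R + 2))) with hε
  have hεpos : 0 < ε := lt_min hκ (by positivity)
  obtain ⟨G, hGc, hGs, hGε⟩ := MemLp.exist_eLpNorm_sub_le (p := 2) (by norm_num) (by norm_num)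
    H.memLp hεpos
  have hG2 : MemLp G 2 volume := hGs.continuous.memLp_of_hasCompactSupport hGc
  have hdiff : MemLp (fun x => g x - G x) 2 volume := H.memLp.sub hG2
  have hS : ∫ x, (g x - G x) ^ 2 ≤ ε ^ 2 := integral_sq_le_of_eLpNorm_le hdiff hεpos.le hGε
  set k : ℝ → ℝ := fun x => h 0 + ∫ t in (0:ℝ)..x, G t with hk
  have hkd : ∀ x, HasDerivAt k (G x) x := fun x =>
    (intervalIntegral.integral_hasDerivAt_right (hGs.continuous.intervalIntegrable _ _)
      (hGs.continuous.stronglyMeasurableAtFilter _ _) hGs.continuous.continuousAt).const_add _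
  have hks : ContDiff ℝ ∞ k := by
    rw [contDiff_infty_iff_deriv, funext fun x => (hkd x).deriv]
    exact ⟨fun x => (hkd x).differentiableAt, hGs⟩
  have hclose : ∀ x, |x| ≤ R + 1 → |k x - h x| ≤ κ / 8 := by
    intro x hx
    have e : k x - h x = ∫ t in (0:ℝ)..x, (G t - g t) := by
      rw [intervalIntegral.integral_sub (hGs.continuous.intervalIntegrable _ _)
        (H.intervalIntegrable _ _), ← H.ftc]
      simp only [hk]; ring
    have hcs : (k x - h x) ^ 2 ≤ ε ^ 2 * |x| := by
      rw [e, intervalIntegral.intervalIntegral_eq_integral_uIoc, smul_eq_mul, mul_pow]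
      have hsq : (if (0:ℝ) ≤ x then (1:ℝ) else -1) ^ 2 = 1 := by split_ifs <;> norm_num
      rw [hsq, one_mul]
      have : IsFiniteMeasure (volume.restrict (Set.uIoc 0 x)) := by
        rw [Set.uIoc]; infer_instance
      have h1 := sq_integral_mul_le (μ := volume.restrict (Set.uIoc 0 x))
        (f := fun t => G t - g t) (g := fun _ => 1) ((hG2.sub H.memLp).restrict _) (memLp_const 1)
      simp only [mul_one, one_pow] at h1
      refine h1.trans ?_
      have h2 : ∫ _ in Set.uIoc 0 x, (1:ℝ) = |x| := by
        simp [Measure.real, Real.volume_uIoc]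
      rw [h2]
      refine mul_le_mul_of_nonneg_right (le_trans ?_ hS) (abs_nonneg _)
      have e3 : ∀ t, (G t - g t) ^ 2 = (g t - G t) ^ 2 := fun t => by ring
      simp only [e3]
      exact setIntegral_le_integral hdiff.integrable_sq (ae_of_all _ fun x => sq_nonneg _)
    refine abs_le_of_sq_le_sq (hcs.trans ?_) (by positivity)
    have hε2 : ε ≤ κ / (8 * (R + 2)) := min_le_right _ _
    have h3 : ε * (R + 2) ≤ κ / 8 := by
      calc ε * (R + 2) ≤ κ / (8 * (R + 2)) * (R + 2) := by gcongr
        _ = κ / 8 := by field_simp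
    calc ε ^ 2 * |x| ≤ ε ^ 2 * (R + 2) ^ 2 := by
          gcongr; nlinarith
      _ = (ε * (R + 2)) ^ 2 := by ring
      _ ≤ (κ / 8) ^ 2 := by gcongr
  set T := Real.smoothTransition with hT
  have hTs : ContDiff ℝ ∞ T := Real.smoothTransition.contDiff
  -- θ cuts off far away in x, χ cuts off just below the substrate and equals one above it, and η
  -- cuts off near the graph of the smooth approximation `k` of the profile.
  set θ : ℝ → ℝ := fun x => T (R + 1 - x) * T (R + 1 + x) with hθ
  set χ : ℝ → ℝ := fun y => T (1 + 16 / κ * y) with hχ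
  set η : ℝ → ℝ := fun t => T (2 / κ * t - 1) with hη
  have hθs : ContDiff ℝ ∞ θ :=
    (hTs.comp (contDiff_const.sub contDiff_id)).mul (hTs.comp (contDiff_const.add contDiff_id))
  have hχs : ContDiff ℝ ∞ χ := hTs.comp (contDiff_const.add (contDiff_const.mul contDiff_id))
  have hηs : ContDiff ℝ ∞ η := hTs.comp ((contDiff_const.mul contDiff_id).sub contDiff_const)
  have hθ1 : ∀ x, |x| ≤ R → θ x = 1 := by
    intro x hx
    have := abs_le.1 hx
    simp only [hθ, hT]
    rw [Real.smoothTransition.one_of_one_le (by linarith),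
      Real.smoothTransition.one_of_one_le (by linarith), one_mul]
  have hθ0 : ∀ x, R + 1 ≤ |x| → θ x = 0 := by
    intro x hx
    simp only [hθ, hT]
    rcases le_abs.1 hx with hx | hx
    · rw [Real.smoothTransition.zero_of_nonpos (by linarith), zero_mul]
    · rw [Real.smoothTransition.zero_of_nonpos (x := R + 1 + x) (by linarith), mul_zero]
  have hχ1 : ∀ y, 0 ≤ y → χ y = 1 := fun y hy =>
    Real.smoothTransition.one_of_one_le (by have : 0 ≤ 16 / κ * y := by positivity
                                            linarith)
  have hχ0 : ∀ y, y ≤ -(κ / 16) → χ y = 0 := by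
    intro y hy
    refine Real.smoothTransition.zero_of_nonpos ?_
    have : 16 / κ * y ≤ 16 / κ * (-(κ / 16)) := by gcongr
    have e : 16 / κ * (-(κ / 16)) = -1 := by field_simp
    linarith
  have hη0 : ∀ t, t ≤ κ / 2 → η t = 0 := by
    intro t ht
    refine Real.smoothTransition.zero_of_nonpos ?_
    have : 2 / κ * t ≤ 2 / κ * (κ / 2) := by gcongr
    have e : 2 / κ * (κ / 2) = 1 := by field_simp
    linarith
  have hη1 : ∀ t, κ ≤ t → η t = 1 := by
    intro t ht
    refine Real.smoothTransition.one_of_one_le ?_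
    have : 2 / κ * κ ≤ 2 / κ * t := by gcongr
    have e : 2 / κ * κ = 2 := by field_simp
    linarith
  set f : ℝ × ℝ → ℝ := fun p => θ p.1 * χ p.2 * η (k p.1 - p.2) with hf
  have hfs : ContDiff ℝ ∞ f :=
    ((hθs.comp contDiff_fst).mul (hχs.comp contDiff_snd)).mul
      (hηs.comp ((hks.comp contDiff_fst).sub contDiff_snd))
  set K : Set (ℝ × ℝ) := {p | |p.1| ≤ R + 1 ∧ -(κ / 16) ≤ p.2 ∧ p.2 ≤ k p.1 - κ / 2} with hK
  have hKcl : IsClosed K :=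
    (isClosed_le (continuous_fst.abs) continuous_const).inter
      ((isClosed_le continuous_const continuous_snd).inter
        (isClosed_le continuous_snd ((hks.continuous.comp continuous_fst).sub continuous_const)))
  -- On `K` one has h ≥ k - κ/8 ≥ y + 3κ/8 ≥ 5κ/16, so both conditions for the subgraph hold; the
  -- margin κ/16 for χ is small enough for this.
  have hKsub : K ⊆ subgraph h := by
    rintro ⟨x, y⟩ ⟨h1, h2, h3⟩
    have := abs_le.1 (hclose x h1)
    simp only at h2 h3
    constructor <;> simp only <;> linarith
  have hKc : IsCompact K := by
    refine (isCompact_Icc (a := ((-(R + 1) : ℝ), (-(κ / 16) : ℝ))) (b := (R + 1, M))).of_isClosed_subset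
      hKcl ?_
    rintro ⟨x, y⟩ hp
    have h4 := (hKsub hp).2
    obtain ⟨h1, h2, h3⟩ := hp
    have h5 := abs_le.1 h1
    exact ⟨⟨h5.1, h2⟩, ⟨h5.2, h4.le.trans (hb x)⟩⟩
  have hfsupp : Function.support f ⊆ K := by
    rintro ⟨x, y⟩ hp
    simp only [hf, Function.mem_support, ne_eq, mul_eq_zero, not_or] at hp
    obtain ⟨⟨p1, p2⟩, p3⟩ := hp
    refine ⟨?_, ?_, ?_⟩
    · by_contra hc; push Not at hc; exact p1 (hθ0 x hc.le)
    · by_contra hc; push Not at hc; exact p2 (hχ0 y hc.le)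
    · by_contra hc; push Not at hc
      simp only at hc
      exact p3 (hη0 _ (by linarith))
  have hft : IsTestFunction (subgraph h) f :=
    ⟨hfs, HasCompactSupport.of_support_subset_isCompact hKc hfsupp,
      (closure_minimal hfsupp hKcl).trans hKsub⟩
  have hGft : IsTestFunction (subgraph h) fun p => G p.1 * f p :=
    ⟨(hGs.comp contDiff_fst).mul hfs, hft.2.1.mul_left,
      tsupport_mul_subset_right.trans hft.2.2⟩
  have hT01 : ∀ x, 0 ≤ T x ∧ T x ≤ 1 := fun x =>
    ⟨Real.smoothTransition.nonneg x, Real.smoothTransition.le_one x⟩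
  refine ⟨G, f, hG2, ?_, hfs.continuous, ?_, ?_, ?_⟩
  · have e3 : ∀ t, (G t - g t) ^ 2 = (g t - G t) ^ 2 := fun t => by ring
    simp only [e3]
    refine hS.trans ?_
    have : ε ≤ κ := min_le_left _ _
    gcongr
  · intro p
    simp only [hf, hθ, hχ, hη]
    have a1 := hT01 (R + 1 - p.1)
    have a2 := hT01 (R + 1 + p.1)
    have a3 := hT01 (1 + 16 / κ * p.2)
    have a4 := hT01 (2 / κ * (k p.1 - p.2) - 1)
    have b1 := mul_le_one₀ a1.2 a2.1 a2.2
    have b2 := mul_le_one₀ b1 a3.1 a3.2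
    exact ⟨mul_nonneg (mul_nonneg (mul_nonneg a1.1 a2.1) a3.1) a4.1, mul_le_one₀ b2 a4.1 a4.2⟩
  · rintro ⟨x, y⟩ hp hx hy
    simp only at hx hy
    have h1 := abs_le.1 (hclose x (by linarith))
    simp only [hf]
    rw [hθ1 x (hx.trans hR₀), hχ1 y hp.1.le, hη1 _ (by linarith)]
    norm_num
  · intro u P Q D
    -- The horizontal identity is tested with f and the vertical one with G f. In the sum, u - x
    -- multiplies (∂_x + G ∂_y) f, which vanishes in the film, so only the gradient terms remain.
    have h1 := D.integral_dx f hft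
    have h2 := D.integral_dy _ hGft
    have hii : ∀ {φ : ℝ × ℝ → ℝ} (hφ : IsTestFunction (subgraph h) φ) (v : ℝ × ℝ),
        IntegrableOn (fun p : ℝ × ℝ => (u p - p.1) * fderiv ℝ φ p v) (film h) := by
      intro φ hφ v
      refine ((integrableOn_mul_fderiv D.memLp hφ v).sub
        (integrableOn_fst_mul_fderiv hφ v)).congr (ae_of_all _ fun p => ?_)
      simp only [Pi.sub_apply]; ring
    have hP : IntegrableOn (fun p : ℝ × ℝ => (P p - 1) * f p) (film h) := by
      refine ((integrable_mul_test D.memLp_dx hft.1.continuous hft.2.1).sub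
        (integrableOn_test hft)).congr (ae_of_all _ fun p => ?_)
      simp only [Pi.sub_apply]; ring
    have hQ : IntegrableOn (fun p : ℝ × ℝ => Q p * (G p.1 * f p)) (film h) :=
      integrable_mul_test D.memLp_dy hGft.1.continuous hGft.2.1
    have h3 := integral_add ((hii hft (1, 0)).add hP) ((hii hGft (0, 1)).add hQ)
    simp only [Pi.add_apply] at h3
    rw [h1, h2, add_zero] at h3
    rw [← h3]
    refine setIntegral_congr_fun H.measurableSet_film ?_
    rintro ⟨x, y⟩ hp
    have hy : 0 < y := hp.1
    have hχd : HasDerivAt χ 0 y := hasDerivAt_zero_of_eventually_const (c := 1) (by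
      filter_upwards [lt_mem_nhds hy] with z hz
      exact hχ1 z hz.le)
    -- θ' can differ from zero only for R ≤ |x| ≤ R + 1. There h < κ/8, so k < κ/4 and η(k - y)
    -- vanishes for y > 0: the lateral cutoff costs nothing.
    have hθd : deriv θ x * η (k x - y) = 0 := by
      rcases lt_or_ge |x| R with hx | hx
      · have : HasDerivAt θ 0 x := hasDerivAt_zero_of_eventually_const (c := 1) (by
          filter_upwards [continuous_abs.continuousAt.eventually (gt_mem_nhds hx)] with z hz
          exact hθ1 z hz.le)
        rw [this.deriv, zero_mul]
      · rcases le_or_gt |x| (R + 1) with hx' | hx'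
        · have h6 := hR x hx
          have h7 := abs_le.1 (hclose x hx')
          rw [hη0 _ (by linarith), mul_zero]
        · have : HasDerivAt θ 0 x := hasDerivAt_zero_of_eventually_const (c := 0) (by
            filter_upwards [continuous_abs.continuousAt.eventually (lt_mem_nhds hx')] with z hz
            exact hθ0 z hz.le)
          rw [this.deriv, zero_mul]
    have key := transport_derivative hθs hχs hηs hkd hks hχd hθd
    have e2 : fderiv ℝ (fun p : ℝ × ℝ => G p.1 * f p) (x, y) (0, 1)
        = G x * fderiv ℝ f (x, y) (0, 1) :=
      (hasDerivAt_snd_slice hGft.contDiff_one x y).unique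
        ((hasDerivAt_snd_slice hft.contDiff_one x y).const_mul (G x))
    simp only [e2]
    linear_combination (-(u (x, y) - x)) * key

/-- The flux identity: the field `(1, h')` is tangential to the free surface. -/
theorem integral_flux (H : IsProfile V h g) (D : IsDisplacement h u P Q) :
    ∫ p in film h, (P p + g p.1 * Q p) = V := by
  have := H.isFiniteMeasure_film
  obtain ⟨M, hM, hb⟩ := H.exists_bound
  have hκ : ∀ n : ℕ, (0 : ℝ) < 1 / (n + 1) := fun n => by positivity
  choose G f hG2 hGg hfc hf01 hf1 hfz using
    fun n : ℕ => H.exists_transport_test (hκ n) n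
  have iP : IntegrableOn (fun p => P p - 1) (film h) :=
    (D.memLp_dx.integrable (by norm_num)).sub (integrable_const 1)
  have iQ : IntegrableOn (fun p : ℝ × ℝ => g p.1 * Q p) (film h) :=
    (H.memLp_film H.memLp).integrable_mul D.memLp_dy
  have iPQ : IntegrableOn (fun p : ℝ × ℝ => (P p - 1) + g p.1 * Q p) (film h) := iP.add iQ
  have hfl : ∀ n p, ‖f n p‖ ≤ 1 := fun n p => by
    rw [Real.norm_of_nonneg (hf01 n p).1]; exact (hf01 n p).2
  have hlim : Tendsto (fun n => ∫ p in film h, ((P p - 1) + g p.1 * Q p) * f n p) atTop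
      (𝓝 (∫ p in film h, ((P p - 1) + g p.1 * Q p))) := by
    refine tendsto_integral_of_dominated_convergence
      (fun p => ‖(P p - 1) + g p.1 * Q p‖) ?_ iPQ.norm ?_ ?_
    · exact fun n => iPQ.aestronglyMeasurable.mul (hfc n).aestronglyMeasurable
    · intro n
      refine ae_of_all _ fun p => ?_
      rw [norm_mul]
      exact mul_le_of_le_one_right (norm_nonneg _) (hfl n p)
    · filter_upwards [ae_restrict_mem H.measurableSet_film] with p hp
      refine tendsto_const_nhds.congr' ?_
      obtain ⟨n₁, h1⟩ := exists_nat_gt |p.1|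
      obtain ⟨n₂, h2⟩ := exists_nat_gt (2 / (h p.1 - p.2))
      filter_upwards [eventually_ge_atTop n₁, eventually_ge_atTop n₂] with n a1 a2
      have b1 : (n₁ : ℝ) ≤ n := Nat.cast_le.2 a1
      have b2 : (n₂ : ℝ) ≤ n := Nat.cast_le.2 a2
      have hpos : 0 < h p.1 - p.2 := by have := hp.2; linarith
      rw [div_lt_iff₀ hpos] at h2
      rw [hf1 n p hp (by linarith), mul_one]
      have : 2 * (1 / ((n : ℝ) + 1)) ≤ h p.1 - p.2 := by
        rw [mul_one_div, div_le_iff₀ (by positivity)]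
        nlinarith
      linarith
  -- The transport identity is exact for the smooth slope `G n`, so the only error is the
  -- replacement of `g` by `G n`. It tends to zero by Cauchy–Schwarz, the height of the film being
  -- bounded.
  have hsplit : ∀ n, ∫ p in film h, ((P p - 1) + g p.1 * Q p) * f n p
      = -∫ p in film h, (G n p.1 - g p.1) * (Q p * f n p) := by
    intro n
    have i1 : IntegrableOn (fun p => ((P p - 1) + g p.1 * Q p) * f n p) (film h) :=
      iPQ.mul_bdd (c := 1) (hfc n).aestronglyMeasurable (ae_of_all _ (hfl n))
    have hQf : MemLp (fun p => Q p * f n p) 2 (volume.restrict (film h)) :=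
      MemLp.of_le D.memLp_dy (D.memLp_dy.aestronglyMeasurable.mul (hfc n).aestronglyMeasurable)
        (ae_of_all _ fun p => by
          rw [norm_mul]; exact mul_le_of_le_one_right (norm_nonneg _) (hfl n p))
    have i2 : IntegrableOn (fun p : ℝ × ℝ => (G n p.1 - g p.1) * (Q p * f n p)) (film h) :=
      (H.memLp_film ((hG2 n).sub H.memLp)).integrable_mul hQf
    rw [← add_eq_zero_iff_eq_neg, ← integral_add i1 i2, ← hfz n u P Q D]
    congr 1; funext p; ring
  have herr : Tendsto (fun n => ∫ p in film h, (G n p.1 - g p.1) * (Q p * f n p)) atTop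
      (𝓝 0) := by
    set C := M * ∫ p in film h, Q p ^ 2 with hC
    have hbound : ∀ n : ℕ, (∫ p in film h, (G n p.1 - g p.1) * (Q p * f n p)) ^ 2
        ≤ (1 / ((n : ℝ) + 1)) ^ 2 * C := by
      intro n
      have hQf : MemLp (fun p => Q p * f n p) 2 (volume.restrict (film h)) :=
        MemLp.of_le D.memLp_dy (D.memLp_dy.aestronglyMeasurable.mul (hfc n).aestronglyMeasurable)
          (ae_of_all _ fun p => by
            rw [norm_mul]; exact mul_le_of_le_one_right (norm_nonneg _) (hfl n p))
      have hd : MemLp (fun x => G n x - g x) 2 volume := (hG2 n).sub H.memLp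
      refine (sq_integral_mul_le (H.memLp_film hd) hQf).trans ?_
      have e1 : ∫ p in film h, (G n p.1 - g p.1) ^ 2 ≤ M * (1 / ((n : ℝ) + 1)) ^ 2 := by
        rw [integral_film_fst H.cont H.nonneg (k := fun x => (G n x - g x) ^ 2)
          hd.integrable_sq.aestronglyMeasurable]
        calc ∫ x, h x * (G n x - g x) ^ 2 ≤ ∫ x, M * (G n x - g x) ^ 2 := by
              refine integral_mono_of_nonneg (ae_of_all _ fun x => ?_)
                (hd.integrable_sq.const_mul M) (ae_of_all _ fun x => ?_)
              · exact mul_nonneg (H.nonneg x) (sq_nonneg _)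
              · exact mul_le_mul_of_nonneg_right (hb x) (sq_nonneg _)
          _ ≤ _ := by
              rw [integral_const_mul]
              exact mul_le_mul_of_nonneg_left (hGg n) hM.le
      have e2 : ∫ p in film h, (Q p * f n p) ^ 2 ≤ ∫ p in film h, Q p ^ 2 := by
        refine integral_mono hQf.integrable_sq D.memLp_dy.integrable_sq fun p => ?_
        simp only [mul_pow]
        refine mul_le_of_le_one_right (sq_nonneg _) (pow_le_one₀ (hf01 n p).1 (hf01 n p).2)
      calc _ ≤ (M * (1 / ((n : ℝ) + 1)) ^ 2) * ∫ p in film h, Q p ^ 2 :=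
            mul_le_mul e1 e2 (integral_nonneg fun p => sq_nonneg _) (by positivity)
        _ = _ := by rw [hC]; ring
    have hlim0 : Tendsto (fun n : ℕ => (1 / ((n : ℝ) + 1)) ^ 2 * C) atTop (𝓝 0) := by
      have := (tendsto_one_div_add_atTop_nhds_zero_nat (𝕜 := ℝ)).pow 2 |>.mul_const C
      simpa using this
    have hsq := squeeze_zero (fun n => sq_nonneg _) hbound hlim0
    have := hsq.sqrt
    simp only [Real.sqrt_sq_eq_abs, Real.sqrt_zero] at this
    exact (tendsto_zero_iff_abs_tendsto_zero _).2 this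
  simp only [hsplit] at hlim
  have h0 := tendsto_nhds_unique hlim (herr.neg)
  rw [neg_zero] at h0
  have h1 : ∫ p in film h, (P p + g p.1 * Q p)
      = (∫ p in film h, ((P p - 1) + g p.1 * Q p)) + ∫ _ in film h, (1 : ℝ) := by
    rw [← integral_add iPQ (integrable_const 1)]
    congr 1; funext p; ring
  rw [h1, h0, H.integral_film_one, zero_add]

/-! ### The lower bound and operations on films -/

section lower

variable {V : ℝ} {h g : ℝ → ℝ} {u P Q : ℝ × ℝ → ℝ}

theorem elastic_nonneg (h : ℝ → ℝ) (P Q : ℝ × ℝ → ℝ) :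
    0 ≤ ∫ p in film h, (P p ^ 2 + Q p ^ 2) :=
  integral_nonneg fun _ => add_nonneg (sq_nonneg _) (sq_nonneg _)

theorem surface_nonneg (g : ℝ → ℝ) : 0 ≤ ∫ x, g x ^ 2 :=
  integral_nonneg fun _ => sq_nonneg _

theorem IsDisplacement.integrable_energy (D : IsDisplacement h u P Q) :
    IntegrableOn (fun p => P p ^ 2 + Q p ^ 2) (film h) :=
  D.memLp_dx.integrable_sq.add D.memLp_dy.integrable_sq

/-- Films of height at most one do not gain energy. -/
theorem volume_le_energy (H : IsProfile V h g) (D : IsDisplacement h u P Q)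
    (h1 : ∀ x, h x ≤ 1) :
    V ≤ (∫ p in film h, (P p ^ 2 + Q p ^ 2)) + ∫ x, g x ^ 2 := by
  have := H.isFiniteMeasure_film
  have hg := H.memLp_film H.memLp
  have iP : IntegrableOn P (film h) := D.memLp_dx.integrable (by norm_num)
  have iQ : IntegrableOn (fun p : ℝ × ℝ => g p.1 * Q p) (film h) := hg.integrable_mul D.memLp_dy
  have i1 : IntegrableOn (fun p => P p + g p.1 * Q p) (film h) := iP.add iQ
  have i2 : IntegrableOn (fun p => (P p ^ 2 + Q p ^ 2) + g p.1 ^ 2) (film h) :=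
    D.integrable_energy.add hg.integrable_sq
  have i3 : IntegrableOn (fun p => ((P p ^ 2 + Q p ^ 2) + g p.1 ^ 2) + 1) (film h) :=
    i2.add (integrable_const 1)
  -- This is (P - 1)² + (Q - g)² ≥ 0. By the flux identity the left side is 2V, while the constant
  -- one contributes V on the right.
  have key : ∫ p in film h, 2 * (P p + g p.1 * Q p)
      ≤ ∫ p in film h, (((P p ^ 2 + Q p ^ 2) + g p.1 ^ 2) + 1) :=
    integral_mono (i1.const_mul 2) i3 fun p => by
      nlinarith [sq_nonneg (P p - 1), sq_nonneg (g p.1 - Q p)]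
  rw [integral_const_mul, integral_flux H D, integral_add i2 (integrable_const 1),
    integral_add D.integrable_energy hg.integrable_sq, H.integral_film_one,
    integral_film_fst H.cont H.nonneg H.integrable_sq.aestronglyMeasurable] at key
  have : ∫ x, h x * g x ^ 2 ≤ ∫ x, g x ^ 2 :=
    integral_mono_of_nonneg (ae_of_all _ fun x => mul_nonneg (H.nonneg x) (sq_nonneg _))
      H.integrable_sq (ae_of_all _ fun x => mul_le_of_le_one_left (sq_nonneg _) (h1 x))
  linarith

/-- Films of small volume do not gain energy. -/
theorem volume_le_energy_of_small (hV : 0 < V) (hV1 : 8 * V ^ 2 ≤ 1) (H : IsProfile V h g)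
    (D : IsDisplacement h u P Q) :
    V ≤ (∫ p in film h, (P p ^ 2 + Q p ^ 2)) + ∫ x, g x ^ 2 := by
  -- Either the surface energy alone suffices, or the cube estimate with T = V gives h³ ≤ 8V² ≤ 1.
  rcases le_total V (∫ x, g x ^ 2) with hS | hS
  · have := elastic_nonneg h P Q
    linarith
  · refine volume_le_energy H D fun x => ?_
    have h3 : h x ^ 3 ≤ 1 ^ 3 := by
      refine (H.cube_le hV hS x).trans ?_
      nlinarith
    exact le_of_pow_le_pow_left₀ (by norm_num) zero_le_one h3

/-- A displacement restricts to a lower film. -/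
theorem IsDisplacement.restrict {h' : ℝ → ℝ} (D : IsDisplacement h u P Q)
    (hle : ∀ x, h' x ≤ h x) : IsDisplacement h' u P Q := by
  have hm := Measure.restrict_mono (film_mono hle) (le_refl (volume : Measure (ℝ × ℝ)))
  have hs := subgraph_mono hle
  refine ⟨D.memLp.mono_measure hm, D.memLp_dx.mono_measure hm, D.memLp_dy.mono_measure hm,
    fun φ hφ => ?_, fun φ hφ => ?_⟩
  -- A test function for the lower film is one for the higher film, and both film integrals equal
  -- the same integral over the upper half plane.
  · have hz : ∀ p ∉ subgraph h',
        (u p - p.1) * fderiv ℝ φ p (1, 0) + (P p - 1) * φ p = 0 := fun p hp => by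
      rw [fderiv_eq_zero_of_notMem hφ.2.2 hp, eq_zero_of_notMem hφ.2.2 hp]; simp
    have := D.integral_dx φ (hφ.mono hs)
    rw [integral_film_eq_upper fun p hp => hz p fun hp' => hp (hs hp')] at this
    rwa [integral_film_eq_upper hz]
  · have hz : ∀ p ∉ subgraph h',
        (u p - p.1) * fderiv ℝ φ p (0, 1) + Q p * φ p = 0 := fun p hp => by
      rw [fderiv_eq_zero_of_notMem hφ.2.2 hp, eq_zero_of_notMem hφ.2.2 hp]; simp
    have := D.integral_dy φ (hφ.mono hs)
    rw [integral_film_eq_upper fun p hp => hz p fun hp' => hp (hs hp')] at this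
    rwa [integral_film_eq_upper hz]

end lower

/-! ### Homotheties of films. -/

section scaling

/-- The homothety `(x, y) ↦ ((x - c) / l, y / l)`. -/
def contraction (l c : ℝ) (p : ℝ × ℝ) : ℝ × ℝ := ((p.1 - c) / l, p.2 / l)

theorem contDiff_contraction (l c : ℝ) : ContDiff ℝ ∞ (contraction l c) := by
  unfold contraction; fun_prop

theorem map_contraction {l : ℝ} (hl : 0 < l) (c : ℝ) :
    (volume : Measure (ℝ × ℝ)).map (contraction l c) = ENNReal.ofReal (l ^ 2) • volume := by
  have e : contraction l c = (fun p : ℝ × ℝ => l⁻¹ • p) ∘ fun p => p - (c, 0) := by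
    funext p
    ext <;> simp [contraction, div_eq_inv_mul]
  rw [e, ← Measure.map_map (by fun_prop) (by fun_prop), map_sub_right_eq_self,
    Measure.map_addHaar_smul _ (inv_ne_zero hl.ne')]
  congr 2
  simp [abs_of_pos hl]

theorem map_line_contraction {l : ℝ} (hl : 0 < l) (c : ℝ) :
    (volume : Measure ℝ).map (fun x => (x - c) / l) = ENNReal.ofReal l • volume := by
  have e : (fun x : ℝ => (x - c) / l) = (fun p : ℝ => l⁻¹ • p) ∘ fun p => p - c := by
    funext p
    simp [div_eq_inv_mul]
  rw [e, ← Measure.map_map (by fun_prop) (by fun_prop), map_sub_right_eq_self,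
    Measure.map_addHaar_smul _ (inv_ne_zero hl.ne')]
  congr 2
  simp [abs_of_pos hl]

theorem integral_line_contraction {l : ℝ} (hl : 0 < l) (c : ℝ) (f : ℝ → ℝ) :
    ∫ x, f ((x - c) / l) = l * ∫ x, f x := by
  have h1 := integral_sub_right_eq_self (μ := volume) (fun x => f (x / l)) c
  rw [h1, Measure.integral_comp_div, abs_of_pos hl, smul_eq_mul]

/-- The homothetic profile. -/
def scaleProfile (l c : ℝ) (h : ℝ → ℝ) (x : ℝ) : ℝ := l * h ((x - c) / l)

variable {V : ℝ} {h g : ℝ → ℝ} {u P Q : ℝ × ℝ → ℝ} {l c : ℝ}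

theorem contraction_preimage_film (hl : 0 < l) :
    contraction l c ⁻¹' film h = film (scaleProfile l c h) := by
  ext p
  simp only [film, contraction, scaleProfile, mem_preimage, mem_ofPred_eq]
  rw [div_lt_iff₀ hl, mul_comm]
  simp [hl]

theorem map_restrict_film (hl : 0 < l) (hc : Continuous h) :
    ((volume : Measure (ℝ × ℝ)).restrict (film (scaleProfile l c h))).map (contraction l c)
      = ENNReal.ofReal (l ^ 2) • volume.restrict (film h) := by
  rw [← Measure.restrict_smul, ← map_contraction hl c, Measure.restrict_map
    (contDiff_contraction l c).continuous.measurable (isOpen_film hc).measurableSet,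
    contraction_preimage_film hl]

theorem measurableEmbedding_contraction (hl : 0 < l) :
    MeasurableEmbedding (contraction l c) := by
  have hinj : Function.Injective (contraction l c) := by
    rintro ⟨x, y⟩ ⟨x', y'⟩ he
    simp only [contraction, Prod.mk.injEq] at he
    have h1 : x - c = x' - c := (div_left_inj' hl.ne').1 he.1
    exact Prod.ext (by simpa using h1) ((div_left_inj' hl.ne').1 he.2)
  exact (contDiff_contraction l c).continuous.measurable.measurableEmbedding hinj

theorem integral_film_scale (hl : 0 < l) (hc : Continuous h) (f : ℝ × ℝ → ℝ) :
    ∫ p in film (scaleProfile l c h), f (contraction l c p) = l ^ 2 * ∫ p in film h, f p := by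
  rw [← (measurableEmbedding_contraction hl).integral_map, map_restrict_film hl hc,
    integral_smul_measure, ENNReal.toReal_ofReal (by positivity), smul_eq_mul]

theorem memLp_film_scale (hl : 0 < l) (hc : Continuous h) {f : ℝ × ℝ → ℝ}
    (hf : MemLp f 2 (volume.restrict (film h))) :
    MemLp (fun p => f (contraction l c p)) 2
      (volume.restrict (film (scaleProfile l c h))) := by
  have h1 : MemLp f 2 ((volume.restrict (film (scaleProfile l c h))).map (contraction l c)) := by
    rw [map_restrict_film hl hc]
    exact hf.smul_measure ENNReal.ofReal_ne_top
  exact h1.comp_of_map (contDiff_contraction l c).continuous.aemeasurable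

theorem IsProfile.scale (H : IsProfile V h g) (hl : 0 < l) (c : ℝ) :
    IsProfile (l ^ 2 * V) (scaleProfile l c h) (fun x => g ((x - c) / l)) := by
  have hcont : Continuous fun x : ℝ => (x - c) / l := by fun_prop
  refine ⟨continuous_const.mul (H.cont.comp hcont), fun x => mul_nonneg hl.le (H.nonneg _),
    ?_, ?_, ?_, fun a b => ?_⟩
  · have : Integrable fun x => h (x / l) := H.integrable.comp_div hl.ne'
    exact (this.comp_sub_right c).const_mul l
  · simp only [scaleProfile]
    rw [integral_const_mul, integral_line_contraction hl c h, H.volume_eq]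
    ring
  · have h1 : MemLp g 2 ((volume : Measure ℝ).map fun x => (x - c) / l) := by
      rw [map_line_contraction hl]
      exact H.memLp.smul_measure ENNReal.ofReal_ne_top
    exact h1.comp_of_map hcont.aemeasurable
  · simp only [scaleProfile]
    rw [← mul_sub, H.ftc]
    have h1 := intervalIntegral.integral_comp_sub_right (fun x => g (x / l)) c (a := a) (b := b)
    rw [h1, intervalIntegral.integral_comp_div g hl.ne', smul_eq_mul]

theorem integral_scale_sq (hl : 0 < l) (c : ℝ) (g : ℝ → ℝ) :
    ∫ x, g ((x - c) / l) ^ 2 = l * ∫ x, g x ^ 2 :=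
  integral_line_contraction hl c fun x => g x ^ 2

theorem IsTestFunction.comp_dilation {φ : ℝ × ℝ → ℝ} (hl : 0 < l)
    (hφ : IsTestFunction (subgraph (scaleProfile l c h)) φ) :
    ∃ ψ, IsTestFunction (subgraph h) ψ ∧ (∀ p, φ p = ψ (contraction l c p)) ∧
      ∀ p, fderiv ℝ φ p (1, 0) = l⁻¹ * fderiv ℝ ψ (contraction l c p) (1, 0) ∧
        fderiv ℝ φ p (0, 1) = l⁻¹ * fderiv ℝ ψ (contraction l c p) (0, 1) := by
  let e : ℝ × ℝ ≃ₜ ℝ × ℝ :=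
    { toFun := fun p => (l * p.1 + c, l * p.2)
      invFun := contraction l c
      left_inv := fun p => by simp [contraction, hl.ne']
      right_inv := fun p => by
        simp only [contraction]
        ext <;> simp <;> field_simp
        ring
      continuous_toFun := by fun_prop
      continuous_invFun := (contDiff_contraction l c).continuous }
  have hes : ContDiff ℝ ∞ e := by
    change ContDiff ℝ ∞ fun p : ℝ × ℝ => (l * p.1 + c, l * p.2)
    fun_prop
  have hψs : ContDiff ℝ ∞ (φ ∘ e) := hφ.1.comp hes
  have hφψ : ∀ p, φ p = (φ ∘ e) (contraction l c p) := fun p =>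
    congrArg φ (e.right_inv p).symm
  refine ⟨φ ∘ e, ⟨hψs, hφ.2.1.comp_homeomorph e, ?_⟩, hφψ, fun p => ?_⟩
  · intro p hp
    rw [tsupport_comp_eq_preimage] at hp
    have h1 := hφ.2.2 hp
    have e1 : e p = (l * p.1 + c, l * p.2) := rfl
    simp only [e1, subgraph, scaleProfile, mem_ofPred_eq, add_sub_cancel_right] at h1
    rw [mul_div_cancel_left₀ _ hl.ne'] at h1
    exact ⟨pos_of_mul_pos_right h1.1 hl.le, lt_of_mul_lt_mul_left h1.2 hl.le⟩
  · obtain ⟨x, y⟩ := p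
    have hψ1 : ContDiff ℝ 1 (φ ∘ e) := hψs.of_le (by exact_mod_cast le_top)
    constructor
    · refine (hasDerivAt_fst_slice hφ.contDiff_one x y).unique ?_
      have h1 := hasDerivAt_fst_slice hψ1 ((x - c) / l) (y / l)
      have h2 : HasDerivAt (fun s : ℝ => (s - c) / l) (l⁻¹) x := by
        simpa using ((hasDerivAt_id x).sub_const c).div_const l
      have h3 := HasDerivAt.comp x h1 h2
      rw [mul_comm] at h3
      exact h3.congr_of_eventuallyEq (Eventually.of_forall fun s => hφψ (s, y))
    · refine (hasDerivAt_snd_slice hφ.contDiff_one x y).unique ?_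
      have h1 := hasDerivAt_snd_slice hψ1 ((x - c) / l) (y / l)
      have h2 : HasDerivAt (fun s : ℝ => s / l) (l⁻¹) y := by
        simpa using (hasDerivAt_id y).div_const l
      have h3 := HasDerivAt.comp y h1 h2
      rw [mul_comm] at h3
      exact h3.congr_of_eventuallyEq (Eventually.of_forall fun s => hφψ (x, s))

/-- The added constant c keeps the boundary datum: u - x is multiplied by l and transported, and the
gradient is only transported. -/
theorem IsDisplacement.scale (H : IsProfile V h g) (D : IsDisplacement h u P Q) (hl : 0 < l)
    (c : ℝ) :
    IsDisplacement (scaleProfile l c h) (fun p => l * u (contraction l c p) + c)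
      (fun p => P (contraction l c p)) (fun p => Q (contraction l c p)) := by
  have := (H.scale hl c).isFiniteMeasure_film
  have hx : ∀ p : ℝ × ℝ, l * u (contraction l c p) + c - p.1
      = l * (u (contraction l c p) - (contraction l c p).1) := by
    intro p
    simp only [contraction]
    field_simp
    ring
  refine ⟨((memLp_film_scale hl H.cont D.memLp).const_mul l).add (memLp_const c),
    memLp_film_scale hl H.cont D.memLp_dx, memLp_film_scale hl H.cont D.memLp_dy,
    fun φ hφ => ?_, fun φ hφ => ?_⟩
  · obtain ⟨ψ, hψ, h1, h2⟩ := hφ.comp_dilation hl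
    have h3 := integral_film_scale (c := c) hl H.cont
      (fun p => (u p - p.1) * fderiv ℝ ψ p (1, 0) + (P p - 1) * ψ p)
    rw [D.integral_dx ψ hψ, mul_zero] at h3
    refine Eq.trans ?_ h3
    congr 1; funext p
    rw [hx, h1, (h2 p).1]
    field_simp
  · obtain ⟨ψ, hψ, h1, h2⟩ := hφ.comp_dilation hl
    have h3 := integral_film_scale (c := c) hl H.cont
      (fun p => (u p - p.1) * fderiv ℝ ψ p (0, 1) + Q p * ψ p)
    rw [D.integral_dy ψ hψ, mul_zero] at h3
    refine Eq.trans ?_ h3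
    congr 1; funext p
    rw [hx, h1, (h2 p).2]
    field_simp

end scaling

/-! ### Compactness -/

/-- Bounded sequences in a separable Hilbert space have weakly convergent subsequences. -/
theorem exists_weak_subseq {E : Type*} [NormedAddCommGroup E] [InnerProductSpace ℝ E]
    [CompleteSpace E] [TopologicalSpace.SeparableSpace E] {x : ℕ → E} {C : ℝ}
    (hx : ∀ n, ‖x n‖ ≤ C) :
    ∃ (y : E) (s : ℕ → ℕ), StrictMono s ∧
      ∀ z, Tendsto (fun n => inner ℝ (x (s n)) z) atTop (𝓝 (inner ℝ y z)) := by
  -- Sequential Banach–Alaoglu in the dual, carried back by the Riesz isometry.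
  have hcomp := WeakDual.isSeqCompact_closedBall ℝ E 0 C
  let f : ℕ → WeakDual ℝ E := fun n =>
    StrongDual.toWeakDual (InnerProductSpace.toDual ℝ E (x n))
  obtain ⟨a, -, s, hs, hlim⟩ := hcomp (x := f) (fun n => by
    simp only [mem_preimage, mem_closedBall_zero_iff]
    change ‖InnerProductSpace.toDual ℝ E (x n)‖ ≤ C
    rw [LinearIsometryEquiv.norm_map]
    exact hx n)
  refine ⟨(InnerProductSpace.toDual ℝ E).symm (WeakDual.toStrongDual a), s, hs, fun z => ?_⟩
  have h1 := ((WeakDual.eval_continuous z).tendsto a).comp hlim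
  rw [InnerProductSpace.toDual_symm_apply]
  exact h1

/-- Sequences of functions bounded in `L²` have weakly convergent subsequences. -/
theorem exists_weak_subseq_L2 {α : Type*} [MeasurableSpace α] {μ : Measure α}
    [IsSeparable μ] {f : ℕ → α → ℝ} (hf : ∀ n, MemLp (f n) 2 μ)
    {C : ℝ} (hC : ∀ n, ∫ x, f n x ^ 2 ∂μ ≤ C) :
    ∃ (F : α → ℝ) (s : ℕ → ℕ), MemLp F 2 μ ∧ StronglyMeasurable F ∧ StrictMono s ∧
      ∀ k, MemLp k 2 μ →
        Tendsto (fun n => ∫ x, f (s n) x * k x ∂μ) atTop (𝓝 (∫ x, F x * k x ∂μ)) := by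
  have hinner : ∀ {a b : α → ℝ} (ha : MemLp a 2 μ) (hb : MemLp b 2 μ),
      inner ℝ (ha.toLp a) (hb.toLp b) = ∫ x, a x * b x ∂μ := by
    intro a b ha hb
    rw [L2.inner_def]
    refine integral_congr_ae ?_
    filter_upwards [ha.coeFn_toLp, hb.coeFn_toLp] with x h1 h2
    rw [h1, h2]
    simp [mul_comm]
  have hn : ∀ n, ‖(hf n).toLp (f n)‖ ≤ √C := by
    intro n
    refine Real.le_sqrt_of_sq_le ?_
    rw [← real_inner_self_eq_norm_sq, hinner]
    simpa [sq] using hC n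
  have : Fact ((2 : ENNReal) ≠ ⊤) := ⟨by norm_num⟩
  obtain ⟨y, s, hs, hlim⟩ := exists_weak_subseq hn
  refine ⟨y, s, Lp.memLp y, Lp.stronglyMeasurable y, hs, fun k hk => ?_⟩
  have h1 := hlim (hk.toLp k)
  have h2 : inner ℝ y (hk.toLp k) = ∫ x, y x * k x ∂μ := by
    rw [← hinner (Lp.memLp y) hk, Lp.toLp_coeFn]
  rw [h2] at h1
  simpa only [hinner (hf _) hk] using h1

/-- A vertical primitive of the horizontal derivative of a test function. -/
theorem exists_vertical_primitive {φ : ℝ × ℝ → ℝ} (hφ : ContDiff ℝ ∞ φ)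
    (hc : HasCompactSupport φ) :
    ∃ Φ : ℝ × ℝ → ℝ, (∀ p : ℝ × ℝ, 0 < p.2 → fderiv ℝ Φ p (0, 1) = fderiv ℝ φ p (1, 0)) ∧
      ∀ h : ℝ → ℝ, tsupport φ ⊆ subgraph h → IsTestFunction (subgraph h) Φ := by
  set ζ : ℝ × ℝ → ℝ := fun p => fderiv ℝ φ p (1, 0) with hζ
  have hζs : ContDiff ℝ ∞ ζ :=
    (hφ.fderiv_right (m := ∞) (by simp)).clm_apply contDiff_const
  have hζc : HasCompactSupport ζ := hasCompactSupport_fderiv_apply' hc _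
  have hζ0 : ∀ p, p ∉ tsupport φ → ζ p = 0 := fun p hp => by
    simp only [hζ]
    rw [fderiv_eq_zero_of_notMem subset_rfl hp]; rfl
  obtain ⟨R, hR⟩ := hc.isCompact.isBounded.subset_closedBall (0 : ℝ × ℝ)
  set S : ℝ := max R 0 with hS
  have hS0 : 0 ≤ S := le_max_right _ _
  have hζS : ∀ x y, 0 < y → ζ (x, y + S) = 0 := by
    intro x y hy
    refine hζ0 _ fun hp => ?_
    have h1 := hR hp
    rw [mem_closedBall_zero_iff, Prod.norm_def] at h1
    have h2 := (le_max_right _ _).trans h1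
    simp only [Real.norm_eq_abs] at h2
    have h3 := (le_abs_self (y + S)).trans h2
    have := le_max_left R 0
    linarith
  -- The primitive is -∫ ζ(x, y + s) ds over 0 < s ≤ S. Written as a convolution with a measure on a
  -- vertical segment it inherits smoothness from ζ. Above the substrate, y + S has left the
  -- support, so the upper endpoint does not contribute to the derivative.
  let μ : Measure (ℝ × ℝ) := (volume.restrict (Ioc 0 S)).map fun s : ℝ => ((0 : ℝ), -s)
  have hmeas : Measurable fun s : ℝ => ((0 : ℝ), -s) := by fun_prop
  have : IsFiniteMeasure μ := Measure.isFiniteMeasure_map _ _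
  set Ψ : ℝ × ℝ → ℝ :=
    convolution (fun _ => (-1 : ℝ)) ζ (ContinuousLinearMap.mul ℝ ℝ) μ with hΨ
  have hΨs : ContDiff ℝ ∞ Ψ :=
    hζc.contDiff_convolution_right _ (integrable_const _).locallyIntegrable hζs
  have hΨe : ∀ x y, Ψ (x, y) = -∫ s in Ioc 0 S, ζ (x, y + s) := by
    intro x y
    simp only [hΨ, convolution, μ]
    rw [integral_map hmeas.aemeasurable, ← integral_neg]
    · simp
    · have : Continuous fun t : ℝ × ℝ => (ContinuousLinearMap.mul ℝ ℝ) (-1) (ζ ((x, y) - t)) := by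
        simp only [ContinuousLinearMap.mul_apply']
        exact continuous_const.mul (hζs.continuous.comp (by fun_prop))
      exact this.aestronglyMeasurable
  refine ⟨Ψ, ?_, fun h hh => ?_⟩
  · rintro ⟨x, y⟩ hy
    have hslice : Continuous fun t => ζ (x, t) := hζs.continuous.comp (by fun_prop)
    set F : ℝ → ℝ := fun z => ∫ t in (0:ℝ)..z, ζ (x, t) with hF
    have hFd : ∀ z, HasDerivAt F (ζ (x, z)) z := fun z =>
      intervalIntegral.integral_hasDerivAt_right (hslice.intervalIntegrable _ _)
        (hslice.stronglyMeasurableAtFilter _ _) hslice.continuousAt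
    have hΨF : ∀ z, Ψ (x, z) = -(F (z + S) - F z) := by
      intro z
      rw [hΨe, ← intervalIntegral.integral_of_le hS0,
        intervalIntegral.integral_comp_add_left (fun t => ζ (x, t)), add_zero]
      simp only [hF]
      rw [intervalIntegral.integral_interval_sub_left (hslice.intervalIntegrable _ _)
        (hslice.intervalIntegrable _ _)]
    have hd : HasDerivAt (fun z => Ψ (x, z)) (-(ζ (x, y + S) - ζ (x, y))) y := by
      have h1 := (((hFd (y + S)).comp_add_const y S).sub (hFd y)).neg
      exact h1.congr_of_eventuallyEq (Eventually.of_forall hΨF)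
    have h2 := (hasDerivAt_snd_slice (hΨs.of_le (by exact_mod_cast le_top)) x y).unique hd
    rw [h2, hζS x y hy]
    simp [hζ]
  · have hKc : IsCompact ((fun q : (ℝ × ℝ) × ℝ => (q.1.1, q.1.2 - q.2)) ''
        (tsupport φ ×ˢ Icc 0 S)) :=
      (hc.isCompact.prod isCompact_Icc).image (by fun_prop)
    have hsupp : Function.support Ψ ⊆ (fun q : (ℝ × ℝ) × ℝ => (q.1.1, q.1.2 - q.2)) ''
        (tsupport φ ×ˢ Icc 0 S) := by
      rintro ⟨x, y⟩ hp
      by_contra hcon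
      refine hp ?_
      rw [hΨe, setIntegral_eq_zero_of_forall_eq_zero, neg_zero]
      intro s hs
      refine hζ0 _ fun hmem => hcon ⟨((x, y + s), s), ⟨hmem, hs.1.le, hs.2⟩, ?_⟩
      simp
    refine ⟨hΨs, HasCompactSupport.of_support_subset_isCompact hKc hsupp,
      (closure_minimal hsupp hKc.isClosed).trans ?_⟩
    -- The support is only moved downwards, and the subgraph is stable under downward translation.
    rintro p ⟨⟨q, s⟩, ⟨hq, hs⟩, rfl⟩
    have := hh hq
    exact ⟨this.1, by have h1 := this.2; have h2 := hs.1; simp only at *; linarith⟩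

/-! ### Vertical primitives vanishing on the substrate. -/

section primitive

variable {h : ℝ → ℝ} {Q : ℝ × ℝ → ℝ}

/-- The vertical primitive of `Q` vanishing on the substrate. -/
def verticalPrimitive (Q : ℝ × ℝ → ℝ) (p : ℝ × ℝ) : ℝ :=
  ∫ t, indicator {s : ℝ | 0 < s ∧ s ≤ p.2} (fun s => Q (p.1, s)) t

theorem stronglyMeasurable_verticalPrimitive (hQ : StronglyMeasurable Q) :
    StronglyMeasurable (verticalPrimitive Q) := by
  have : StronglyMeasurable (Function.uncurry fun (p : ℝ × ℝ) (t : ℝ) =>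
      indicator {s : ℝ | 0 < s ∧ s ≤ p.2} (fun s => Q (p.1, s)) t) := by
    have h1 : StronglyMeasurable fun z : (ℝ × ℝ) × ℝ => Q (z.1.1, z.2) :=
      hQ.comp_measurable (by fun_prop)
    have hm : MeasurableSet {z : (ℝ × ℝ) × ℝ | 0 < z.2 ∧ z.2 ≤ z.1.2} :=
      (measurableSet_lt measurable_const measurable_snd).inter
        (measurableSet_le measurable_snd (measurable_snd.comp measurable_fst))
    exact h1.indicator hm
  exact this.integral_prod_right

theorem verticalPrimitive_eq_zero {p : ℝ × ℝ} (hp : p.2 ≤ 0) : verticalPrimitive Q p = 0 := by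
  have : {s : ℝ | 0 < s ∧ s ≤ p.2} = ∅ := by
    ext s; simp only [mem_ofPred_eq, mem_empty_iff_false, iff_false]; rintro ⟨h1, h2⟩; linarith
  simp [verticalPrimitive, this]

theorem verticalPrimitive_eq (x y : ℝ) :
    verticalPrimitive Q (x, y) = ∫ t in (0:ℝ)..y, indicator (Ioi 0) (fun s => Q (x, s)) t := by
  rcases le_total 0 y with hy | hy
  · rw [intervalIntegral.integral_of_le hy, verticalPrimitive]
    have e : {s : ℝ | 0 < s ∧ s ≤ y} = Ioc 0 y := rfl
    rw [e, integral_indicator measurableSet_Ioc]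
    refine setIntegral_congr_fun measurableSet_Ioc fun t ht => ?_
    have hm : t ∈ Ioi (0 : ℝ) := ht.1
    exact (indicator_of_mem hm fun s => Q (x, s)).symm
  · rw [verticalPrimitive_eq_zero hy, intervalIntegral.integral_of_ge hy,
      setIntegral_eq_zero_of_forall_eq_zero, neg_zero]
    intro t ht
    have hn : t ∉ Ioi (0 : ℝ) := fun h => not_lt.2 ht.2 h
    exact indicator_of_notMem hn _

theorem ae_memLp_slice (hQs : StronglyMeasurable Q) (hQ : MemLp Q 2 volume) :
    ∀ᵐ x : ℝ, MemLp (fun t => Q (x, t)) 2 volume := by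
  have hi := hQ.integrable_sq
  rw [Measure.volume_eq_prod] at hi
  filter_upwards [hi.prod_right_ae] with x hx
  have hm : StronglyMeasurable fun t => Q (x, t) := hQs.comp_measurable (by fun_prop)
  exact (memLp_two_iff_integrable_sq hm.aestronglyMeasurable).2 hx

theorem sq_verticalPrimitive_le {x y : ℝ} (hy : 0 ≤ y)
    (hQ : MemLp (fun t => Q (x, t)) 2 volume) :
    verticalPrimitive Q (x, y) ^ 2 ≤ y * ∫ t, Q (x, t) ^ 2 := by
  have e : {s : ℝ | 0 < s ∧ s ≤ y} = Ioc 0 y := rfl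
  rw [verticalPrimitive, e, integral_indicator measurableSet_Ioc]
  have h1 := sq_integral_mul_le (μ := volume.restrict (Ioc 0 y)) (f := fun t => Q (x, t))
    (g := fun _ => 1) (hQ.restrict _) (memLp_const 1)
  simp only [mul_one, one_pow] at h1
  refine h1.trans ?_
  have h2 : ∫ _ in Ioc 0 y, (1:ℝ) = y := by simp [hy]
  rw [h2, mul_comm]
  exact mul_le_mul_of_nonneg_left
    (setIntegral_le_integral hQ.integrable_sq (ae_of_all _ fun x => sq_nonneg _)) hy

theorem memLp_verticalPrimitive (hc : Continuous h) {M : ℝ} (hM : ∀ x, h x ≤ M)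
    (hQs : StronglyMeasurable Q) (hQ : MemLp Q 2 volume) :
    MemLp (verticalPrimitive Q) 2 (volume.restrict (film h)) := by
  have hm := stronglyMeasurable_verticalPrimitive hQs
  rw [memLp_two_iff_integrable_sq hm.aestronglyMeasurable]
  have hi := hQ.integrable_sq
  rw [Measure.volume_eq_prod] at hi
  have h1 : Integrable fun x => ∫ t, Q (x, t) ^ 2 := hi.integral_prod_left
  have h2 : IntegrableOn (fun p : ℝ × ℝ => ∫ t, Q (p.1, t) ^ 2) (film h) :=
    memLp_one_iff_integrable.1 (memLp_film_fst hc hM (memLp_one_iff_integrable.2 h1))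
  refine (h2.const_mul M).mono' (hm.pow 2).aestronglyMeasurable ?_
  have h3 : ∀ᵐ p : ℝ × ℝ, MemLp (fun t => Q (p.1, t)) 2 volume := by
    rw [Measure.volume_eq_prod]
    exact Measure.quasiMeasurePreserving_fst.ae (ae_memLp_slice hQs hQ)
  filter_upwards [ae_restrict_of_ae h3, ae_restrict_mem (isOpen_film hc).measurableSet]
    with p hp hf
  rw [Real.norm_of_nonneg (sq_nonneg _)]
  refine (sq_verticalPrimitive_le hf.1.le hp).trans ?_
  exact mul_le_mul_of_nonneg_right (hf.2.le.trans (hM _)) (integral_nonneg fun t => sq_nonneg _)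

/-- The vertical primitive has vertical derivative `Q` and vanishes on the substrate. -/
theorem integral_verticalPrimitive (hc : Continuous h) {M : ℝ} (hM : ∀ x, h x ≤ M)
    (hQs : StronglyMeasurable Q) (hQ : MemLp Q 2 volume) {φ : ℝ × ℝ → ℝ}
    (hφ : IsTestFunction (subgraph h) φ) :
    ∫ p in film h, (verticalPrimitive Q p * fderiv ℝ φ p (0, 1) + Q p * φ p) = 0 := by
  -- Truncating Q to y > 0 makes the integrand vanish off the film, so the integral runs over the
  -- whole plane. Fubini then leaves, on almost every vertical line, a one-dimensional integration
  -- by parts without boundary terms.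
  set T : ℝ × ℝ → ℝ := fun p => indicator (Ioi 0) (fun s => Q (p.1, s)) p.2 with hT
  set f : ℝ × ℝ → ℝ := fun p => verticalPrimitive Q p * fderiv ℝ φ p (0, 1) + T p * φ p with hf
  have hTQ : ∀ p : ℝ × ℝ, 0 < p.2 → T p = Q p := fun p hp =>
    indicator_of_mem (show p.2 ∈ Ioi 0 from hp) _
  have hms := (isOpen_film hc).measurableSet
  have e1 : ∫ p in film h, (verticalPrimitive Q p * fderiv ℝ φ p (0, 1) + Q p * φ p)
      = ∫ p in film h, f p :=
    setIntegral_congr_fun hms fun p hp => by simp only [hf, hTQ p hp.1]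
  have hoff : ∀ p, p ∉ film h → f p = 0 := by
    intro p hp
    rcases le_or_gt p.2 0 with hy | hy
    · have : T p = 0 := indicator_of_notMem (fun h => not_lt.2 hy h) _
      simp only [hf, verticalPrimitive_eq_zero hy, this, zero_mul, add_zero]
    · have hs := upper_inter_notMem_film hy hp
      simp only [hf]
      rw [fderiv_eq_zero_of_notMem hφ.2.2 hs, eq_zero_of_notMem hφ.2.2 hs]
      simp
  have hi : IntegrableOn f (film h) := by
    refine ((integrableOn_mul_fderiv (memLp_verticalPrimitive hc hM hQs hQ) hφ (0, 1)).add
      (integrable_mul_test (hQ.restrict _) hφ.1.continuous hφ.2.1)).congr ?_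
    filter_upwards [ae_restrict_mem hms] with p hp
    simp only [hf, hTQ p hp.1, Pi.add_apply]
  have hi' : Integrable f := (integrableOn_iff_integrable_of_support_subset fun p hp => by
    by_contra hp'; exact hp (hoff p hp')).1 hi
  rw [e1, setIntegral_eq_integral_of_forall_compl_eq_zero hoff]
  rw [Measure.volume_eq_prod] at hi' ⊢
  rw [integral_prod _ hi', integral_eq_zero_of_ae]
  filter_upwards [ae_memLp_slice hQs hQ, hi'.prod_right_ae] with x hx hxi
  simp only [Pi.zero_apply, hf, hT]
  have hloc : LocallyIntegrable (indicator (Ioi 0) fun s => Q (x, s)) :=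
    (hx.indicator measurableSet_Ioi).locallyIntegrable (by norm_num)
  have hii : ∀ a b, IntervalIntegrable (indicator (Ioi 0) fun s => Q (x, s)) volume a b :=
    fun a b => (hloc.integrableOn_isCompact isCompact_uIcc).intervalIntegrable
  have hftc : ∀ a b, verticalPrimitive Q (x, b) - verticalPrimitive Q (x, a)
      = ∫ t in a..b, indicator (Ioi 0) (fun s => Q (x, s)) t := fun a b => by
    rw [verticalPrimitive_eq, verticalPrimitive_eq]
    exact intervalIntegral.integral_interval_sub_left (hii _ _) (hii _ _)
  have hφs : ContDiff ℝ 1 fun s => φ (x, s) := hφ.contDiff_one.comp (by fun_prop)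
  have hφc := hasCompactSupport_snd_slice hφ.2.1 x
  have key := integral_mul_deriv_of_primitive (h := fun y => verticalPrimitive Q (x, y))
    hloc hftc hφs hφc
  have hd : deriv (fun s => φ (x, s)) = fun y => fderiv ℝ φ (x, y) (0, 1) :=
    funext fun y => (hasDerivAt_snd_slice hφ.contDiff_one x y).deriv
  rw [hd] at key
  have i2 : Integrable fun s => indicator (Ioi 0) (fun s => Q (x, s)) s * φ (x, s) :=
    MemLp.integrable_mul (p := 2) (q := 2) (hx.indicator measurableSet_Ioi)
      (hφs.continuous.memLp_of_hasCompactSupport hφc)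
  have i1 : Integrable fun s => verticalPrimitive Q (x, s) * fderiv ℝ φ (x, s) (0, 1) := by
    refine (hxi.sub i2).congr (ae_of_all _ fun s => ?_)
    simp only [Pi.sub_apply, hf, hT]
    ring
  rw [integral_add i1 i2, key]
  ring

end primitive

theorem tendsto_interval_integral_of_weak {g : ℕ → ℝ → ℝ} {g' : ℝ → ℝ}
    (hw : ∀ k, MemLp k 2 volume →
      Tendsto (fun n => ∫ x, g n x * k x) atTop (𝓝 (∫ x, g' x * k x))) (a b : ℝ) :
    Tendsto (fun n => ∫ x in a..b, g n x) atTop (𝓝 (∫ x in a..b, g' x)) := by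
  have h1 := hw (indicator (Set.uIoc a b) fun _ => 1)
    ((memLp_indicator_const 2 measurableSet_uIoc 1 (Or.inr (by simp [Real.volume_uIoc]))))
  have e : ∀ f : ℝ → ℝ, ∫ x, f x * indicator (Set.uIoc a b) (fun _ => (1:ℝ)) x
      = ∫ x in Set.uIoc a b, f x := by
    intro f
    rw [← integral_indicator measurableSet_uIoc]
    congr 1; funext x
    by_cases hx : x ∈ Set.uIoc a b <;> simp [hx]
  simp only [e] at h1
  simp only [intervalIntegral.intervalIntegral_eq_integral_uIoc]
  exact h1.const_smul _

/-- Compact subsets of the limiting subgraph eventually lie in the approximating subgraphs. -/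
theorem eventually_subset_subgraph {h : ℕ → ℝ → ℝ} {h' : ℝ → ℝ} {C : ℝ} (hC : 0 < C)
    (hH : ∀ n a b, (h n b - h n a) ^ 2 ≤ C * |b - a|)
    (hlim : ∀ x, Tendsto (fun n => h n x) atTop (𝓝 (h' x))) {K : Set (ℝ × ℝ)}
    (hK : IsCompact K) (hsub : K ⊆ subgraph h') : ∀ᶠ n in atTop, K ⊆ subgraph (h n) := by
  refine hK.induction_on (p := fun s => ∀ᶠ n in atTop, s ⊆ subgraph (h n)) (by simp)
    (fun s t hst ht => ht.mono fun n hn => hst.trans hn)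
    (fun s t hs ht => by filter_upwards [hs, ht] with n h1 h2 using union_subset h1 h2) ?_
  intro p hp
  obtain ⟨h1, h2⟩ := hsub hp
  -- The slack 4δ covers a loss δ from pointwise convergence at `p.1`, a loss δ from the uniform
  -- Hölder bound near `p.1`, and the vertical size δ of the neighbourhood.
  set δ := min (h' p.1) (h' p.1 - p.2) / 4 with hδ
  have hδ0 : 0 < δ := by
    have : 0 < min (h' p.1) (h' p.1 - p.2) := lt_min h1 (by linarith)
    positivity
  have hδ1 : 4 * δ ≤ h' p.1 := by
    have := min_le_left (h' p.1) (h' p.1 - p.2); rw [hδ]; linarith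
  have hδ2 : 4 * δ ≤ h' p.1 - p.2 := by
    have := min_le_right (h' p.1) (h' p.1 - p.2); rw [hδ]; linarith
  have hr : 0 < δ ^ 2 / C := by positivity
  refine ⟨{q | |q.1 - p.1| < δ ^ 2 / C ∧ q.2 < p.2 + δ}, mem_nhdsWithin_of_mem_nhds ?_, ?_⟩
  · have ho : IsOpen {q : ℝ × ℝ | |q.1 - p.1| < δ ^ 2 / C ∧ q.2 < p.2 + δ} :=
      (isOpen_lt (continuous_fst.sub continuous_const).abs continuous_const).inter
        (isOpen_lt continuous_snd continuous_const)
    exact ho.mem_nhds ⟨by simpa using hr, by linarith⟩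
  · filter_upwards [(hlim p.1).eventually (lt_mem_nhds (show h' p.1 - δ < h' p.1 by linarith))]
      with n hn
    rintro q ⟨hq1, hq2⟩
    have h3 : (h n q.1 - h n p.1) ^ 2 ≤ δ ^ 2 := by
      refine (hH n p.1 q.1).trans ?_
      calc C * |q.1 - p.1| ≤ C * (δ ^ 2 / C) := by gcongr
        _ = δ ^ 2 := by field_simp
    have h4 := abs_le.1 (abs_le_of_sq_le_sq h3 hδ0.le)
    constructor
    · linarith
    · linarith

/-! ### Limits of films on a fixed bounded base. -/

section limit

variable {V L f C : ℝ} {h g : ℕ → ℝ → ℝ} {u P Q : ℕ → ℝ × ℝ → ℝ} {g' : ℝ → ℝ} {P' Q' : ℝ × ℝ → ℝ}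

/-- A weak limit of profiles supported in a fixed bounded interval is a profile. -/
theorem isProfile_of_weak_limit (hC : 0 < C) (H : ∀ n, IsProfile V (h n) (g n))
    (hS : ∀ n, ∫ x, g n x ^ 2 ≤ C) (hz : ∀ n x, x ∉ Ioo 0 L → h n x = 0)
    (hg' : MemLp g' 2 volume)
    (wg : ∀ k, MemLp k 2 volume →
      Tendsto (fun n => ∫ x, g n x * k x) atTop (𝓝 (∫ x, g' x * k x))) :
    IsProfile V (fun x => ∫ t in (0:ℝ)..x, g' t) g' ∧
      ∀ x, Tendsto (fun n => h n x) atTop (𝓝 (∫ t in (0:ℝ)..x, g' t)) := by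
  have hloc : LocallyIntegrable g' := hg'.locallyIntegrable (by norm_num)
  have hii : ∀ a b, IntervalIntegrable g' volume a b := fun a b =>
    (hloc.integrableOn_isCompact isCompact_uIcc).intervalIntegrable
  have hn : ∀ n x, h n x = ∫ t in (0:ℝ)..x, g n t := by
    intro n x
    rw [← (H n).ftc, hz n 0 (by simp), sub_zero]
  have hlim : ∀ x, Tendsto (fun n => h n x) atTop (𝓝 (∫ t in (0:ℝ)..x, g' t)) := by
    intro x
    simp only [hn]
    exact tendsto_interval_integral_of_weak wg 0 x
  set h' : ℝ → ℝ := fun x => ∫ t in (0:ℝ)..x, g' t with hh'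
  have hc : Continuous h' := intervalIntegral.continuous_primitive hii 0
  have hz' : ∀ x, x ∉ Ioo 0 L → h' x = 0 := by
    intro x hx
    have := hlim x
    simp only [hz _ x hx] at this
    exact (tendsto_nhds_unique this tendsto_const_nhds)
  have hcomp : HasCompactSupport h' :=
    HasCompactSupport.of_support_subset_isCompact (isCompact_Icc (a := 0) (b := L)) fun x hx => by
      by_contra hx'
      exact hx (hz' x fun h => hx' ⟨h.1.le, h.2.le⟩)
  have hi : Integrable h' := hc.integrable_of_hasCompactSupport hcomp
  refine ⟨⟨hc, fun x => ge_of_tendsto' (hlim x) fun n => (H n).nonneg x, hi, ?_, hg',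
    fun a b => intervalIntegral.integral_interval_sub_left (hii _ _) (hii _ _)⟩, hlim⟩
  -- The fixed base preserves the volume: the Hölder bound from the zero at x = 0 dominates all
  -- profiles by √(CL) on (0, L).
  have hdom : Tendsto (fun n => ∫ x, h n x) atTop (𝓝 (∫ x, h' x)) := by
    refine tendsto_integral_of_dominated_convergence
      (indicator (Ioo 0 L) fun _ => √(C * L)) (fun n => (H n).cont.aestronglyMeasurable) ?_ ?_
      (ae_of_all _ hlim)
    · rw [integrable_indicator_iff measurableSet_Ioo]
      exact integrableOn_const (by simp)
    · intro n
      refine ae_of_all _ fun x => ?_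
      by_cases hx : x ∈ Ioo 0 L
      · rw [indicator_of_mem hx, Real.norm_of_nonneg ((H n).nonneg x)]
        refine Real.le_sqrt_of_sq_le ?_
        have := (H n).sq_sub_le 0 x
        rw [hz n 0 (by simp), sub_zero, sub_zero, abs_of_pos hx.1] at this
        exact this.trans (mul_le_mul (hS n) hx.2.le hx.1.le hC.le)
      · rw [indicator_of_notMem hx, hz n x hx, norm_zero]
  simp only [(H _).volume_eq] at hdom
  exact tendsto_nhds_unique hdom tendsto_const_nhds

/-- Weak limits of displacements are displacements of the limiting film. -/
theorem isDisplacement_of_weak_limit {h' : ℝ → ℝ} (hC : 0 < C)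
    (H : ∀ n, IsProfile V (h n) (g n)) (H' : IsProfile V h' g')
    (hS : ∀ n, ∫ x, g n x ^ 2 ≤ C) (hz' : ∀ x, x ∉ Ioo 0 L → h' x = 0)
    (hlim : ∀ x, Tendsto (fun n => h n x) atTop (𝓝 (h' x)))
    (D : ∀ n, IsDisplacement (h n) (u n) (P n) (Q n))
    (hP' : MemLp P' 2 volume) (hQ' : MemLp Q' 2 volume) (hQs : StronglyMeasurable Q')
    (wP : ∀ k, MemLp k 2 volume → Tendsto
      (fun n => ∫ p, indicator (film (h n)) (P n) p * k p) atTop (𝓝 (∫ p, P' p * k p)))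
    (wQ : ∀ k, MemLp k 2 volume → Tendsto
      (fun n => ∫ p, indicator (film (h n)) (Q n) p * k p) atTop (𝓝 (∫ p, Q' p * k p))) :
    IsDisplacement h' (fun p => p.1 + verticalPrimitive Q' p) P' Q' := by
  have := H'.isFiniteMeasure_film
  obtain ⟨M, -, hM⟩ := H'.exists_bound
  have hW := memLp_verticalPrimitive H'.cont hM hQs hQ'
  have hx : MemLp (fun p : ℝ × ℝ => p.1) 2 (volume.restrict (film h')) := by
    refine MemLp.of_bound (by fun_prop) |L| ?_
    filter_upwards [ae_restrict_mem H'.measurableSet_film] with p hp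
    have hp0 : p.1 ∈ Ioo 0 L := by
      by_contra hcon
      have := hp.1.trans hp.2
      rw [hz' _ hcon] at this
      exact lt_irrefl _ this
    rw [Real.norm_of_nonneg hp0.1.le]
    exact hp0.2.le.trans (le_abs_self L)
  have hdy : ∀ φ : ℝ × ℝ → ℝ, IsTestFunction (subgraph h') φ → ∫ p in film h',
      (verticalPrimitive Q' p * fderiv ℝ φ p (0, 1) + Q' p * φ p) = 0 := fun φ hφ =>
    integral_verticalPrimitive H'.cont hM hQs hQ' hφ
  refine ⟨hx.add hW, hP'.restrict _, hQ'.restrict _, fun φ hφ => ?_, fun φ hφ => ?_⟩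
  swap
  · simpa only [add_sub_cancel_left] using hdy φ hφ
  simp only [add_sub_cancel_left]
  -- With w = u - x and ∂_yΦ = ∂_xφ in the film, ∫ w ∂_xφ = ∫ w ∂_yΦ = -∫ QΦ. The horizontal
  -- identity thus becomes a linear relation between P and Q alone, which passes to weak limits.
  obtain ⟨Φ, hΦ1, hΦ2⟩ := exists_vertical_primitive hφ.1 hφ.2.1
  have hΦ := hΦ2 h' hφ.2.2
  have hup : MeasurableSet (univ ×ˢ Ioi (0:ℝ) : Set (ℝ × ℝ)) :=
    MeasurableSet.univ.prod measurableSet_Ioi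
  have hlin : ∀ {k : ℝ → ℝ} {w A B : ℝ × ℝ → ℝ}, Continuous k →
      IsTestFunction (subgraph k) φ → IsTestFunction (subgraph k) Φ →
      MemLp A 2 (volume.restrict (film k)) → MemLp B 2 (volume.restrict (film k)) →
      (∀ v, IntegrableOn (fun p => w p * fderiv ℝ φ p v) (film k)) →
      (∀ v, IntegrableOn (fun p => w p * fderiv ℝ Φ p v) (film k)) →
      ∫ p in film k, (w p * fderiv ℝ Φ p (0, 1) + B p * Φ p) = 0 →
      ∫ p in film k, (w p * fderiv ℝ φ p (1, 0) + (A p - 1) * φ p)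
        = (∫ p in film k, A p * φ p) - (∫ p in film k, B p * Φ p) - ∫ p in film k, φ p := by
    intro k w A B hk h1 h2 hA hB iw iW h3
    have iA := integrable_mul_test hA h1.1.continuous h1.2.1
    have iB := integrable_mul_test hB h2.1.continuous h2.2.1
    have iφ := integrableOn_test (s := film k) h1
    rw [integral_add (iW (0, 1)) iB] at h3
    have h4 : ∫ p in film k, w p * fderiv ℝ Φ p (0, 1)
        = ∫ p in film k, w p * fderiv ℝ φ p (1, 0) :=
      setIntegral_congr_fun (isOpen_film hk).measurableSet fun p hp => by
        simp only [hΦ1 p hp.1]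
    have h5 : ∫ p in film k, (A p - 1) * φ p
        = (∫ p in film k, A p * φ p) - ∫ p in film k, φ p := by
      rw [← integral_sub iA iφ]
      congr 1; funext p; ring
    have iA' : IntegrableOn (fun p => (A p - 1) * φ p) (film k) :=
      (iA.sub iφ).congr (ae_of_all _ fun p => by simp only [Pi.sub_apply]; ring)
    rw [integral_add (iw (1, 0)) iA', h5]
    linarith
  -- Cutting the test function to the upper half plane, and not to the film, gives an L² test that
  -- does not vary along the sequence.
  have hind : ∀ {k : ℝ → ℝ} {A ψ : ℝ × ℝ → ℝ}, IsTestFunction (subgraph k) ψ →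
      Continuous k → ∫ p, indicator (film k) A p * indicator (univ ×ˢ Ioi (0:ℝ)) ψ p
        = ∫ p in film k, A p * ψ p := by
    intro k A ψ hψ hk
    rw [← integral_indicator (isOpen_film hk).measurableSet]
    congr 1; funext p
    by_cases hp : p ∈ film k
    · have hp' : p ∈ (univ ×ˢ Ioi (0:ℝ) : Set (ℝ × ℝ)) := ⟨mem_univ _, hp.1⟩
      rw [indicator_of_mem hp, indicator_of_mem hp, indicator_of_mem hp']
    · rw [indicator_of_notMem hp, indicator_of_notMem hp, zero_mul]
  have hind' : ∀ {A ψ : ℝ × ℝ → ℝ}, IsTestFunction (subgraph h') ψ →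
      ∫ p, A p * indicator (univ ×ˢ Ioi (0:ℝ)) ψ p = ∫ p in film h', A p * ψ p := by
    intro A ψ hψ
    rw [integral_film_eq_upper (fun p hp => by rw [eq_zero_of_notMem hψ.2.2 hp, mul_zero]),
      ← integral_indicator hup]
    congr 1; funext p
    by_cases hp : p ∈ (univ ×ˢ Ioi (0:ℝ) : Set (ℝ × ℝ)) <;> simp [hp]
  have hev := eventually_subset_subgraph hC
    (fun n a b => ((H n).sq_sub_le a b).trans
      (mul_le_mul_of_nonneg_right (hS n) (abs_nonneg _))) hlim hφ.2.1.isCompact hφ.2.2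
  have hwint : ∀ n {ψ : ℝ × ℝ → ℝ}, IsTestFunction (subgraph (h n)) ψ → ∀ v,
      IntegrableOn (fun p => (u n p - p.1) * fderiv ℝ ψ p v) (film (h n)) := by
    intro n ψ hψ v
    refine ((integrableOn_mul_fderiv (D n).memLp hψ v).sub
      (integrableOn_fst_mul_fderiv hψ v)).congr (ae_of_all _ fun p => ?_)
    simp only [Pi.sub_apply]; ring
  have hzero : ∀ᶠ n in atTop,
      (∫ p, indicator (film (h n)) (P n) p * indicator (univ ×ˢ Ioi (0:ℝ)) φ p)
        - (∫ p, indicator (film (h n)) (Q n) p * indicator (univ ×ˢ Ioi (0:ℝ)) Φ p)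
        - (∫ p in univ ×ˢ Ioi (0:ℝ), φ p) = 0 := by
    filter_upwards [hev] with n hn
    have h1 : IsTestFunction (subgraph (h n)) φ := ⟨hφ.1, hφ.2.1, hn⟩
    have h2 := hΦ2 (h n) hn
    rw [hind h1 (H n).cont, hind h2 (H n).cont,
      ← integral_film_eq_upper (fun p hp => eq_zero_of_notMem hn hp),
      ← hlin (w := fun p => u n p - p.1) (H n).cont h1 h2 (D n).memLp_dx (D n).memLp_dy
        (hwint n h1) (hwint n h2) ((D n).integral_dy Φ h2)]
    exact (D n).integral_dx φ h1
  have hk : ∀ {ψ : ℝ × ℝ → ℝ}, IsTestFunction (subgraph h') ψ →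
      MemLp (indicator (univ ×ˢ Ioi (0:ℝ)) ψ) 2 volume := fun hψ =>
    (hψ.1.continuous.memLp_of_hasCompactSupport hψ.2.1).indicator hup
  have hconv := ((wP _ (hk hφ)).sub (wQ _ (hk hΦ))).sub_const (∫ p in univ ×ˢ Ioi (0:ℝ), φ p)
  rw [hind' hφ, hind' hΦ, ← integral_film_eq_upper
    (fun p hp => eq_zero_of_notMem hφ.2.2 hp)] at hconv
  have hl0 := tendsto_nhds_unique (hconv.congr' (f₂ := fun _ => (0 : ℝ)) (by
    filter_upwards [hzero] with n hn
    rwa [integral_film_eq_upper (fun p hp => eq_zero_of_notMem hφ.2.2 hp)]))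
    tendsto_const_nhds
  rw [hlin (w := verticalPrimitive Q') H'.cont hφ hΦ (hP'.restrict _) (hQ'.restrict _)
    (fun v => integrableOn_mul_fderiv hW hφ v) (fun v => integrableOn_mul_fderiv hW hΦ v)
    (hdy Φ hΦ)]
  exact hl0

theorem two_mul_integral_mul_le {α : Type*} [MeasurableSpace α] {μ : Measure α} {a b : α → ℝ}
    (ha : MemLp a 2 μ) (hb : MemLp b 2 μ) :
    2 * ∫ x, a x * b x ∂μ ≤ (∫ x, a x ^ 2 ∂μ) + ∫ x, b x ^ 2 ∂μ := by
  rw [← integral_const_mul, ← integral_add ha.integrable_sq hb.integrable_sq]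
  refine integral_mono ((ha.integrable_mul hb).const_mul 2)
    (ha.integrable_sq.add hb.integrable_sq) fun x => ?_
  have := two_mul_le_add_sq (a x) (b x)
  simp only
  linarith

theorem integral_indicator_sq {s : Set (ℝ × ℝ)} (hs : MeasurableSet s) (f : ℝ × ℝ → ℝ) :
    ∫ p, indicator s f p ^ 2 = ∫ p in s, f p ^ 2 := by
  rw [← integral_indicator hs]
  congr 1; funext p
  by_cases hp : p ∈ s <;> simp [hp]

/-- Sequences of films in a fixed bounded interval have a limit film of no more energy. -/
theorem exists_limit_film (H : ∀ n, IsProfile V (h n) (g n))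
    (D : ∀ n, IsDisplacement (h n) (u n) (P n) (Q n)) (hz : ∀ n x, x ∉ Ioo 0 L → h n x = 0)
    (hF : Tendsto (fun n => (∫ p in film (h n), (P n p ^ 2 + Q n p ^ 2)) + ∫ x, g n x ^ 2)
      atTop (𝓝 f)) :
    ∃ (h' g' : ℝ → ℝ) (u' P' Q' : ℝ × ℝ → ℝ), IsProfile V h' g' ∧
      IsDisplacement h' u' P' Q' ∧
      (∫ p in film h', (P' p ^ 2 + Q' p ^ 2)) + ∫ x, g' x ^ 2 ≤ f := by
  obtain ⟨C₀, hC₀⟩ := hF.bddAbove_range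
  set C := max C₀ 1 with hCdef
  have hC : 0 < C := lt_of_lt_of_le one_pos (le_max_right _ _)
  have hbound : ∀ n, (∫ p in film (h n), (P n p ^ 2 + Q n p ^ 2)) + ∫ x, g n x ^ 2 ≤ C :=
    fun n => (hC₀ ⟨n, rfl⟩).trans (le_max_left _ _)
  have hEadd : ∀ n, ∫ p in film (h n), (P n p ^ 2 + Q n p ^ 2)
      = (∫ p, indicator (film (h n)) (P n) p ^ 2) + ∫ p, indicator (film (h n)) (Q n) p ^ 2 := by
    intro n
    rw [integral_indicator_sq (H n).measurableSet_film,
      integral_indicator_sq (H n).measurableSet_film,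
      ← integral_add (D n).memLp_dx.integrable_sq (D n).memLp_dy.integrable_sq]
  have hPm : ∀ n, MemLp (indicator (film (h n)) (P n)) 2 volume := fun n =>
    (memLp_indicator_iff_restrict (H n).measurableSet_film).2 (D n).memLp_dx
  have hQm : ∀ n, MemLp (indicator (film (h n)) (Q n)) 2 volume := fun n =>
    (memLp_indicator_iff_restrict (H n).measurableSet_film).2 (D n).memLp_dy
  have n1 : ∀ n, 0 ≤ ∫ p, indicator (film (h n)) (P n) p ^ 2 := fun n =>
    integral_nonneg fun _ => sq_nonneg _
  have n2 : ∀ n, 0 ≤ ∫ p, indicator (film (h n)) (Q n) p ^ 2 := fun n =>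
    integral_nonneg fun _ => sq_nonneg _
  have n3 : ∀ n, 0 ≤ ∫ x, g n x ^ 2 := fun n => surface_nonneg _
  have hSC : ∀ n, ∫ x, g n x ^ 2 ≤ C := fun n => by
    have := hbound n; rw [hEadd] at this; linarith [n1 n, n2 n]
  obtain ⟨g', s₁, hg', -, hs₁, w₁⟩ := exists_weak_subseq_L2 (fun n => (H n).memLp) hSC
  obtain ⟨P', s₂, hP', -, hs₂, w₂⟩ := exists_weak_subseq_L2 (fun n => hPm (s₁ n)) (C := C)
    (fun n => by
      have := hbound (s₁ n); rw [hEadd] at this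
      linarith [n2 (s₁ n), n3 (s₁ n)])
  obtain ⟨Q', s₃, hQ', hQs, hs₃, w₃⟩ := exists_weak_subseq_L2 (fun n => hQm (s₁ (s₂ n))) (C := C)
    (fun n => by
      have := hbound (s₁ (s₂ n)); rw [hEadd] at this
      linarith [n1 (s₁ (s₂ n)), n3 (s₁ (s₂ n))])
  set s : ℕ → ℕ := fun n => s₁ (s₂ (s₃ n)) with hs
  have hsm : Tendsto s atTop atTop :=
    hs₁.tendsto_atTop.comp (hs₂.tendsto_atTop.comp hs₃.tendsto_atTop)
  have wg : ∀ k, MemLp k 2 volume →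
      Tendsto (fun n => ∫ x, g (s n) x * k x) atTop (𝓝 (∫ x, g' x * k x)) := fun k hk =>
    (w₁ k hk).comp (hs₂.tendsto_atTop.comp hs₃.tendsto_atTop)
  have wP : ∀ k, MemLp k 2 volume → Tendsto
      (fun n => ∫ p, indicator (film (h (s n))) (P (s n)) p * k p) atTop
        (𝓝 (∫ p, P' p * k p)) := fun k hk => (w₂ k hk).comp hs₃.tendsto_atTop
  have wQ : ∀ k, MemLp k 2 volume → Tendsto
      (fun n => ∫ p, indicator (film (h (s n))) (Q (s n)) p * k p) atTop
        (𝓝 (∫ p, Q' p * k p)) := w₃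
  obtain ⟨H', hlim⟩ := isProfile_of_weak_limit hC (fun n => H (s n)) (fun n => hSC (s n))
    (fun n => hz (s n)) hg' wg
  have hz' : ∀ x, x ∉ Ioo 0 L → ∫ t in (0:ℝ)..x, g' t = 0 := by
    intro x hx
    have := hlim x
    simp only [hz _ x hx] at this
    exact (tendsto_nhds_unique this tendsto_const_nhds)
  have D' := isDisplacement_of_weak_limit hC (fun n => H (s n)) H' (fun n => hSC (s n)) hz' hlim
    (fun n => D (s n)) hP' hQ' hQs wP wQ
  refine ⟨_, g', _, P', Q', H', D', ?_⟩
  set F' := (∫ p, P' p ^ 2) + (∫ p, Q' p ^ 2) + ∫ x, g' x ^ 2 with hF'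
  -- The weak limits live on the whole plane; their energy outside the limit film is discarded.
  have hle : (∫ p in film fun x => ∫ t in (0:ℝ)..x, g' t, (P' p ^ 2 + Q' p ^ 2))
      ≤ (∫ p, P' p ^ 2) + ∫ p, Q' p ^ 2 := by
    rw [← integral_add hP'.integrable_sq hQ'.integrable_sq]
    exact setIntegral_le_integral (hP'.integrable_sq.add hQ'.integrable_sq)
      (ae_of_all _ fun p => add_nonneg (sq_nonneg _) (sq_nonneg _))
  have hsum := ((wP P' hP').add (wQ Q' hQ')).add (wg g' hg')
  have e : (∫ p, P' p * P' p) + (∫ p, Q' p * Q' p) + (∫ x, g' x * g' x) = F' := by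
    simp only [hF', sq]
  rw [e] at hsum
  -- Weak lower semicontinuity of the squared norm, from 2⟨aₙ, a⟩ ≤ |aₙ|² + |a|² with a the weak
  -- limit.
  have h2 : 2 * F' ≤ f + F' := by
    refine le_of_tendsto_of_tendsto' (hsum.const_mul 2) ((hF.comp hsm).add_const F') fun n => ?_
    have a1 := two_mul_integral_mul_le (hPm (s n)) hP'
    have a2 := two_mul_integral_mul_le (hQm (s n)) hQ'
    have a3 := two_mul_integral_mul_le (H (s n)).memLp hg'
    simp only [Function.comp, hEadd]
    linarith
  linarith

end limit

/-! ### Cutting a film into its excursions above a small height -/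

variable {V δ : ℝ} {h g : ℝ → ℝ} {u P Q : ℝ × ℝ → ℝ}

/-- The superlevel set `{h > δ}` is a countable disjoint union of bounded intervals. -/
theorem IsProfile.exists_excursions (H : IsProfile V h g) (hδ : 0 < δ) :
    ∃ (ι : Type) (_ : Countable ι) (a b : ι → ℝ), (∀ i, a i < b i) ∧
      (∀ i, h (a i) = δ ∧ h (b i) = δ ∧ ∀ x ∈ Ioo (a i) (b i), δ < h x) ∧
      Pairwise (Function.onFun Disjoint fun i => Ioo (a i) (b i)) ∧
      ⋃ i, Ioo (a i) (b i) = {x | δ < h x} := by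
  set U : Set ℝ := {x | δ < h x} with hU
  have hUo : IsOpen U := isOpen_lt continuous_const H.cont
  obtain ⟨R, -, -, hR⟩ := H.exists_radius hδ 0
  have hUb : U ⊆ Icc (-R) R := by
    intro x hx
    have : |x| < R := by
      by_contra hcon
      exact lt_asymm (hR x (not_lt.1 hcon)) hx
    exact ⟨(abs_lt.1 this).1.le, (abs_lt.1 this).2.le⟩
  let 𝒥 : Set (Set ℝ) := (connectedComponentIn U) '' U
  have hJ : ∀ J ∈ 𝒥, IsOpen J ∧ IsConnected J ∧ J ⊆ U ∧
      ∀ s : Set ℝ, IsPreconnected s → s ⊆ U → (s ∩ J).Nonempty → s ⊆ J := by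
    rintro _ ⟨x, hx, rfl⟩
    refine ⟨hUo.connectedComponentIn, isConnected_connectedComponentIn_iff.2 hx,
      connectedComponentIn_subset _ _, fun s hs hsU ⟨y, hys, hyJ⟩ => ?_⟩
    rw [connectedComponentIn_eq hyJ]
    exact hs.subset_connectedComponentIn hys hsU
  have hform : ∀ J ∈ 𝒥, ∃ a b, a < b ∧ J = Ioo a b ∧ h a = δ ∧ h b = δ := by
    intro J hJm
    obtain ⟨ho, hc, hsub, hmax⟩ := hJ J hJm
    have hbb : BddBelow J := bddBelow_Icc.mono (hsub.trans hUb)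
    have hba : BddAbove J := bddAbove_Icc.mono (hsub.trans hUb)
    have hnotinf : sInf J ∉ J := by
      intro hmem
      obtain ⟨ε, hε, hball⟩ := Metric.isOpen_iff.1 ho _ hmem
      have h1 : sInf J - ε / 2 ∈ J := hball (by
        rw [Metric.mem_ball, Real.dist_eq, abs_lt]; constructor <;> linarith)
      linarith [csInf_le hbb h1]
    have hnotsup : sSup J ∉ J := by
      intro hmem
      obtain ⟨ε, hε, hball⟩ := Metric.isOpen_iff.1 ho _ hmem
      have h1 : sSup J + ε / 2 ∈ J := hball (by
        rw [Metric.mem_ball, Real.dist_eq, abs_lt]; constructor <;> linarith)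
      linarith [le_csSup hba h1]
    have hJeq : J = Ioo (sInf J) (sSup J) := by
      refine Subset.antisymm (fun x hx => ⟨?_, ?_⟩) (hc.Ioo_csInf_csSup_subset hbb hba)
      · exact lt_of_le_of_ne (csInf_le hbb hx) fun he => hnotinf (he ▸ hx)
      · exact lt_of_le_of_ne (le_csSup hba hx) fun he => hnotsup (he ▸ hx)
    obtain ⟨x, hx⟩ := hc.nonempty
    have hx' := hx
    rw [hJeq] at hx'
    have hab : sInf J < sSup J := hx'.1.trans hx'.2
    have hcl : closure J ⊆ {x | δ ≤ h x} :=
      closure_minimal (fun y hy => le_of_lt (show δ < h y from hsub hy)) (isClosed_le continuous_const H.cont)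
    have hIoo : Ioo (sInf J) (sSup J) ⊆ U := hJeq ▸ hsub
    refine ⟨sInf J, sSup J, hab, hJeq, le_antisymm ?_ ?_, le_antisymm ?_ ?_⟩
    -- If h exceeded δ at an endpoint, adding that endpoint would give a connected subset of {h > δ}
    -- larger than the component.
    · by_contra hcon
      push Not at hcon
      refine hnotinf (hmax (Ico (sInf J) (sSup J)) isPreconnected_Ico ?_
        ⟨x, ⟨hx'.1.le, hx'.2⟩, hx⟩ ⟨le_rfl, hab⟩)
      intro y hy
      rcases hy.1.eq_or_lt with he | hlt
      · exact he ▸ hcon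
      · exact hIoo ⟨hlt, hy.2⟩
    · exact hcl (csInf_mem_closure hc.nonempty hbb)
    · by_contra hcon
      push Not at hcon
      refine hnotsup (hmax (Ioc (sInf J) (sSup J)) isPreconnected_Ioc ?_
        ⟨x, ⟨hx'.1, hx'.2.le⟩, hx⟩ ⟨hab, le_rfl⟩)
      intro y hy
      rcases hy.2.eq_or_lt with he | hlt
      · exact he ▸ hcon
      · exact hIoo ⟨hy.1, hlt⟩
    · exact hcl (csSup_mem_closure hc.nonempty hba)
  have hdisj : 𝒥.PairwiseDisjoint id := by
    intro J₁ h₁ J₂ h₂ hne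
    by_contra hcon
    rw [Function.onFun, not_disjoint_iff_nonempty_inter] at hcon
    simp only [id] at hcon
    obtain ⟨-, c1, s1, m1⟩ := hJ J₁ h₁
    obtain ⟨-, c2, s2, m2⟩ := hJ J₂ h₂
    exact hne (Subset.antisymm (m2 J₁ c1.isPreconnected s1 hcon)
      (m1 J₂ c2.isPreconnected s2 (by rwa [inter_comm] at hcon)))
  have hcount : 𝒥.Countable := hdisj.countable_of_isOpen (fun J hJm => (hJ J hJm).1)
    fun J hJm => (hJ J hJm).2.1.nonempty
  choose a b hab hJab ha hb using fun i : 𝒥 => hform i i.2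
  refine ⟨𝒥, hcount.to_subtype, a, b, hab, fun i => ⟨ha i, hb i, fun x hx => ?_⟩, ?_, ?_⟩
  · rw [← hJab i] at hx
    exact (hJ i i.2).2.2.1 hx
  · intro i j hij
    have := hdisj i.2 j.2 (fun he => hij (Subtype.ext he))
    simp only [Function.onFun, id] at this ⊢
    rwa [← hJab i, ← hJab j]
  · ext x
    simp only [mem_iUnion]
    constructor
    · rintro ⟨i, hx⟩
      rw [← hJab i] at hx
      exact (hJ i i.2).2.2.1 hx
    · intro hx
      refine ⟨⟨connectedComponentIn U x, mem_image_of_mem _ hx⟩, ?_⟩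
      rw [← hJab]
      exact mem_connectedComponentIn hx

/-- The part of the profile above height `δ` over the interval `(a, b)`. -/
def excursion (h : ℝ → ℝ) (δ a b x : ℝ) : ℝ := h (max a (min x b)) - δ

section excursion

variable {a b : ℝ}

theorem excursion_of_mem {x : ℝ} (hx : x ∈ Icc a b) : excursion h δ a b x = h x - δ := by
  rw [excursion, min_eq_left hx.2, max_eq_right hx.1]

theorem excursion_of_notMem (hab : a < b) (ha : h a = δ) (hb : h b = δ) {x : ℝ}
    (hx : x ∉ Ioo a b) : excursion h δ a b x = 0 := by
  rw [excursion]
  rcases le_or_gt x a with h1 | h1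
  · rw [min_eq_left (h1.trans hab.le), max_eq_left h1, ha, sub_self]
  · have h2 : b ≤ x := by
      by_contra h2
      exact hx ⟨h1, not_le.1 h2⟩
    rw [min_eq_right h2, max_eq_right hab.le, hb, sub_self]

theorem excursion_le (H : IsProfile V h g) (hδ : 0 < δ) (hab : a < b) (ha : h a = δ)
    (hb : h b = δ) (x : ℝ) : excursion h δ a b x ≤ h x := by
  by_cases hx : x ∈ Ioo a b
  · rw [excursion_of_mem (Ioo_subset_Icc_self hx)]; linarith
  · rw [excursion_of_notMem hab ha hb hx]; exact H.nonneg x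

theorem IsProfile.excursion (H : IsProfile V h g) (hδ : 0 < δ) (hab : a < b) (ha : h a = δ)
    (hb : h b = δ) (hpos : ∀ x ∈ Ioo a b, δ < h x) :
    IsProfile (∫ x, excursion h δ a b x) (excursion h δ a b) (indicator (Ioo a b) g) := by
  have hc : Continuous (EpitaxialFilm.excursion h δ a b) :=
    (H.cont.comp (continuous_const.max (continuous_id.min continuous_const))).sub continuous_const
  have h0 : ∀ x, 0 ≤ EpitaxialFilm.excursion h δ a b x := by
    intro x
    by_cases hx : x ∈ Ioo a b
    · rw [excursion_of_mem (Ioo_subset_Icc_self hx)]; linarith [hpos x hx]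
    · rw [excursion_of_notMem hab ha hb hx]
  have hgm : MemLp (indicator (Ioo a b) g) 2 volume := H.memLp.indicator measurableSet_Ioo
  have hloc : LocallyIntegrable (indicator (Ioo a b) g) := hgm.locallyIntegrable (by norm_num)
  have hii : ∀ x y, IntervalIntegrable (indicator (Ioo a b) g) volume x y := fun x y =>
    (hloc.integrableOn_isCompact isCompact_uIcc).intervalIntegrable
  have hprim : ∀ x, EpitaxialFilm.excursion h δ a b x
      = ∫ t in a..x, indicator (Ioo a b) g t := by
    intro x
    have hmid : ∀ y, a ≤ y → y ≤ b →
        ∫ t in a..y, indicator (Ioo a b) g t = h y - δ := by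
      intro y hay hyb
      rw [← ha, H.ftc, intervalIntegral.integral_of_le hay, intervalIntegral.integral_of_le hay,
        integral_Ioc_eq_integral_Ioo, integral_Ioc_eq_integral_Ioo]
      refine setIntegral_congr_fun measurableSet_Ioo fun t ht => ?_
      have hm : t ∈ Ioo a b := ⟨ht.1, ht.2.trans_le hyb⟩
      exact indicator_of_mem hm g
    rcases le_or_gt x a with h1 | h1
    · rw [excursion_of_notMem hab ha hb (fun h => not_lt.2 h1 h.1),
        intervalIntegral.integral_of_ge h1, setIntegral_eq_zero_of_forall_eq_zero, neg_zero]
      intro t ht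
      exact indicator_of_notMem (fun h : t ∈ Ioo a b => not_lt.2 ht.2 h.1) _
    · rcases le_or_gt x b with h2 | h2
      · rw [hmid x h1.le h2, excursion_of_mem ⟨h1.le, h2⟩]
      · rw [excursion_of_notMem hab ha hb (fun h => not_lt.2 h2.le h.2),
          ← intervalIntegral.integral_add_adjacent_intervals (hii a b) (hii b x),
          hmid b hab.le le_rfl, hb, sub_self, zero_add, intervalIntegral.integral_of_le h2.le,
          setIntegral_eq_zero_of_forall_eq_zero]
        intro t ht
        exact indicator_of_notMem (fun h : t ∈ Ioo a b => not_lt.2 ht.1.le h.2) _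
  refine ⟨hc, h0, ?_, rfl, hgm, fun x y => ?_⟩
  · refine H.integrable.mono' hc.aestronglyMeasurable (ae_of_all _ fun x => ?_)
    rw [Real.norm_of_nonneg (h0 x)]
    exact excursion_le H hδ hab ha hb x
  · rw [hprim, hprim]
    exact intervalIntegral.integral_interval_sub_left (hii _ _) (hii _ _)

theorem film_excursion (hab : a < b) (ha : h a = δ) (hb : h b = δ) :
    film (excursion h δ a b) = Prod.fst ⁻¹' Ioo a b ∩ film (fun x => max (h x - δ) 0) := by
  ext ⟨x, y⟩
  simp only [film, mem_ofPred_eq, mem_inter_iff, mem_preimage]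
  by_cases hx : x ∈ Ioo a b
  · rw [excursion_of_mem (Ioo_subset_Icc_self hx)]
    constructor
    · rintro ⟨h1, h2⟩; exact ⟨hx, h1, h2.trans_le (le_max_left _ _)⟩
    · rintro ⟨-, h1, h2⟩
      refine ⟨h1, ?_⟩
      rcases lt_max_iff.1 h2 with h3 | h3
      · exact h3
      · exact absurd h3 (not_lt.2 h1.le)
  · rw [excursion_of_notMem hab ha hb hx]
    constructor
    · rintro ⟨h1, h2⟩; exact absurd h2 (not_lt.2 h1.le)
    · rintro ⟨h1, -⟩; exact absurd h1 hx

end excursion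

/-- The energy and the volume above height `δ` split over the excursions; the loss of volume is
compensated by the loss of energy up to `δ` times the surface energy. -/
theorem exists_excursion_decomposition (H : IsProfile V h g) (D : IsDisplacement h u P Q)
    (hδ : 0 < δ) (hδ1 : δ ≤ 1) :
    ∃ (ι : Type) (a b : ι → ℝ) (W F : ι → ℝ) (W' F' : ℝ), (∀ i, a i < b i) ∧
      (∀ i, IsProfile (W i) (excursion h δ (a i) (b i)) (indicator (Ioo (a i) (b i)) g)) ∧
      (∀ i, IsDisplacement (excursion h δ (a i) (b i)) u P Q) ∧
      (∀ i x, x ∉ Ioo (a i) (b i) → excursion h δ (a i) (b i) x = 0) ∧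
      (∀ i, F i = (∫ p in film (excursion h δ (a i) (b i)), (P p ^ 2 + Q p ^ 2))
        + ∫ x, indicator (Ioo (a i) (b i)) g x ^ 2) ∧
      HasSum W W' ∧ HasSum F F' ∧ (∀ i, W i ≤ V) ∧ (∀ i, δ * (b i - a i) ≤ V - W') ∧
      (0 < V → W' < V) ∧
      F' + (V - W') ≤ (∫ p in film h, (P p ^ 2 + Q p ^ 2)) + (1 + δ) * ∫ x, g x ^ 2 := by
  obtain ⟨ι, hι, a, b, hab, hh, hdisj, hun⟩ := H.exists_excursions hδ
  have hfin := H.isFiniteMeasure_film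
  set k : ℝ → ℝ := fun x => max (h x - δ) 0 with hk
  have hkc : Continuous k := (H.cont.sub continuous_const).max continuous_const
  have hk0 : ∀ x, 0 ≤ k x := fun x => le_max_right _ _
  have hkh : ∀ x, k x ≤ h x := fun x => max_le (by linarith) (H.nonneg x)
  have hkm : MeasurableSet (film k) := (isOpen_film hkc).measurableSet
  have hki : Integrable k := H.integrable.mono' hkc.aestronglyMeasurable (ae_of_all _ fun x => by
    rw [Real.norm_of_nonneg (hk0 x)]; exact hkh x)
  have hsub : film k ⊆ film h := film_mono hkh
  have HJ : ∀ i, IsProfile (∫ x, excursion h δ (a i) (b i) x) (excursion h δ (a i) (b i))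
      (indicator (Ioo (a i) (b i)) g) := fun i =>
    H.excursion hδ (hab i) (hh i).1 (hh i).2.1 (hh i).2.2
  have DJ : ∀ i, IsDisplacement (excursion h δ (a i) (b i)) u P Q := fun i =>
    D.restrict (excursion_le H hδ (hab i) (hh i).1 (hh i).2.1)
  have hfilm : ∀ i, film (excursion h δ (a i) (b i)) = Prod.fst ⁻¹' Ioo (a i) (b i) ∩ film k :=
    fun i => film_excursion (hab i) (hh i).1 (hh i).2.1
  have hfun : ⋃ i, film (excursion h δ (a i) (b i)) = film k := by
    simp only [hfilm]
    rw [← iUnion_inter, ← preimage_iUnion, hun]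
    refine inter_eq_right.2 fun p hp => ?_
    have h1 : 0 < k p.1 := hp.1.trans hp.2
    rcases lt_max_iff.1 h1 with h3 | h3
    · exact sub_pos.1 h3
    · exact absurd h3 (lt_irrefl _)
  have hfdisj : Pairwise (Function.onFun Disjoint fun i => film (excursion h δ (a i) (b i))) := by
    intro i j hij
    simp only [Function.onFun, hfilm]
    exact ((hdisj hij).preimage Prod.fst).mono inter_subset_left inter_subset_left
  have hfm : ∀ i, MeasurableSet (film (excursion h δ (a i) (b i))) := fun i =>
    (HJ i).measurableSet_film
  have hsumfilm : ∀ f : ℝ × ℝ → ℝ, IntegrableOn f (film h) →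
      HasSum (fun i => ∫ p in film (excursion h δ (a i) (b i)), f p) (∫ p in film k, f p) := by
    intro f hf
    have := hasSum_integral_iUnion (f := f) (μ := volume) hfm hfdisj
      (hfun ▸ hf.mono_set hsub)
    rwa [hfun] at this
  have hg2 := (H.memLp_film H.memLp).integrable_sq
  have iP : IntegrableOn P (film h) := D.memLp_dx.integrable (by norm_num)
  have iQ : IntegrableOn (fun p : ℝ × ℝ => g p.1 * Q p) (film h) :=
    (H.memLp_film H.memLp).integrable_mul D.memLp_dy
  have iflux : IntegrableOn (fun p => P p + g p.1 * Q p) (film h) := iP.add iQ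
  have iE := D.integrable_energy
  have i1 : IntegrableOn (fun _ : ℝ × ℝ => (1 : ℝ)) (film h) := integrable_const 1
  have hUm : MeasurableSet {x | δ < h x} := (isOpen_lt continuous_const H.cont).measurableSet
  set S := ∫ x, g x ^ 2 with hS
  set S' := ∫ x in {x | δ < h x}, g x ^ 2 with hS'
  set E := ∫ p in film h, (P p ^ 2 + Q p ^ 2) with hE
  set E' := ∫ p in film k, (P p ^ 2 + Q p ^ 2) with hE'
  set W' := ∫ _ in film k, (1 : ℝ) with hW'
  have hW'k : W' = ∫ x, k x := by
    have := integral_film_fst hkc hk0 (k := fun _ => 1) aestronglyMeasurable_const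
    simpa only [mul_one] using this
  have hWsum : HasSum (fun i => ∫ x, excursion h δ (a i) (b i) x) W' := by
    have h1 := hsumfilm _ i1
    simp only [(HJ _).integral_film_one] at h1
    exact h1
  -- Each excursion is itself a film lying on the substrate, with the same displacement. The flux
  -- identity holds on each one and is summed.
  have hfluxsum : ∫ p in film k, (P p + g p.1 * Q p) = W' := by
    have h1 := hsumfilm _ iflux
    have h2 : ∀ i, ∫ p in film (excursion h δ (a i) (b i)), (P p + g p.1 * Q p)
        = ∫ x, excursion h δ (a i) (b i) x := by
      intro i
      rw [← integral_flux (HJ i) (DJ i)]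
      refine setIntegral_congr_fun (hfm i) fun p hp => ?_
      have hp' := hp
      rw [hfilm] at hp'
      simp only [indicator_of_mem (show p.1 ∈ Ioo (a i) (b i) from hp'.1)]
    simp only [h2] at h1
    exact h1.unique hWsum
  have hSsum : HasSum (fun i => ∫ x, indicator (Ioo (a i) (b i)) g x ^ 2) S' := by
    have h1 := hasSum_integral_iUnion (f := fun x => g x ^ 2) (μ := volume)
      (fun i => measurableSet_Ioo (a := a i) (b := b i)) hdisj H.integrable_sq.integrableOn
    rw [hun] at h1
    have e : ∀ i, ∫ x, indicator (Ioo (a i) (b i)) g x ^ 2 = ∫ x in Ioo (a i) (b i), g x ^ 2 := by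
      intro i
      rw [← integral_indicator measurableSet_Ioo]
      congr 1; funext x
      by_cases hx : x ∈ Ioo (a i) (b i) <;> simp [hx]
    simpa only [e] using h1
  have hdiff : ∀ f : ℝ × ℝ → ℝ, IntegrableOn f (film h) →
      ∫ p in film h \ film k, f p = (∫ p in film h, f p) - ∫ p in film k, f p := fun f hf =>
    setIntegral_sdiff hkm hf hsub
  have hgk : ∫ p in film k, g p.1 ^ 2 = ∫ x, k x * g x ^ 2 :=
    integral_film_fst hkc hk0 H.integrable_sq.aestronglyMeasurable
  have hgh : ∫ p in film h, g p.1 ^ 2 = ∫ x, h x * g x ^ 2 :=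
    integral_film_fst H.cont H.nonneg H.integrable_sq.aestronglyMeasurable
  have ihg : Integrable fun x => h x * g x ^ 2 := by
    obtain ⟨M, hM, hb⟩ := H.exists_bound
    exact H.integrable_sq.bdd_mul (c := M) H.cont.aestronglyMeasurable
      (ae_of_all _ fun x => by rw [Real.norm_of_nonneg (H.nonneg x)]; exact hb x)
  have ikg : Integrable fun x => k x * g x ^ 2 := by
    obtain ⟨M, hM, hb⟩ := H.exists_bound
    exact H.integrable_sq.bdd_mul (c := M) hkc.aestronglyMeasurable
      (ae_of_all _ fun x => by rw [Real.norm_of_nonneg (hk0 x)]; exact (hkh x).trans (hb x))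
  -- The weight h - k equals δ on {h > δ}, and it is at most one on the complement, where the
  -- surface energy is lost entirely.
  have hlayer : (∫ x, h x * g x ^ 2) - ∫ x, k x * g x ^ 2 ≤ (S - S') + δ * S := by
    have hc : S - S' = ∫ x in {x | δ < h x}ᶜ, g x ^ 2 := by
      have := integral_add_compl hUm H.integrable_sq
      rw [hS, ← this]; ring
    rw [hc, ← integral_sub ihg ikg, ← integral_indicator hUm.compl, hS, ← integral_const_mul,
      ← integral_add (H.integrable_sq.indicator hUm.compl) (H.integrable_sq.const_mul δ)]
    refine integral_mono (ihg.sub ikg) ((H.integrable_sq.indicator hUm.compl).add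
      (H.integrable_sq.const_mul δ)) fun x => ?_
    simp only [← sub_mul]
    by_cases hx : δ < h x
    · have h1 : k x = h x - δ := max_eq_left (by linarith)
      rw [indicator_of_notMem (by simpa using hx), h1]
      linarith
    · have h1 : k x = 0 := max_eq_right (by linarith)
      have h2 : h x ≤ 1 := (not_lt.1 hx).trans hδ1
      rw [indicator_of_mem (by simpa using hx), h1]
      nlinarith [sq_nonneg (g x), mul_nonneg hδ.le (sq_nonneg (g x))]
  -- The square completion of `volume_le_energy`, now on `film h \ film k`. Both the flux through
  -- this set and its area equal V - W'.
  have hmain : V - W' ≤ (E - E') + ((∫ x, h x * g x ^ 2) - ∫ x, k x * g x ^ 2) := by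
    have d1 := hdiff _ iflux
    have d2 := hdiff _ iE
    have d3 := hdiff _ i1
    have d4 := hdiff _ hg2
    rw [integral_flux H D, hfluxsum] at d1
    rw [H.integral_film_one] at d3
    rw [hgk, hgh] at d4
    have hs : film h \ film k ⊆ film h := sdiff_subset
    have j1 : IntegrableOn (fun p => (P p ^ 2 + Q p ^ 2) + g p.1 ^ 2) (film h \ film k) :=
      (iE.add hg2).mono_set hs
    have j2 : IntegrableOn (fun p => (P p ^ 2 + Q p ^ 2) + g p.1 ^ 2 + 1) (film h \ film k) :=
      ((iE.add hg2).add i1).mono_set hs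
    have key : ∫ p in film h \ film k, 2 * (P p + g p.1 * Q p)
        ≤ ∫ p in film h \ film k, ((P p ^ 2 + Q p ^ 2) + g p.1 ^ 2 + 1) :=
      integral_mono ((iflux.mono_set hs).const_mul 2) j2 fun p => by
        nlinarith [sq_nonneg (P p - 1), sq_nonneg (g p.1 - Q p)]
    rw [integral_const_mul, d1, integral_add j1 (i1.mono_set hs),
      integral_add (iE.mono_set hs) (IntegrableOn.mono_set (t := film h) hg2 hs), d2, d3, d4, ← hE,
      ← hE', ← hW'] at key
    linarith
  have hVW : V - W' = ∫ x, (h x - k x) := by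
    rw [integral_sub H.integrable hki, H.volume_eq, hW'k]
  refine ⟨ι, a, b, fun i => ∫ x, excursion h δ (a i) (b i) x, _, W', E' + S', hab, HJ, DJ,
    fun i x hx => excursion_of_notMem (hab i) (hh i).1 (hh i).2.1 hx, fun i => rfl, hWsum,
    (hsumfilm _ iE).add hSsum, fun i => ?_, fun i => ?_, fun hV => ?_, ?_⟩
  · rw [← H.volume_eq]
    exact integral_mono (HJ i).integrable H.integrable
      (excursion_le H hδ (hab i) (hh i).1 (hh i).2.1)
  · rw [hVW]
    have h1 : ∫ _ in Ioo (a i) (b i), δ = δ * (b i - a i) := by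
      simp [(hab i).le, mul_comm]
    rw [← h1]
    -- Over the base of an excursion the removed thickness is exactly δ, so the removed volume
    -- controls the length of the base.
    calc ∫ _ in Ioo (a i) (b i), δ ≤ ∫ x in Ioo (a i) (b i), (h x - k x) := by
          refine setIntegral_mono_on (by simp) (H.integrable.sub hki).integrableOn
            measurableSet_Ioo fun x hx => ?_
          have : k x = h x - δ := max_eq_left (by linarith [(hh i).2.2 x hx])
          rw [this]; linarith
      _ ≤ _ := setIntegral_le_integral (H.integrable.sub hki)
          (ae_of_all _ fun x => sub_nonneg.2 (hkh x))
  · obtain ⟨M, hM, hb⟩ := H.exists_bound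
    -- A quantitative form of "something is removed": h - k is δ where h > δ and h elsewhere, and h
    -- ≤ M.
    have h1 : ∫ x, δ * h x ≤ ∫ x, (M + δ) * (h x - k x) := by
      refine integral_mono (H.integrable.const_mul δ)
        ((H.integrable.sub hki).const_mul (M + δ)) fun x => ?_
      simp only
      by_cases hx : δ < h x
      · have h1 : k x = h x - δ := max_eq_left (by linarith)
        rw [h1]
        nlinarith [hb x]
      · have h1 : k x = 0 := max_eq_right (by linarith)
        rw [h1]
        nlinarith [H.nonneg x]
    rw [integral_const_mul, integral_const_mul, H.volume_eq, ← hVW] at h1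
    have h2 : 0 < δ * V := mul_pos hδ hV
    have h3 : 0 < V - W' := pos_of_mul_pos_right (h2.trans_le h1) (by positivity)
    linarith
  · linarith

/-! ### Comparison films and the dependence of the minimal energy on the volume. -/

variable {V : ℝ} {h g : ℝ → ℝ} {u P Q : ℝ × ℝ → ℝ}

theorem Fs_le (H : IsProfile V h g) (D : IsDisplacement h u P Q) :
    Fs V ≤ (∫ p in film h, (P p ^ 2 + Q p ^ 2)) + ∫ x, g x ^ 2 := by
  rw [← energy_eq H D]
  refine csInf_le ⟨0, ?_⟩ ⟨(u, h), mem_admissible H D, rfl⟩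
  rintro _ ⟨q, -, rfl⟩
  exact add_nonneg (elastic_nonneg _ _ _) (surface_nonneg _)

theorem isProfile_of_contDiff {ρ : ℝ → ℝ} (hρ : ContDiff ℝ 1 ρ) (hc : HasCompactSupport ρ)
    (h0 : ∀ x, 0 ≤ ρ x) : IsProfile (∫ x, ρ x) ρ (deriv ρ) := by
  have hd : Continuous (deriv ρ) := hρ.continuous_deriv le_rfl
  refine ⟨hρ.continuous, h0, hρ.continuous.integrable_of_hasCompactSupport hc, rfl,
    hd.memLp_of_hasCompactSupport hc.deriv, fun a b => ?_⟩
  exact (intervalIntegral.integral_deriv_eq_sub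
    (fun x _ => (hρ.differentiable (by norm_num)).differentiableAt)
    (hd.intervalIntegrable _ _)).symm

theorem film_memLp_of_continuous (H : IsProfile V h g) (hc : HasCompactSupport h)
    {k : ℝ × ℝ → ℝ} (hk : Continuous k) : MemLp k 2 (volume.restrict (film h)) := by
  have := H.isFiniteMeasure_film
  obtain ⟨M, -, hM⟩ := H.exists_bound
  have hK : IsCompact (tsupport h ×ˢ Icc 0 M) := IsCompact.prod hc isCompact_Icc
  obtain ⟨C, hC⟩ := hK.exists_bound_of_continuousOn hk.continuousOn
  refine MemLp.of_bound hk.aestronglyMeasurable C ?_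
  refine ae_restrict_of_forall_mem H.measurableSet_film fun p hp => hC p ⟨?_, hp.1.le, ?_⟩
  · exact subset_tsupport _ (hp.1.trans hp.2).ne'
  · exact hp.2.le.trans (hM _)

/-- The horizontal stretch relaxes linearly with height, a first-order gain in ε against
second-order costs. The case ε = 0 is the unrelaxed displacement u = x. -/
theorem isDisplacement_shear (H : IsProfile V h g) (hc : HasCompactSupport h) (ε : ℝ) :
    IsDisplacement h (fun p => p.1 * (1 - ε * p.2)) (fun p => 1 - ε * p.2)
      (fun p => -ε * p.1) := by
  have hk : ContDiff ℝ 1 fun p : ℝ × ℝ => -ε * p.1 * p.2 := by fun_prop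
  have hd : ∀ p v : ℝ × ℝ, fderiv ℝ (fun p : ℝ × ℝ => -ε * p.1 * p.2) p v
      = -ε * p.1 * v.2 + -ε * v.1 * p.2 := by
    intro p v
    have h1 : HasFDerivAt (fun p : ℝ × ℝ => -ε * p.1 * p.2) _ p :=
      ((hasFDerivAt_fst (𝕜 := ℝ) (p := p)).const_mul (-ε)).mul (hasFDerivAt_snd (𝕜 := ℝ) (p := p))
    rw [h1.fderiv]
    simp
    ring
  refine ⟨film_memLp_of_continuous H hc (by fun_prop), film_memLp_of_continuous H hc (by fun_prop),
    film_memLp_of_continuous H hc (by fun_prop), fun φ hφ => ?_, fun φ hφ => ?_⟩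
  · refine Eq.trans ?_ (integral_film_mul_fderiv_fst hk hφ)
    congr 1; funext p
    rw [hd]; ring
  · refine Eq.trans ?_ ((integral_film_mul_fderiv_snd hk hφ).trans (by simp))
    congr 1; funext p
    rw [hd]; ring

/-- A smooth compactly supported profile of volume one. -/
theorem exists_unit_bump : ∃ ρ : ℝ → ℝ, ContDiff ℝ 1 ρ ∧ HasCompactSupport ρ ∧
    (∀ x, 0 ≤ ρ x) ∧ ∫ x, ρ x = 1 := by
  let f : ContDiffBump (0 : ℝ) := ⟨1, 2, one_pos, one_lt_two⟩
  exact ⟨f.normed volume, f.contDiff_normed, f.hasCompactSupport_normed, f.nonneg_normed,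
    f.integral_normed⟩

/-- A bump of height scale η and width scale w = V/η with u = x has elastic energy exactly V, and
its surface energy is of order η²/w = η³/V. -/
theorem exists_flat_film (hV : 0 < V) : ∃ S₀ : ℝ, ∀ η : ℝ, 0 < η →
    ∃ (h g : ℝ → ℝ) (u P Q : ℝ × ℝ → ℝ), IsProfile V h g ∧ IsDisplacement h u P Q ∧
      (∫ p in film h, (P p ^ 2 + Q p ^ 2)) + ∫ x, g x ^ 2 = V + η ^ 3 * S₀ := by
  obtain ⟨ρ, hρ, hρc, hρ0, hρ1⟩ := exists_unit_bump
  refine ⟨(∫ x, deriv ρ x ^ 2) / V, fun η hη => ?_⟩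
  set w := V / η with hw
  have hw0 : 0 < w := div_pos hV hη
  have hd1 : ContDiff ℝ 1 fun x => η * ρ (x / w) :=
    contDiff_const.mul (hρ.comp (contDiff_id.div_const w))
  have hc1 : HasCompactSupport fun x => η * ρ (x / w) := by
    have h1 : HasCompactSupport fun x => ρ (w⁻¹ • x) := hρc.comp_smul (inv_ne_zero hw0.ne')
    have h2 : (fun x => ρ (x / w)) = fun x => ρ (w⁻¹ • x) := by
      funext x; rw [smul_eq_mul, div_eq_inv_mul]
    exact HasCompactSupport.mul_left (h2 ▸ h1)
  have hderiv : deriv (fun x => η * ρ (x / w)) = fun x => η / w * deriv ρ (x / w) := by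
    funext x
    have h1 : HasDerivAt ρ (deriv ρ (x / w)) (x / w) :=
      (hρ.differentiable (by norm_num)).differentiableAt.hasDerivAt
    have h2 := ((h1.comp x ((hasDerivAt_id x).div_const w)).const_mul η).deriv
    refine Eq.trans h2 ?_
    ring
  have H := isProfile_of_contDiff hd1 hc1 fun x => mul_nonneg hη.le (hρ0 _)
  have hvol : ∫ x, η * ρ (x / w) = V := by
    rw [integral_const_mul, Measure.integral_comp_div, hρ1, abs_of_pos hw0, smul_eq_mul, hw]
    field_simp
  rw [hvol, hderiv] at H
  refine ⟨_, _, _, _, _, H, isDisplacement_shear H hc1 0, ?_⟩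
  have e1 : ∫ p in film fun x => η * ρ (x / w), ((1 - 0 * p.2) ^ 2 + (-0 * p.1) ^ 2) = V := by
    simpa using H.integral_film_one
  have e2 : ∫ x, (η / w * deriv ρ (x / w)) ^ 2 = (η / w) ^ 2 * (w * ∫ x, deriv ρ x ^ 2) := by
    simp only [mul_pow]
    rw [integral_const_mul, Measure.integral_comp_div (fun x => deriv ρ x ^ 2), abs_of_pos hw0,
      smul_eq_mul]
  rw [e1, e2, hw]
  field_simp

theorem Fs_le_self (hV : 0 < V) : Fs V ≤ V := by
  obtain ⟨S₀, hS⟩ := exists_flat_film hV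
  have h1 : Tendsto (fun η : ℝ => V + η ^ 3 * S₀) (𝓝[>] 0) (𝓝 (V + 0 ^ 3 * S₀)) :=
    (Continuous.tendsto (by fun_prop) 0).mono_left nhdsWithin_le_nhds
  have h2 : Fs V ≤ V + 0 ^ 3 * S₀ := by
    refine ge_of_tendsto h1 (eventually_mem_nhdsWithin.mono fun η hη => ?_)
    obtain ⟨h, g, u, P, Q, H, D, he⟩ := hS η hη
    exact he ▸ Fs_le H D
  simpa using h2

theorem exists_near_minimizer (hV : 0 < V) {ε : ℝ} (hε : 0 < ε) :
    ∃ (h g : ℝ → ℝ) (u P Q : ℝ × ℝ → ℝ), IsProfile V h g ∧ IsDisplacement h u P Q ∧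
      (∫ p in film h, (P p ^ 2 + Q p ^ 2)) + ∫ x, g x ^ 2 < Fs V + ε := by
  have hne : (energy '' admissible V).Nonempty := by
    obtain ⟨S₀, hS⟩ := exists_flat_film hV
    obtain ⟨h, g, u, P, Q, H, D, -⟩ := hS 1 one_pos
    exact ⟨_, (u, h), mem_admissible H D, rfl⟩
  obtain ⟨_, ⟨q, hq, rfl⟩, hlt⟩ := Real.lt_sInf_add_pos hne hε
  exact ⟨_, _, _, _, _, isProfile_of_admissible hq, isDisplacement_of_admissible hq, hlt⟩

theorem self_le_Fs (hV : 0 < V) (hV1 : 8 * V ^ 2 ≤ 1) : V ≤ Fs V := by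
  refine le_of_forall_pos_lt_add fun ε hε => ?_
  obtain ⟨h, g, u, P, Q, H, D, hlt⟩ := exists_near_minimizer hV hε
  exact (volume_le_energy_of_small hV hV1 H D).trans_lt hlt

/-- Elastic energy scales like area and surface energy like length; this imbalance drives the
comparison between volumes. -/
theorem Fs_scale_le (H : IsProfile V h g) (D : IsDisplacement h u P Q) {l : ℝ} (hl : 0 < l) :
    Fs (l ^ 2 * V) ≤ l ^ 2 * (∫ p in film h, (P p ^ 2 + Q p ^ 2)) + l * ∫ x, g x ^ 2 := by
  refine (Fs_le (H.scale hl 0) (D.scale H hl 0)).trans_eq ?_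
  rw [integral_scale_sq hl, integral_film_scale hl H.cont fun p => P p ^ 2 + Q p ^ 2]

/-- The energy per volume of the optimal film does not increase with the volume. -/
theorem mul_Fs_le {W : ℝ} (hW : 0 < W) (hWV : W ≤ V) (H : IsProfile W h g)
    (D : IsDisplacement h u P Q) :
    Fs V * W ≤ V * ((∫ p in film h, (P p ^ 2 + Q p ^ 2)) + ∫ x, g x ^ 2) := by
  have h1 : 1 ≤ V / W := (one_le_div hW).2 hWV
  have h0 : 0 ≤ V / W := zero_le_one.trans h1
  have hl1 : 1 ≤ √(V / W) := Real.one_le_sqrt.2 h1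
  have hsq : √(V / W) ^ 2 = V / W := Real.sq_sqrt h0
  have hle : √(V / W) ≤ V / W := by nlinarith
  have h2 := Fs_scale_le H D (zero_lt_one.trans_le hl1)
  rw [hsq, div_mul_cancel₀ _ hW.ne'] at h2
  have h3 := mul_le_mul_of_nonneg_right hle (surface_nonneg g)
  have h4 : Fs V ≤ V / W * ((∫ p in film h, (P p ^ 2 + Q p ^ 2)) + ∫ x, g x ^ 2) := by linarith
  calc Fs V * W ≤ V / W * ((∫ p in film h, (P p ^ 2 + Q p ^ 2)) + ∫ x, g x ^ 2) * W :=
        mul_le_mul_of_nonneg_right h4 hW.le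
    _ = _ := by field_simp

theorem Fs_lt_self_of_le {W : ℝ} (hV : 0 < V) (hlt : Fs V < V) (hVW : V ≤ W) : Fs W < W := by
  obtain ⟨h, g, u, P, Q, H, D, he⟩ := exists_near_minimizer hV (sub_pos.2 hlt)
  have h1 := mul_Fs_le hV hVW H D
  have hW : 0 < W := hV.trans_le hVW
  have h2 : Fs W * V < W * V := h1.trans_lt (mul_lt_mul_of_pos_left (by linarith) hW)
  exact lt_of_mul_lt_mul_right h2 hV.le

/-- For a fixed film the strict inequality is an open condition on the ratio of the homothety, so it
persists for a ratio slightly below one. Consequently the critical volume itself shows no gain. -/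
theorem exists_lt_Fs_lt_self (hV : 0 < V) (hlt : Fs V < V) :
    ∃ W, 0 < W ∧ W < V ∧ Fs W < W := by
  obtain ⟨h, g, u, P, Q, H, D, he⟩ := exists_near_minimizer hV (sub_pos.2 hlt)
  set E := ∫ p in film h, (P p ^ 2 + Q p ^ 2)
  set S := ∫ x, g x ^ 2
  have hcont : Continuous fun l : ℝ => l ^ 2 * E + l * S - l ^ 2 * V := by fun_prop
  have h1 : ∀ᶠ l : ℝ in 𝓝 1, l ^ 2 * E + l * S - l ^ 2 * V < 0 :=
    hcont.continuousAt.eventually_lt continuousAt_const (by simp; linarith)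
  have h2 : ∀ᶠ l : ℝ in 𝓝 1, 0 < l := lt_mem_nhds one_pos
  obtain ⟨l, ⟨hl, hl0⟩, hl1⟩ := (((h1.and h2).filter_mono nhdsWithin_le_nhds).and
    (self_mem_nhdsWithin : Iio (1 : ℝ) ∈ 𝓝[<] 1)).exists
  have hl1' : l < 1 := hl1
  refine ⟨l ^ 2 * V, by positivity, ?_, (Fs_scale_le H D hl0).trans_lt (by linarith)⟩
  have : l ^ 2 < 1 := by nlinarith
  nlinarith

/-- A small shear of a unit bump lowers the elastic energy below the volume. Under enlargement this
gain grows like l² and beats the surface energy, which grows like l. -/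
theorem exists_Fs_lt_self : ∃ V, 0 < V ∧ Fs V < V := by
  obtain ⟨ρ, hρ, hρc, hρ0, hρ1⟩ := exists_unit_bump
  have H := isProfile_of_contDiff hρ hρc hρ0
  rw [hρ1] at H
  have := H.isFiniteMeasure_film
  have iy : IntegrableOn (fun p : ℝ × ℝ => p.2) (film ρ) :=
    (film_memLp_of_continuous H hρc continuous_snd).integrable (by norm_num)
  have ixy : IntegrableOn (fun p : ℝ × ℝ => p.1 ^ 2 + p.2 ^ 2) (film ρ) :=
    (film_memLp_of_continuous H hρc (by fun_prop)).integrable (by norm_num)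
  have i1 : IntegrableOn (fun _ : ℝ × ℝ => (1 : ℝ)) (film ρ) := integrable_const 1
  set A := ∫ p in film ρ, p.2 with hA
  set B := ∫ p in film ρ, (p.1 ^ 2 + p.2 ^ 2) with hB
  have hApos : 0 < A := by
    rw [hA, setIntegral_pos_iff_support_of_nonneg_ae
      (ae_restrict_of_forall_mem H.measurableSet_film fun p hp => hp.1.le) iy]
    have hsub : film ρ ⊆ Function.support (fun p : ℝ × ℝ => p.2) ∩ film ρ :=
      fun p hp => ⟨hp.1.ne', hp⟩
    refine lt_of_lt_of_le ?_ (measure_mono hsub)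
    by_contra hz
    have h0 : volume (film ρ) = 0 := by simpa using hz
    have h1 := H.integral_film_one
    rw [Measure.restrict_eq_zero.2 h0] at h1
    simp at h1
  have hE : ∀ ε : ℝ, ∫ p in film ρ, ((1 - ε * p.2) ^ 2 + (-ε * p.1) ^ 2)
      = 1 - 2 * ε * A + ε ^ 2 * B := by
    intro ε
    have j1 : IntegrableOn (fun p : ℝ × ℝ => 1 - 2 * ε * p.2) (film ρ) := i1.sub (iy.const_mul _)
    have j2 : IntegrableOn (fun p : ℝ × ℝ => ε ^ 2 * (p.1 ^ 2 + p.2 ^ 2)) (film ρ) :=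
      ixy.const_mul _
    have j3 : IntegrableOn (fun p : ℝ × ℝ => 2 * ε * p.2) (film ρ) := iy.const_mul _
    refine Eq.trans ?_ ((integral_add j1 j2).trans ?_)
    · congr 1; funext p
      ring
    · rw [integral_sub i1 j3, H.integral_film_one, integral_const_mul, integral_const_mul]
  have hB0 : 0 ≤ B := integral_nonneg fun p => by positivity
  -- Since ε(B + 1) = A, the gain 2εA - ε²B equals εA + ε² > 0; the added one avoids division by
  -- zero.
  set ε := A / (B + 1) with hε
  have hε0 : 0 < ε := by positivity
  have hgain : 0 < 2 * ε * A - ε ^ 2 * B := by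
    have h1 : ε * (B + 1) = A := by rw [hε]; field_simp
    have h2 : 2 * ε * A - ε ^ 2 * B = ε * A + ε ^ 2 := by rw [← h1]; ring
    rw [h2]; positivity
  set S := ∫ x, deriv ρ x ^ 2
  have hS0 : 0 ≤ S := surface_nonneg _
  -- With l times the gain equal to S + 1, the scaled energy is at most l² - l(S + 1) + lS = l² - l.
  set l := (S + 1) / (2 * ε * A - ε ^ 2 * B) with hl
  have hl0 : 0 < l := by positivity
  have h1 := Fs_scale_le H (isDisplacement_shear H hρc ε) hl0
  rw [hE] at h1
  refine ⟨l ^ 2 * 1, by positivity, h1.trans_lt ?_⟩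
  have h2 : l * (2 * ε * A - ε ^ 2 * B) = S + 1 :=
    div_mul_cancel₀ _ hgain.ne'
  nlinarith

/-! ### Minimizers above the critical volume. -/

variable {V : ℝ}

/-- A film of energy below its volume can be enlarged to any larger volume, on a bounded base. -/
theorem exists_enlarged {W F a b : ℝ} {h g : ℝ → ℝ} {u P Q : ℝ × ℝ → ℝ} (H : IsProfile W h g)
    (D : IsDisplacement h u P Q) (hz : ∀ x, x ∉ Ioo a b → h x = 0) (hab : a < b) (hW : 0 < W)
    (hWV : W ≤ V) (hF : F = (∫ p in film h, (P p ^ 2 + Q p ^ 2)) + ∫ x, g x ^ 2) (hFW : F < W) :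
    ∃ (h' g' : ℝ → ℝ) (u' P' Q' : ℝ × ℝ → ℝ), IsProfile V h' g' ∧ IsDisplacement h' u' P' Q' ∧
      (∀ x, x ∉ Ioo 0 (3 * V * (b - a)) → h' x = 0) ∧
      ((∫ p in film h', (P' p ^ 2 + Q' p ^ 2)) + ∫ x, g' x ^ 2) * W ≤ V * F := by
  have hV : 0 < V := hW.trans_le hWV
  have hS0 := surface_nonneg g
  have hE0 := elastic_nonneg h P Q
  -- A film with energy below its volume cannot be tiny: its surface energy is at most V, so 8VW < 1
  -- would force h ≤ 1 and exclude a gain.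
  have hbig : 1 ≤ 8 * V * W := by
    by_contra hlt
    push Not at hlt
    have h1 := volume_le_energy H D fun x => by
      have h3 := H.cube_le hV (by linarith) x
      exact le_of_pow_le_pow_left₀ (n := 3) (by norm_num) zero_le_one (by linarith)
    linarith
  have h1 : 1 ≤ V / W := (one_le_div hW).2 hWV
  have h0 : 0 ≤ V / W := zero_le_one.trans h1
  have hl1 : 1 ≤ √(V / W) := Real.one_le_sqrt.2 h1
  have hsq : √(V / W) ^ 2 = V / W := Real.sq_sqrt h0
  set l := √(V / W)
  have hl0 : 0 < l := zero_lt_one.trans_le hl1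
  have hlW : l ^ 2 * W = V := by rw [hsq, div_mul_cancel₀ _ hW.ne']
  -- l² = V/W ≤ 8V² ≤ 9V², which bounds the stretching of the base independently of the film.
  have hl3 : l ≤ 3 * V := by
    have h2 : l ^ 2 ≤ 8 * V ^ 2 := by
      calc l ^ 2 ≤ l ^ 2 * (8 * V * W) := le_mul_of_one_le_right (sq_nonneg l) hbig
        _ = 8 * V * (l ^ 2 * W) := by ring
        _ = 8 * V ^ 2 := by rw [hlW]; ring
    exact le_of_pow_le_pow_left₀ two_ne_zero (by positivity) (by nlinarith)
  have H' := H.scale hl0 (-(l * a))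
  rw [hlW] at H'
  refine ⟨_, _, _, _, _, H', D.scale H hl0 (-(l * a)), fun x hx => ?_, ?_⟩
  · rw [scaleProfile, hz, mul_zero]
    rintro ⟨ha, hb⟩
    rw [lt_div_iff₀ hl0] at ha
    rw [div_lt_iff₀ hl0] at hb
    refine hx ⟨by linarith, ?_⟩
    have := mul_le_mul_of_nonneg_right hl3 (sub_pos.2 hab).le
    linarith
  · rw [integral_scale_sq hl0, integral_film_scale hl0 H.cont fun p => P p ^ 2 + Q p ^ 2]
    have hle : l ≤ l ^ 2 := by nlinarith
    have h3 := mul_le_mul_of_nonneg_right hle hS0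
    calc _ ≤ l ^ 2 * F * W := mul_le_mul_of_nonneg_right (by rw [hF]; linarith) hW.le
      _ = l ^ 2 * W * F := by ring
      _ = V * F := by rw [hlW]

/-- The bound on the base does not depend on ε. The cutting height δ enters both the removed volume
and the slab below an excursion linearly, and it cancels. -/
theorem exists_near_minimizer_bounded_base (hV : 0 < V) (hlt : Fs V < V) :
    ∃ L, ∀ ε, 0 < ε → ∃ (h g : ℝ → ℝ) (u P Q : ℝ × ℝ → ℝ), IsProfile V h g ∧
      IsDisplacement h u P Q ∧ (∀ x, x ∉ Ioo 0 L → h x = 0) ∧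
      (∫ p in film h, (P p ^ 2 + Q p ^ 2)) + ∫ x, g x ^ 2 ≤ Fs V + ε := by
  have hm : 0 < V - Fs V := sub_pos.2 hlt
  refine ⟨3 * V * (V * (V + 2) / (V - Fs V)), fun ε hε => ?_⟩
  -- The total error δ(V + 2) combines δ from near minimality with δ times a surface energy of at
  -- most V + 1. Keeping it below half the gap makes `G` smaller than V.
  set κ := min ε ((V - Fs V) / 2)
  have hκ : 0 < κ := lt_min hε (half_pos hm)
  have hκε : κ ≤ ε := min_le_left _ _
  have hκm : κ ≤ (V - Fs V) / 2 := min_le_right _ _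
  set δ := min 1 (κ / (V + 2))
  have hδ : 0 < δ := lt_min one_pos (by positivity)
  have hδ1 : δ ≤ 1 := min_le_left _ _
  have hδκ : δ * (V + 2) ≤ κ := (le_div_iff₀ (by positivity)).1 (min_le_right _ _)
  obtain ⟨h, g, u, P, Q, H, D, he⟩ := exists_near_minimizer hV hδ
  obtain ⟨ι, a, b, W, F, W', F', hab, HJ, DJ, hz, hFi, hWs, hFs, hWV, hba, hW'V, hmain⟩ :=
    exists_excursion_decomposition H D hδ hδ1
  have hE0 := elastic_nonneg h P Q
  have hS0 := surface_nonneg g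
  have hgap : 0 < V - W' := sub_pos.2 (hW'V hV)
  set G := (∫ p in film h, (P p ^ 2 + Q p ^ 2)) + (1 + δ) * ∫ x, g x ^ 2
  have hG : G ≤ Fs V + δ * (V + 2) := by
    have h1 : δ * ∫ x, g x ^ 2 ≤ δ * (V + 1) :=
      mul_le_mul_of_nonneg_left (by linarith) hδ.le
    simp only [G]
    linarith
  have hGV : G < V := by linarith
  have hF0 : ∀ i, 0 ≤ F i := fun i =>
    (hFi i).symm ▸ add_nonneg (elastic_nonneg _ _ _) (surface_nonneg _)
  have hrate : ∀ i, Fs V * W i ≤ V * F i := by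
    intro i
    rcases (HJ i).volume_nonneg.eq_or_lt with h0 | h0
    · rw [← h0, mul_zero]
      exact mul_nonneg hV.le (hF0 i)
    · rw [hFi i]
      exact mul_Fs_le h0 (hWV i) (HJ i) (DJ i)
  have hsum : Fs V * W' ≤ V * F' := hasSum_le hrate (hWs.mul_left _) (hFs.mul_left _)
  -- The excursions pay at least `Fs V` / V per unit volume and the removed volume pays about one
  -- per unit. The gap between these rates limits how much volume can be removed.
  have hloss : (V - W') * (V - Fs V) ≤ V * (δ * (V + 2)) := by
    have h1 := mul_le_mul_of_nonneg_left (hmain.trans hG) hV.le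
    nlinarith
  -- If every excursion had ratio at least `G` / V, summation would give (V - W')(V - G) ≤ 0,
  -- although both factors are positive.
  obtain ⟨i, hi⟩ : ∃ i, V * F i < G * W i := by
    by_contra hcon
    push Not at hcon
    have h1 : G * W' ≤ V * F' := hasSum_le hcon (hWs.mul_left _) (hFs.mul_left _)
    have h2 := mul_le_mul_of_nonneg_left hmain hV.le
    have h3 := mul_pos hgap (sub_pos.2 hGV)
    nlinarith
  have hWi : 0 < W i := by
    refine (HJ i).volume_nonneg.lt_of_ne fun h0 => ?_
    rw [← h0, mul_zero] at hi
    exact absurd hi (not_lt.2 (mul_nonneg hV.le (hF0 i)))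
  have hFW : F i < W i := by
    have h1 := mul_lt_mul_of_pos_right hGV hWi
    exact lt_of_mul_lt_mul_left (hi.trans h1) hV.le
  obtain ⟨h', g', u', P', Q', H', D', hz', he'⟩ :=
    exists_enlarged (HJ i) (DJ i) (hz i) (hab i) hWi (hWV i) (hFi i) hFW
  refine ⟨h', g', u', P', Q', H', D', fun x hx => hz' x fun hx' => hx ⟨hx'.1, hx'.2.trans_le ?_⟩,
    ?_⟩
  · refine mul_le_mul_of_nonneg_left ?_ (by positivity)
    rw [le_div_iff₀ hm]
    have h1 := mul_le_mul_of_nonneg_right (hba i) hm.le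
    -- The slab bound δ(b - a) ≤ V - W' meets the linear bound on V - W', and δ cancels.
    refine le_of_mul_le_mul_left (?_ : δ * _ ≤ δ * _) hδ
    linarith
  · have h1 := le_of_mul_le_mul_right (he'.trans hi.le) hWi
    linarith

theorem exists_isMinimizer (hV : 0 < V) (hlt : Fs V < V) : ∃ q, IsMinimizer V q := by
  obtain ⟨L, hL⟩ := exists_near_minimizer_bounded_base hV hlt
  choose h g u P Q H D hz he using fun n : ℕ => hL (1 / ((n : ℝ) + 1)) (by positivity)
  have hlim : Tendsto (fun n : ℕ => Fs V + 1 / ((n : ℝ) + 1)) atTop (𝓝 (Fs V)) := by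
    simpa using (tendsto_one_div_add_atTop_nhds_zero_nat (𝕜 := ℝ)).const_add (Fs V)
  obtain ⟨h', g', u', P', Q', H', D', he'⟩ := exists_limit_film H D hz
    (tendsto_of_tendsto_of_tendsto_of_le_of_le tendsto_const_nhds hlim
      (fun n => Fs_le (H n) (D n)) he)
  refine ⟨(u', h'), mem_admissible H' D', fun q hq => ?_⟩
  rw [mem_ofPred_eq, energy_eq H' D']
  exact he'.trans (Fs_le (isProfile_of_admissible hq) (isDisplacement_of_admissible hq))

/-- The critical volume is the infimum of the volumes with a gain. That set is closed under
enlarging and contains a smaller volume with each of its members, so it is exactly the open half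
line above its infimum. -/
theorem exists_isCriticalVolume :
    ∃ Vbar, IsCriticalVolume Vbar ∧ 0 < Vbar ∧ ∀ V, 0 < V → (Vbar < V ↔ Fs V < V) := by
  set B : Set ℝ := {V | 0 < V ∧ Fs V < V} with hB
  have hne : B.Nonempty := exists_Fs_lt_self
  -- For V < 1/3 one has 8V² < 8/9 < 1, so the lower bound for small volumes applies.
  have hlow : ∀ V ∈ B, (1 / 3 : ℝ) ≤ V := by
    rintro V ⟨hV, hlt⟩
    by_contra hcon
    push Not at hcon
    exact absurd hlt (not_lt.2 (self_le_Fs hV (by nlinarith)))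
  have hbdd : BddBelow B := ⟨1 / 3, hlow⟩
  have hpos : 0 < sInf B := lt_of_lt_of_le (by norm_num) (le_csInf hne hlow)
  have hiff : ∀ V, 0 < V → (sInf B < V ↔ Fs V < V) := by
    refine fun V hV => ⟨fun h => ?_, fun h => ?_⟩
    · obtain ⟨W, ⟨hW, hWlt⟩, hWV⟩ := exists_lt_of_csInf_lt hne h
      exact Fs_lt_self_of_le hW hWlt hWV.le
    · obtain ⟨W, hW, hWV, hWlt⟩ := exists_lt_Fs_lt_self hV h
      exact (csInf_le hbdd ⟨hW, hWlt⟩).trans_lt hWV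
  refine ⟨sInf B, ⟨⟨hpos, fun V hV hle => ?_⟩, fun W hW => ?_⟩, hpos, hiff⟩
  · exact le_antisymm (Fs_le_self hV) (not_lt.1 fun h => not_lt.2 hle ((hiff V hV).2 h))
  · by_contra hcon
    push Not at hcon
    exact ((hiff W hW.1).1 hcon).ne (hW.2 W hW.1 le_rfl)

end EpitaxialFilm

end

theorem mainTheorem3 :
    ∃ Vbar : ℝ, EpitaxialFilm.IsCriticalVolume Vbar ∧
      (∀ V : ℝ, 0 < V → (Vbar < V ↔ EpitaxialFilm.Fs V < V)) ∧
      ∀ V : ℝ, Vbar < V →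
        ∃ q : (ℝ × ℝ → ℝ) × (ℝ → ℝ), EpitaxialFilm.IsMinimizer V q := by
  obtain ⟨Vbar, hcrit, hpos, hiff⟩ := EpitaxialFilm.exists_isCriticalVolume
  exact ⟨Vbar, hcrit, hiff, fun V hV =>
    EpitaxialFilm.exists_isMinimizer (hpos.trans hV) ((hiff V (hpos.trans hV)).1 hV)⟩
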